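/- Assume the Strong Exponential Time Hypothesis (SETH): for every $\varepsilon>0$ there is a $k$ such that satisfiability of $k$-CNF formulas with $n$ variables and $m$ clauses cannot be decided in time $2^{(1-\varepsilon)n}\cdot\mathrm{poly}(n+m)$. Let $\alpha>0$ and let $d:\mathbb N\to\mathbb N$ be any function with $d(n)=\omega(\log n)$, that is, $\log n=o(d(n))$. For points $x_1,\dots,x_n\in\mathbb R^{d'}$ let $A\in\mathbb R^{n\times n}$ be their $\ell_\infty$ distance matrix, $A_{i,j}=\|x_i-x_j\|_\infty$. Then no algorithm that, given $n$, a dimension $d'\le d(n)$, the points $x_1,\dots,x_n$ and a vector $z$, computes the product $Az$ exactly, has running time $O(n^{2-\alpha})$ on the inputs of dimension $d'=d(n)$. This holds already for algorithms that are only required to be correct for points in $\{0,1,2\}^{d'}$ and vectors $z\in\{0,1\}^n$. Algorithms are deterministic word RAM programs. Word operations (arithmetic, bitwise operations, shifts, comparisons) and indexed reads and writes of memory take one step each. The words have $O(\log(n+d'))$ bits for computing $Az$, and $O(n+\log m)$ bits for satisfiability. -/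

import Mathlib

/-! ### A word RAM with a step count -/

namespace WordRAM

/-- The operations on words that take one step.  `sub` is truncated subtraction, `div` and `mod`
are those of `ℕ`, and the comparisons `lt` and `eq` return `1` for true and `0` for false. -/
inductive BinOp : Type
  | add | sub | mul | div | mod | and | or | xor | shl | shr | lt | eq

/-- The value of an operation. -/
def BinOp.eval : BinOp → ℕ → ℕ → ℕ
  | .add, x, y => x + y
  | .sub, x, y => x - y
  | .mul, x, y => x * y
  | .div, x, y => x / y
  | .mod, x, y => x % y
  | .and, x, y => x &&& y
  | .or, x, y => x ||| y
  | .xor, x, y => x ^^^ y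
  | .shl, x, y => x <<< y
  | .shr, x, y => x >>> y
  | .lt, x, y => if x < y then 1 else 0
  | .eq, x, y => if x = y then 1 else 0

/-- A configuration: registers, and memory organised in arrays (`mem a i` is cell `i` of array
`a`).  A program mentions finitely many registers and arrays; cells are addressed by words. -/
structure State : Type where
  reg : ℕ → ℕ
  mem : ℕ → ℕ → ℕ

/-- Write `v` to register `r`. -/
def State.setReg (s : State) (r v : ℕ) : State :=
  { s with reg := Function.update s.reg r v }

/-- Write `v` to cell `i` of array `a`. -/
def State.setMem (s : State) (a i v : ℕ) : State :=
  { s with mem := Function.update s.mem a (Function.update (s.mem a) i v) }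

/-- Structured random-access programs. -/
inductive Prog : Type
  /-- do nothing -/
  | nop : Prog
  /-- `reg r := v` -/
  | const (r v : ℕ) : Prog
  /-- `reg r := o (reg x) (reg y)` -/
  | op (o : BinOp) (r x y : ℕ) : Prog
  /-- `reg r := mem a (reg x)` -/
  | load (r a x : ℕ) : Prog
  /-- `mem a (reg x) := reg y` -/
  | store (a x y : ℕ) : Prog
  /-- first `p`, then `q` -/
  | seq (p q : Prog) : Prog
  /-- `p` if `reg x ≠ 0`, otherwise `q` -/
  | ite (x : ℕ) (p q : Prog) : Prog
  /-- repeat `p` as long as `reg x ≠ 0` -/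
  | loop (x : ℕ) (p : Prog) : Prog

/-- `Exec W p s t s'`: on a machine whose words hold the numbers `0, …, W`, the program `p` started
in `s` halts in `s'` after exactly `t` steps.  Every elementary instruction and every test counts
as one step; a program that produces a number exceeding `W` has no execution. -/
inductive Exec (W : ℕ) : Prog → State → ℕ → State → Prop
  | nop (s : State) : Exec W .nop s 1 s
  | const (r v : ℕ) (s : State) (h : v ≤ W) : Exec W (.const r v) s 1 (s.setReg r v)
  | op (o : BinOp) (r x y : ℕ) (s : State) (h : o.eval (s.reg x) (s.reg y) ≤ W) :
      Exec W (.op o r x y) s 1 (s.setReg r (o.eval (s.reg x) (s.reg y)))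
  | load (r a x : ℕ) (s : State) :
      Exec W (.load r a x) s 1 (s.setReg r (s.mem a (s.reg x)))
  | store (a x y : ℕ) (s : State) :
      Exec W (.store a x y) s 1 (s.setMem a (s.reg x) (s.reg y))
  | seq {p q : Prog} {s s' s'' : State} {t t' : ℕ}
      (hp : Exec W p s t s') (hq : Exec W q s' t' s'') : Exec W (.seq p q) s (t + t') s''
  | iteTrue {x : ℕ} {p q : Prog} {s s' : State} {t : ℕ} (h : s.reg x ≠ 0)
      (hp : Exec W p s t s') : Exec W (.ite x p q) s (t + 1) s'
  | iteFalse {x : ℕ} {p q : Prog} {s s' : State} {t : ℕ} (h : s.reg x = 0)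
      (hq : Exec W q s t s') : Exec W (.ite x p q) s (t + 1) s'
  | loopStop {x : ℕ} {p : Prog} {s : State} (h : s.reg x = 0) : Exec W (.loop x p) s 1 s
  | loopStep {x : ℕ} {p : Prog} {s s' s'' : State} {t t' : ℕ} (h : s.reg x ≠ 0)
      (hp : Exec W p s t s') (hl : Exec W (.loop x p) s' t' s'') :
      Exec W (.loop x p) s (t + t' + 1) s''

end WordRAM

/-! ### k-SAT and the Strong Exponential Time Hypothesis -/

/-- A `k`-CNF formula with `n` variables and `m` clauses.  A literal is a variable together with
the truth value that makes it true.  Literals may be repeated in a clause, so that clauses with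
fewer than `k` distinct literals are included. -/
abbrev KCNF (k n m : ℕ) : Type := Fin m → Fin k → Fin n × Bool

/-- Some assignment makes a literal of every clause true. -/
def KCNF.Satisfiable {k n m : ℕ} (φ : KCNF k n m) : Prop :=
  ∃ a : Fin n → Bool, ∀ i, ∃ j, a (φ i j).1 = (φ i j).2

/-- The initial configuration for a formula: `n` and `m` in registers `0` and `1`, and the list of
clauses in array `0`, where a literal on variable `v` is the number `2 v + 1` if it is positive and
`2 v` if it is negated. -/
def KCNF.input {k n m : ℕ} (φ : KCNF k n m) : WordRAM.State where
  reg
    | 0 => n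
    | 1 => m
    | _ => 0
  mem
    | 0 => fun i =>
        if h : i < m * k then
          let ij := finProdFinEquiv.symm ⟨i, h⟩
          2 * ((φ ij.1 ij.2).1 : ℕ) + (φ ij.1 ij.2).2.toNat
        else 0
    | _ => fun _ => 0

/-- Some word RAM program decides satisfiability of `k`-CNF formulas with `n` variables and `m`
clauses in time `2 ^ (δ n) * poly (n + m)`, with words of `O(n + log m)` bits; the answer
(`1` for satisfiable, `0` for unsatisfiable) is left in register `0`. -/
def KSATSolvableInTime (k : ℕ) (δ : ℝ) : Prop :=
  ∃ (P : WordRAM.Prog) (C : ℕ), ∀ (n m : ℕ) (φ : KCNF k n m), ∃ (t : ℕ) (s : WordRAM.State),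
    WordRAM.Exec ((2 ^ n * (m + 2)) ^ C) P φ.input t s ∧
    (t : ℝ) ≤ C * (2 : ℝ) ^ (δ * n) * ((n : ℝ) + m + 1) ^ C ∧
    (φ.Satisfiable → s.reg 0 = 1) ∧ (¬ φ.Satisfiable → s.reg 0 = 0)

/-- The Strong Exponential Time Hypothesis: for every `ε > 0` there is a `k` such that `k`-SAT
cannot be solved in time `2 ^ ((1 - ε) n)`, up to polynomial factors. -/
def SETH : Prop := ∀ ε : ℝ, 0 < ε → ∃ k : ℕ, ¬ KSATSolvableInTime k (1 - ε)

/-! ### Matrix-vector products with `ℓ_∞` distance matrices -/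

/-- The matrix `A i j = ‖x i - x j‖_∞` (the norm of `Fin d → ℝ` is the maximum norm). -/
noncomputable def linftyDistMatrix {n d : ℕ} (x : Fin n → Fin d → ℝ) :
    Matrix (Fin n) (Fin n) ℝ :=
  Matrix.of fun i j => ‖x i - x j‖

/-- The initial configuration for `n` points of `{0,1,2}^d` and a vector of `{0,1}^n`: `n` and `d`
in registers `0` and `1`, the coordinates of the points, point after point, in array `0`, and the
vector in array `1`. -/
def matVecInput {n d : ℕ} (x : Fin n → Fin d → Fin 3) (z : Fin n → Fin 2) : WordRAM.State where
  reg
    | 0 => n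
    | 1 => d
    | _ => 0
  mem
    | 0 => fun i =>
        if h : i < n * d then
          let ij := finProdFinEquiv.symm ⟨i, h⟩
          (x ij.1 ij.2 : ℕ)
        else 0
    | 1 => fun i => if h : i < n then (z ⟨i, h⟩ : ℕ) else 0
    | _ => fun _ => 0

/-- The program `P`, on words of `O(log (n + d))` bits, computes (into array `2`) the product `A z`
exactly for every set of `n` points in `{0,1,2}^d`, with `ℓ_∞` distance matrix `A`, every
`z ∈ {0,1}^n` and every dimension `d ≤ D n`; and if `d = D n` it takes at most `T n` steps. -/
def ComputesLinftyMatVec (P : WordRAM.Prog) (D T : ℕ → ℕ) : Prop :=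
  ∃ C : ℕ, ∀ n d : ℕ, d ≤ D n → ∀ (x : Fin n → Fin d → Fin 3) (z : Fin n → Fin 2),
    ∃ (t : ℕ) (s : WordRAM.State),
      WordRAM.Exec ((n + d + 2) ^ C) P (matVecInput x z) t s ∧
      (d = D n → t ≤ T n) ∧
      ∀ i : Fin n, (s.mem 2 i : ℝ) =
        (linftyDistMatrix (fun i j => ((x i j : ℕ) : ℝ))).mulVec (fun j => ((z j : ℕ) : ℝ)) i

/-! Suppose that a program `P` computes the products in `T N = O(N ^ (2 - α))` steps, and let `1 / b
≤ α`. The proof turns `P` into a decision procedure for `k`-SAT that runs in time `2 ^ ((1 - 1 / (8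
b)) n)` up to a polynomial factor, with the same `b` for every `k`. This contradicts SETH.

The gadget. Split the variables into two groups. A partial assignment of the first group becomes a
point with one coordinate per clause: 1 if the clause is already satisfied, 0 if not. For the second
group the values are 1 and 2. Two points from different groups are at distance 2 exactly if some
clause is satisfied by neither assignment; otherwise they are closer. If `z` is the indicator of the
second group, then a row of the first group attains the maximal value of the product unless its
assignment extends to a satisfying one (`gadget_mulVec_lt`). So one product examines all pairs of `2
^ g` first and `2 ^ g` second assignments.

Sparsification. Since `D N` is only known to exceed every multiple of `log N`, the number of clauses
has to be linear in the number of variables. A formula is regarded as a family of sets of literals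
that the set of true literals has to hit. While many sets of one size share a common part `H`, one
branches: either `H` itself is hit, or all the petals are (`hits_branch`). A potential, the total
weight of the sets added so far, never exceeds a small multiple of the number of literals
(`Inv.Wt_le`). It grows a little when `H` is added and a lot when the petals are added. The
resulting recurrence (`two_rpow_neg_add_le`, `Budget.branch`) gives a tree of size `2 ^ (n / (8 b))`
up to a constant. Its leaves have linearly many clauses (`card_le_of_not_heavy`).

The unknown dimension. `D` is arbitrary, possibly uncomputable, and the time bound holds only in
dimension `D N`. Therefore `P` is simulated with a clock (`Prog.sim_exec`). If the clock runs out,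
the dimension `d ≤ D N` was not `D N`, and `d` is increased by one; the padding coordinates are 0.
The value of `d` is kept for the rest of the computation, so at most `D N` calls fail altogether.
Moreover `D N ≤ T N`, because a program has to read every coordinate of a point
(`ComputesLinftyMatVec.dim_le`). The failed calls thus cost about `T N ^ 2`. To keep this below `2 ^
n`, the instances have `N ≈ 2 ^ (n / 4)` points instead of `2 ^ (n / 2)`, and the second group of
assignments is treated in about `2 ^ (n / 2)` blocks. One leaf then takes about `2 ^ (n / 2) * N ^
(2 - 1 / b) = 2 ^ (n - n / (4 b))` steps, and half of this saving pays for the sparsification tree.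

All of this is written in a small command language that compiles to RAM programs, and it is verified
by weakest preconditions in which the running time appears as a credit. Each call of `P` uses memory
that has never been touched. Hence nothing is ever cleared, and addresses remain polynomial in `2 ^
n * (m + 2)`. -/

set_option linter.unusedSimpArgs false

/-! ### Expressions and commands compiled to word RAM programs -/

namespace WordRAM

/-- All registers and cells hold words. -/
def State.Bounded (W : ℕ) (s : State) : Prop := (∀ r, s.reg r ≤ W) ∧ ∀ a i, s.mem a i ≤ W

@[simp] theorem State.setReg_reg (s : State) (r v r' : ℕ) :
    (s.setReg r v).reg r' = if r' = r then v else s.reg r' := by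
  simp [State.setReg, Function.update_apply]

@[simp] theorem State.setReg_mem (s : State) (r v : ℕ) : (s.setReg r v).mem = s.mem := rfl

@[simp] theorem State.setMem_reg (s : State) (a i v : ℕ) : (s.setMem a i v).reg = s.reg := rfl

theorem State.setMem_mem (s : State) (a i v a' : ℕ) :
    (s.setMem a i v).mem a' = if a' = a then Function.update (s.mem a) i v else s.mem a' := by
  simp only [State.setMem, Function.update_apply]

theorem State.setMem_mem_apply (s : State) (a i v a' i' : ℕ) :
    (s.setMem a i v).mem a' i' = if a' = a ∧ i' = i then v else s.mem a' i' := by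
  rw [State.setMem_mem]
  by_cases h : a' = a
  · subst h; by_cases h' : i' = i <;> simp [h']
  · simp [h]

theorem State.Bounded.setReg {W : ℕ} {s : State} (h : s.Bounded W) {r v : ℕ} (hv : v ≤ W) :
    (s.setReg r v).Bounded W := by
  refine ⟨fun r' => ?_, h.2⟩
  rw [State.setReg_reg]; split_ifs
  exacts [hv, h.1 _]

theorem State.Bounded.setMem {W : ℕ} {s : State} (h : s.Bounded W) {a i v : ℕ} (hv : v ≤ W) :
    (s.setMem a i v).Bounded W := by
  refine ⟨h.1, fun a' i' => ?_⟩
  rw [State.setMem_mem_apply]; split_ifs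
  exacts [hv, h.2 _ _]

theorem Exec.bounded {W : ℕ} {p : Prog} {s s' : State} {t : ℕ} (h : Exec W p s t s')
    (hs : s.Bounded W) : s'.Bounded W := by
  induction h with
  | nop | loopStop => exact hs
  | const r v s h => exact hs.setReg h
  | op o r x y s h => exact hs.setReg h
  | load r a x s => exact hs.setReg (hs.2 _ _)
  | store a x y s => exact hs.setMem (hs.1 _)
  | seq _ _ ih1 ih2 => exact ih2 (ih1 hs)
  | iteTrue _ _ ih => exact ih hs
  | iteFalse _ _ ih => exact ih hs
  | loopStep _ _ _ ih1 ih2 => exact ih2 (ih1 hs)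

theorem Exec.mono {W W' : ℕ} (hW : W ≤ W') {p : Prog} {s s' : State} {t : ℕ}
    (h : Exec W p s t s') : Exec W' p s t s' := by
  induction h with
  | nop => exact .nop _
  | loopStop h => exact .loopStop h
  | const r v s h => exact .const _ _ _ (h.trans hW)
  | op o r x y s h => exact .op _ _ _ _ _ (h.trans hW)
  | load r a x s => exact .load _ _ _ _
  | store a x y s => exact .store _ _ _ _
  | seq _ _ ih1 ih2 => exact .seq ih1 ih2
  | iteTrue h _ ih => exact .iteTrue h ih
  | iteFalse h _ ih => exact .iteFalse h ih
  | loopStep h _ _ ih1 ih2 => exact .loopStep h ih1 ih2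

/-- Expressions over registers and memory. -/
inductive Expr : Type
  | lit (v : ℕ) : Expr
  | reg (r : ℕ) : Expr
  | op (o : BinOp) (a b : Expr) : Expr
  | load (a : ℕ) (e : Expr) : Expr

namespace Expr

/-- The value of an expression. -/
def eval : Expr → State → ℕ
  | lit v, _ => v
  | reg r, s => s.reg r
  | op o a b, s => o.eval (a.eval s) (b.eval s)
  | load a e, s => s.mem a (e.eval s)

/-- The number of steps of an evaluation. -/
def cost : Expr → ℕ
  | lit _ => 1
  | reg _ => 1
  | op _ a b => a.cost + b.cost + 1
  | load _ e => e.cost + 1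

/-- A bound for the registers that occur. -/
def regBound : Expr → ℕ
  | lit _ => 0
  | reg r => r + 1
  | op _ a b => max a.regBound b.regBound
  | load _ e => e.regBound

end Expr

/-- The value of an operation on words is a word again (a condition only for those operations
that can produce larger numbers). -/
def BinOp.Fits (W : ℕ) : BinOp → ℕ → ℕ → Prop
  | .add, x, y => x + y ≤ W
  | .mul, x, y => x * y ≤ W
  | .or, x, y => x ||| y ≤ W
  | .xor, x, y => x ^^^ y ≤ W
  | .shl, x, y => x <<< y ≤ W
  | _, _, _ => True

theorem BinOp.Fits.eval_le {W : ℕ} (hW : 1 ≤ W) {o : BinOp} {x y : ℕ} (h : o.Fits W x y)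
    (hx : x ≤ W) : o.eval x y ≤ W := by
  cases o <;> simp only [BinOp.Fits, BinOp.eval] at h ⊢
  case sub => omega
  case div => exact (Nat.div_le_self _ _).trans hx
  case mod => exact (Nat.mod_le _ _).trans hx
  case and => exact Nat.and_le_left.trans hx
  case shr => rw [Nat.shiftRight_eq_div_pow]; exact (Nat.div_le_self _ _).trans hx
  case lt => split_ifs <;> omega
  case eq => split_ifs <;> omega
  all_goals exact h

namespace Expr

/-- All intermediate values are words. -/
def Ok (W : ℕ) : Expr → State → Prop
  | lit v, _ => v ≤ W
  | reg _, _ => True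
  | op o a b, s => a.Ok W s ∧ b.Ok W s ∧ o.Fits W (a.eval s) (b.eval s)
  | load _ e, s => e.Ok W s

/-- Code that leaves the value in register `d`, using registers from `d` on. -/
def compile : Expr → ℕ → Prog
  | lit v, d => .const d v
  | reg r, d => .op .or d r r
  | op o a b, d => .seq (a.compile d) (.seq (b.compile (d + 1)) (.op o d d (d + 1)))
  | load a e, d => .seq (e.compile d) (.load d a d)

theorem eval_congr {e : Expr} {s s' : State} (hr : ∀ r < e.regBound, s.reg r = s'.reg r)
    (hm : s.mem = s'.mem) : e.eval s = e.eval s' := by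
  induction e with
  | lit => rfl
  | reg r => exact hr r (Nat.lt_succ_self r)
  | op o a b iha ihb =>
    simp only [regBound] at hr
    simp only [eval]
    rw [iha fun r h => hr r (by omega), ihb fun r h => hr r (by omega)]
  | load a e ih => simp only [eval]; rw [ih hr, hm]

theorem Ok.congr {W : ℕ} {e : Expr} {s s' : State} (hr : ∀ r < e.regBound, s.reg r = s'.reg r)
    (hm : s.mem = s'.mem) (h : e.Ok W s) : e.Ok W s' := by
  induction e with
  | lit => exact h
  | reg r => trivial
  | op o a b iha ihb =>
    simp only [regBound] at hr
    have ha : ∀ r < a.regBound, s.reg r = s'.reg r := fun r h => hr r (by omega)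
    have hb : ∀ r < b.regBound, s.reg r = s'.reg r := fun r h => hr r (by omega)
    exact ⟨iha ha h.1, ihb hb h.2.1, by rw [← eval_congr ha hm, ← eval_congr hb hm]; exact h.2.2⟩
  | load a e ih => exact ih hr h

/-- The left operand waits in register `d` while the right one is computed in the registers from `d
+ 1` on. As `regBound ≤ d`, no register that the expression reads is overwritten. -/
theorem exec_compile {W : ℕ} (hW : 1 ≤ W) (e : Expr) : ∀ {s : State} {d : ℕ}, s.Bounded W →
    e.regBound ≤ d → e.Ok W s → ∃ s', Exec W (e.compile d) s e.cost s' ∧ s'.mem = s.mem ∧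
      (∀ r < d, s'.reg r = s.reg r) ∧ s'.reg d = e.eval s ∧ s'.Bounded W := by
  induction e with
  | lit v =>
    intro s d hs _ h
    exact ⟨_, .const _ _ _ h, rfl, fun r hr => by simp [hr.ne], by simp [eval], hs.setReg h⟩
  | reg r =>
    intro s d hs hd _
    refine ⟨_, .op .or d r r s ?_, rfl, fun r hr => by simp [hr.ne],
      by simp [eval, BinOp.eval], hs.setReg ?_⟩ <;> simp [BinOp.eval, hs.1]
  | op o a b iha ihb =>
    intro s d hs hd h
    simp only [regBound] at hd
    obtain ⟨s₁, e₁, m₁, r₁, v₁, b₁⟩ := iha (d := d) hs (by omega) h.1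
    have hb : ∀ r < b.regBound, s.reg r = s₁.reg r := fun r h => (r₁ r (by omega)).symm
    obtain ⟨s₂, e₂, m₂, r₂, v₂, b₂⟩ := ihb (d := d + 1) b₁ (by omega) (h.2.1.congr hb m₁.symm)
    have hv1 : s₂.reg d = a.eval s := by rw [r₂ d (by omega), v₁]
    have hv2 : s₂.reg (d + 1) = b.eval s := by rw [v₂, eval_congr hb m₁.symm]
    have hle : o.eval (s₂.reg d) (s₂.reg (d + 1)) ≤ W :=
      BinOp.Fits.eval_le hW (by rw [hv1, hv2]; exact h.2.2) (b₂.1 _)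
    refine ⟨_, ?_, ?_, ?_, ?_, b₂.setReg (r := d) hle⟩
    · have := Exec.seq e₁ (.seq e₂ (.op o d d (d + 1) s₂ hle))
      simpa [cost, compile, add_assoc] using this
    · simp [m₁, m₂]
    · intro r hr
      simp [hr.ne, r₂ r (by omega), r₁ r hr]
    · simp [eval, hv1, hv2]
  | load a e ih =>
    intro s d hs hd h
    obtain ⟨s₁, e₁, m₁, r₁, v₁, b₁⟩ := ih hs hd h
    refine ⟨_, .seq e₁ (.load d a d s₁), ?_, ?_, ?_, b₁.setReg (b₁.2 _ _)⟩
    · simp [m₁]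
    · intro r hr; simp [hr.ne, r₁ r hr]
    · simp [eval, v₁, m₁]

end Expr

/-- Structured programs whose elementary steps evaluate expressions. -/
inductive Cmd : Type
  | skip : Cmd
  | set (r : ℕ) (e : Expr) : Cmd
  | store (a : ℕ) (i v : Expr) : Cmd
  | seq (p q : Cmd) : Cmd
  | ite (e : Expr) (p q : Cmd) : Cmd
  | while (e : Expr) (p : Cmd) : Cmd

/-- `CExec W c s t s'`: the command `c` takes `s` to `s'` in `t` steps. -/
inductive CExec (W : ℕ) : Cmd → State → ℕ → State → Prop
  | skip (s : State) : CExec W .skip s 1 s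
  | set {r : ℕ} {e : Expr} {s : State} (h : e.Ok W s) :
      CExec W (.set r e) s (e.cost + 1) (s.setReg r (e.eval s))
  | store {a : ℕ} {i v : Expr} {s : State} (hi : i.Ok W s) (hv : v.Ok W s) :
      CExec W (.store a i v) s (i.cost + v.cost + 1) (s.setMem a (i.eval s) (v.eval s))
  | seq {p q : Cmd} {s s' s'' : State} {t t' : ℕ} (hp : CExec W p s t s')
      (hq : CExec W q s' t' s'') : CExec W (.seq p q) s (t + t') s''
  | iteTrue {e : Expr} {p q : Cmd} {s s' : State} {t : ℕ} (he : e.Ok W s) (h : e.eval s ≠ 0)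
      (hp : CExec W p s t s') : CExec W (.ite e p q) s (e.cost + t + 1) s'
  | iteFalse {e : Expr} {p q : Cmd} {s s' : State} {t : ℕ} (he : e.Ok W s) (h : e.eval s = 0)
      (hq : CExec W q s t s') : CExec W (.ite e p q) s (e.cost + t + 1) s'
  | whileStop {e : Expr} {p : Cmd} {s : State} (he : e.Ok W s) (h : e.eval s = 0) :
      CExec W (.while e p) s (e.cost + 1) s
  | whileStep {e : Expr} {p : Cmd} {s s' s'' : State} {t t' : ℕ} (he : e.Ok W s)
      (h : e.eval s ≠ 0) (hp : CExec W p s t s') (hl : CExec W (.while e p) s' t' s'') :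
      CExec W (.while e p) s (e.cost + t + 1 + t') s''

namespace Cmd

/-- A bound for the registers that occur. -/
def regBound : Cmd → ℕ
  | skip => 0
  | set r e => max (r + 1) e.regBound
  | store _ i v => max i.regBound v.regBound
  | seq p q => max p.regBound q.regBound
  | ite e p q => max e.regBound (max p.regBound q.regBound)
  | .while e p => max e.regBound p.regBound

/-- Translation into a word RAM program that uses the registers from `d` on for intermediate
results. -/
def compile (d : ℕ) : Cmd → Prog
  | skip => .nop
  | set r e => .seq (e.compile d) (.op .or r d d)
  | store a i v => .seq (i.compile d) (.seq (v.compile (d + 1)) (.store a d (d + 1)))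
  | seq p q => .seq (p.compile d) (q.compile d)
  | ite e p q => .seq (e.compile d) (.ite d (p.compile d) (q.compile d))
  | .while e p => .seq (e.compile d) (.loop d (.seq (p.compile d) (e.compile d)))

/-- The registers that are written. -/
def wregs : Cmd → List ℕ
  | skip => []
  | set r _ => [r]
  | store _ _ _ => []
  | seq p q => p.wregs ++ q.wregs
  | ite _ p q => p.wregs ++ q.wregs
  | .while _ p => p.wregs

/-- The arrays that are written. -/
def warrs : Cmd → List ℕ
  | skip => []
  | set _ _ => []
  | store a _ _ => [a]
  | seq p q => p.warrs ++ q.warrs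
  | ite _ p q => p.warrs ++ q.warrs
  | .while _ p => p.warrs

end Cmd

/-- The two runs are related by equality of the memory and of the registers below `d`; the registers
from `d` on are scratch space. The step counts agree exactly because the costs in `CExec` are those
of the compiled code. -/
theorem CExec.compile {W d : ℕ} (hW : 1 ≤ W) {c : Cmd} {s s' : State} {t : ℕ}
    (h : CExec W c s t s') : ∀ {s₁ : State}, c.regBound ≤ d → s₁.Bounded W →
      (∀ r < d, s.reg r = s₁.reg r) → s.mem = s₁.mem →
      ∃ s₁', Exec W (c.compile d) s₁ t s₁' ∧ s₁'.Bounded W ∧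
        (∀ r < d, s'.reg r = s₁'.reg r) ∧ s'.mem = s₁'.mem := by
  induction h with
  | skip s => intro s₁ _ hb hr hm; exact ⟨s₁, .nop _, hb, hr, hm⟩
  | @set r e s h =>
    intro s₁ hd hb hr hm
    simp only [Cmd.regBound] at hd
    have hc : ∀ r < e.regBound, s.reg r = s₁.reg r := fun r h => hr r (by omega)
    obtain ⟨s₂, e₂, m₂, r₂, v₂, b₂⟩ := e.exec_compile hW hb (d := d) (by omega) (h.congr hc hm)
    have hv : BinOp.or.eval (s₂.reg d) (s₂.reg d) = e.eval s := by
      simp [BinOp.eval, v₂, Expr.eval_congr hc hm]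
    have hle : BinOp.or.eval (s₂.reg d) (s₂.reg d) ≤ W := by simp [BinOp.eval, b₂.1]
    refine ⟨_, .seq e₂ (.op .or r d d s₂ hle), b₂.setReg hle, fun r' hr' => ?_, ?_⟩
    · rw [hv, State.setReg_reg, State.setReg_reg]
      split_ifs with h'
      · rfl
      · rw [r₂ r' hr', hr r' hr']
    · simp [m₂, hm]
  | @store a i v s hi hv =>
    intro s₁ hd hb hr hm
    simp only [Cmd.regBound] at hd
    have hci : ∀ r < i.regBound, s.reg r = s₁.reg r := fun r h => hr r (by omega)
    have hcv : ∀ r < v.regBound, s.reg r = s₁.reg r := fun r h => hr r (by omega)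
    obtain ⟨s₂, e₂, m₂, r₂, v₂, b₂⟩ := i.exec_compile hW hb (d := d) (by omega) (hi.congr hci hm)
    have hcv' : ∀ r < v.regBound, s.reg r = s₂.reg r := fun r h => by
      rw [r₂ r (by omega), hcv r h]
    have hm' : s.mem = s₂.mem := by rw [m₂, hm]
    obtain ⟨s₃, e₃, m₃, r₃, v₃, b₃⟩ :=
      v.exec_compile hW b₂ (d := d + 1) (by omega) (hv.congr hcv' hm')
    refine ⟨_, ?_, b₃.setMem (b₃.1 (d + 1)) (a := a) (i := s₃.reg d), ?_, ?_⟩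
    · have := Exec.seq e₂ (.seq e₃ (.store a d (d + 1) s₃))
      simpa [add_assoc, Cmd.compile] using this
    · intro r h
      simp [r₃ r (by omega), r₂ r h, hr r h]
    · rw [r₃ d (by omega), v₂, v₃, ← Expr.eval_congr hci hm, ← Expr.eval_congr hcv' hm']
      simp only [State.setMem, m₃, m₂, hm]
  | seq _ _ ih1 ih2 =>
    intro s₁ hd hb hr hm
    simp only [Cmd.regBound] at hd
    obtain ⟨s₂, e₂, b₂, r₂, m₂⟩ := ih1 (by omega) hb hr hm
    obtain ⟨s₃, e₃, b₃, r₃, m₃⟩ := ih2 (by omega) b₂ r₂ m₂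
    exact ⟨s₃, .seq e₂ e₃, b₃, r₃, m₃⟩
  | @iteTrue e p q s s' t he h _ ih =>
    intro s₁ hd hb hr hm
    simp only [Cmd.regBound] at hd
    have hc : ∀ r < e.regBound, s.reg r = s₁.reg r := fun r h => hr r (by omega)
    obtain ⟨s₂, e₂, m₂, r₂, v₂, b₂⟩ := e.exec_compile hW hb (d := d) (by omega) (he.congr hc hm)
    obtain ⟨s₃, e₃, b₃, r₃, m₃⟩ := ih (by omega) b₂ (fun r h => by rw [r₂ r h, hr r h])
      (by rw [m₂, hm])
    refine ⟨s₃, ?_, b₃, r₃, m₃⟩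
    have := Exec.seq e₂ (.iteTrue (q := q.compile d) (by rwa [v₂, ← Expr.eval_congr hc hm]) e₃)
    simpa [add_assoc, Cmd.compile] using this
  | @iteFalse e p q s s' t he h _ ih =>
    intro s₁ hd hb hr hm
    simp only [Cmd.regBound] at hd
    have hc : ∀ r < e.regBound, s.reg r = s₁.reg r := fun r h => hr r (by omega)
    obtain ⟨s₂, e₂, m₂, r₂, v₂, b₂⟩ := e.exec_compile hW hb (d := d) (by omega) (he.congr hc hm)
    obtain ⟨s₃, e₃, b₃, r₃, m₃⟩ := ih (by omega) b₂ (fun r h => by rw [r₂ r h, hr r h])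
      (by rw [m₂, hm])
    refine ⟨s₃, ?_, b₃, r₃, m₃⟩
    have := Exec.seq e₂ (.iteFalse (p := p.compile d) (by rwa [v₂, ← Expr.eval_congr hc hm]) e₃)
    simpa [add_assoc, Cmd.compile] using this
  | @whileStop e p s he h =>
    intro s₁ hd hb hr hm
    simp only [Cmd.regBound] at hd
    have hc : ∀ r < e.regBound, s.reg r = s₁.reg r := fun r h => hr r (by omega)
    obtain ⟨s₂, e₂, m₂, r₂, v₂, b₂⟩ := e.exec_compile hW hb (d := d) (by omega) (he.congr hc hm)
    exact ⟨s₂, .seq e₂ (.loopStop (by rwa [v₂, ← Expr.eval_congr hc hm])), b₂,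
      fun r h => by rw [r₂ r h, hr r h], by rw [m₂, hm]⟩
  | @whileStep e p s s' s'' t t' he h _ _ ih1 ih2 =>
    intro s₁ hd hb hr hm
    have hd' := hd
    simp only [Cmd.regBound] at hd
    have hc : ∀ r < e.regBound, s.reg r = s₁.reg r := fun r h => hr r (by omega)
    obtain ⟨s₂, e₂, m₂, r₂, v₂, b₂⟩ := e.exec_compile hW hb (d := d) (by omega) (he.congr hc hm)
    obtain ⟨s₃, e₃, b₃, r₃, m₃⟩ := ih1 (by omega) b₂ (fun r h => by rw [r₂ r h, hr r h])
      (by rw [m₂, hm])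
    obtain ⟨s₄, e₄, b₄, r₄, m₄⟩ := ih2 hd' b₃ r₃ m₃
    refine ⟨s₄, ?_, b₄, r₄, m₄⟩
    have h2 : s₂.reg d ≠ 0 := by rwa [v₂, ← Expr.eval_congr hc hm]
    -- The code for the remaining rounds begins with an evaluation of the guard. It is split off and
    -- becomes the end of the first round.
    simp only [Cmd.compile] at e₄ ⊢
    cases e₄ with
    | @seq _ _ _ s₅ _ t₁ t₂ e₅ e₆ =>
      have := Exec.seq e₂ (.loopStep h2 (.seq e₃ e₅) e₆)
      rwa [show e.cost + (t + t₁ + t₂ + 1) = e.cost + t + 1 + (t₁ + t₂) by ring] at this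

/-- `s'` agrees with `s` outside the registers and arrays written by `c`. -/
def Frame (c : Cmd) (s s' : State) : Prop :=
  (∀ r, r ∉ c.wregs → s'.reg r = s.reg r) ∧ ∀ a, a ∉ c.warrs → s'.mem a = s.mem a

theorem Frame.refl (c : Cmd) (s : State) : Frame c s s := ⟨fun _ _ => rfl, fun _ _ => rfl⟩

theorem Frame.trans {c : Cmd} {s s' s'' : State} (h : Frame c s s') (h' : Frame c s' s'') :
    Frame c s s'' :=
  ⟨fun r hr => (h'.1 r hr).trans (h.1 r hr), fun a ha => (h'.2 a ha).trans (h.2 a ha)⟩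

theorem Frame.mono {c c' : Cmd} {s s' : State} (h : Frame c s s') (h1 : c.wregs ⊆ c'.wregs)
    (h2 : c.warrs ⊆ c'.warrs) : Frame c' s s' :=
  ⟨fun r hr => h.1 r fun h' => hr (h1 h'), fun a ha => h.2 a fun h' => ha (h2 h')⟩

/-- What a command leaves alone can be read off its syntax, so the specifications below need to
mention only what changes. -/
theorem CExec.frame {W : ℕ} {c : Cmd} {s s' : State} {t : ℕ} (h : CExec W c s t s') :
    Frame c s s' := by
  induction h with
  | skip => exact .refl _ _
  | set => exact ⟨fun r hr => by simp_all [Cmd.wregs], fun _ _ => rfl⟩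
  | store => exact ⟨fun _ _ => rfl, fun a ha => by simp_all [Cmd.warrs, State.setMem_mem]⟩
  | seq _ _ ih1 ih2 =>
    exact (ih1.mono (by simp [Cmd.wregs]) (by simp [Cmd.warrs])).trans
      (ih2.mono (by simp [Cmd.wregs]) (by simp [Cmd.warrs]))
  | iteTrue _ _ _ ih => exact ih.mono (by simp [Cmd.wregs]) (by simp [Cmd.warrs])
  | iteFalse _ _ _ ih => exact ih.mono (by simp [Cmd.wregs]) (by simp [Cmd.warrs])
  | whileStop => exact .refl _ _
  | whileStep _ _ _ _ ih1 ih2 =>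
      exact (ih1.mono (by simp [Cmd.wregs]) (by simp [Cmd.warrs])).trans ih2

/-! ### Weakest preconditions -/

/-- The command `c` started in `s` halts after `t` steps in `s'` with `Q t s'`. -/
def wp (W : ℕ) (c : Cmd) (s : State) (Q : ℕ → State → Prop) : Prop :=
  ∃ t s', CExec W c s t s' ∧ Q t s'

theorem wp.mono {W : ℕ} {c : Cmd} {s : State} {Q Q' : ℕ → State → Prop} (h : wp W c s Q)
    (hQ : ∀ t s', Frame c s s' → Q t s' → Q' t s') : wp W c s Q' := by
  obtain ⟨t, s', h1, h2⟩ := h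
  exact ⟨t, s', h1, hQ t s' h1.frame h2⟩

theorem wp_skip {W : ℕ} {s : State} {Q : ℕ → State → Prop} : wp W .skip s Q ↔ Q 1 s :=
  ⟨fun ⟨_, _, h1, h2⟩ => by cases h1; exact h2, fun h => ⟨_, _, .skip _, h⟩⟩

theorem wp_set {W r : ℕ} {e : Expr} {s : State} {Q : ℕ → State → Prop} :
    wp W (.set r e) s Q ↔ e.Ok W s ∧ Q (e.cost + 1) (s.setReg r (e.eval s)) :=
  ⟨fun ⟨_, _, h1, h2⟩ => by cases h1; exact ⟨‹_›, h2⟩, fun h => ⟨_, _, .set h.1, h.2⟩⟩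

theorem wp_store {W a : ℕ} {i v : Expr} {s : State} {Q : ℕ → State → Prop} :
    wp W (.store a i v) s Q ↔ i.Ok W s ∧ v.Ok W s ∧
      Q (i.cost + v.cost + 1) (s.setMem a (i.eval s) (v.eval s)) :=
  ⟨fun ⟨_, _, h1, h2⟩ => by cases h1; exact ⟨‹_›, ‹_›, h2⟩,
    fun h => ⟨_, _, .store h.1 h.2.1, h.2.2⟩⟩

theorem wp_seq {W : ℕ} {p q : Cmd} {s : State} {Q : ℕ → State → Prop} :
    wp W (.seq p q) s Q ↔ wp W p s fun t s' => wp W q s' fun t' s'' => Q (t + t') s'' := by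
  constructor
  · rintro ⟨_, _, h1, h2⟩
    cases h1 with
    | seq hp hq => exact ⟨_, _, hp, _, _, hq, h2⟩
  · rintro ⟨_, _, hp, _, _, hq, h2⟩
    exact ⟨_, _, .seq hp hq, h2⟩

theorem wp_ite {W : ℕ} {e : Expr} {p q : Cmd} {s : State} {Q : ℕ → State → Prop} :
    wp W (.ite e p q) s Q ↔ e.Ok W s ∧
      (e.eval s ≠ 0 → wp W p s fun t s' => Q (e.cost + t + 1) s') ∧
      (e.eval s = 0 → wp W q s fun t s' => Q (e.cost + t + 1) s') := by
  constructor
  · rintro ⟨_, _, h1, h2⟩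
    cases h1 with
    | iteTrue he h hp => exact ⟨he, fun _ => ⟨_, _, hp, h2⟩, fun h' => absurd h' h⟩
    | iteFalse he h hp => exact ⟨he, fun h' => absurd h h', fun _ => ⟨_, _, hp, h2⟩⟩
  · rintro ⟨he, h1, h2⟩
    by_cases h : e.eval s = 0
    · obtain ⟨_, _, hq, h'⟩ := h2 h
      exact ⟨_, _, .iteFalse he h hq, h'⟩
    · obtain ⟨_, _, hq, h'⟩ := h1 h
      exact ⟨_, _, .iteTrue he h hq, h'⟩

/-- A loop terminates if an invariant holds that includes a credit from which the steps are paid. -/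
theorem wp_while {W : ℕ} {e : Expr} {c : Cmd} (I : State → ℕ → Prop)
    (hok : ∀ s p, I s p → e.Ok W s)
    (hI : ∀ s p, I s p → e.eval s ≠ 0 →
      wp W c s fun t s' => ∃ p', I s' p' ∧ t + e.cost + 1 + p' ≤ p) {s : State} {p : ℕ}
    (h : I s p) :
    wp W (.while e c) s fun t s' => ∃ p', I s' p' ∧ e.eval s' = 0 ∧ t + p' ≤ p + (e.cost + 1) := by
  induction p using Nat.strong_induction_on generalizing s with
  | _ p ih =>
    by_cases h0 : e.eval s = 0
    · exact ⟨_, _, .whileStop (hok _ _ h) h0, p, h, h0, by omega⟩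
    · obtain ⟨t, s', h1, p', h2, h3⟩ := hI s p h h0
      obtain ⟨t', s'', h4, p'', h5, h6, h7⟩ := ih p' (by omega) h2
      exact ⟨_, _, .whileStep (hok _ _ h) h0 h1 h4, p'', h5, h6, by omega⟩

/-- `for i in 0, …, reg ℓ - 1 do c`. -/
def Cmd.for (i ℓ : ℕ) (c : Cmd) : Cmd :=
  .seq (.set i (.lit 0))
    (.while (.op .lt (.reg i) (.reg ℓ)) (.seq c (.set i (.op .add (.reg i) (.lit 1)))))

theorem Frame.of_for {i ℓ : ℕ} {c : Cmd} {s s' : State} (h : Frame c s s') :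
    Frame (.for i ℓ c) s s' :=
  h.mono (by intro; simp +contextual [Cmd.for, Cmd.wregs]) (by simp [Cmd.for, Cmd.warrs])

/-- A round has an overhead of 8 steps, 4 for the guard and 4 for the increment; the initialisation
(2) and the last guard (4) give the 6. Because the invariant carries a credit, rounds of very
different length can be charged together, as is needed for the failed calls in `leaf_spec`. -/
theorem wp_for_credit {W i ℓ n p₀ : ℕ} {c : Cmd} {s₀ : State} (I : ℕ → State → ℕ → Prop)
    (hn : s₀.reg ℓ = n) (hnW : n ≤ W) (hW : 1 ≤ W) (hi : i ∉ c.wregs) (hℓ : ℓ ∉ c.wregs)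
    (hiℓ : ℓ ≠ i) (h0 : I 0 (s₀.setReg i 0) p₀)
    (hstep : ∀ j s p, j < n → s.reg i = j → Frame (.for i ℓ c) s₀ s → I j s p →
      wp W c s fun t s' => ∃ p', t + p' ≤ p ∧ I (j + 1) (s'.setReg i (j + 1)) p') :
    wp W (.for i ℓ c) s₀ fun t s' => ∃ p', t + p' ≤ p₀ + n * 8 + 6 ∧ I n s' p' := by
  have key : wp W (.while (.op .lt (.reg i) (.reg ℓ))
      (.seq c (.set i (.op .add (.reg i) (.lit 1)))))
      (s₀.setReg i 0) fun t s' => ∃ p', t + p' ≤ p₀ + n * 8 + 4 ∧ I n s' p' := by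
    refine (wp_while (fun s p => ∃ j p', j ≤ n ∧ s.reg i = j ∧ Frame (.for i ℓ c) s₀ s ∧ I j s p' ∧
      p = p' + (n - j) * 8) (fun s p _ => by simp [Expr.Ok, BinOp.Fits]) ?_
      (p := p₀ + n * 8) ?_).mono ?_
    · rintro s p ⟨j, p', hj, hij, hf, hI, rfl⟩ he
      have hℓs : s.reg ℓ = n := by
        rw [hf.1 ℓ (by simp [Cmd.for, Cmd.wregs, hℓ, hiℓ]), hn]
      simp only [Expr.eval, BinOp.eval, hij, hℓs] at he
      have hlt : j < n := by by_contra h; simp [h] at he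
      rw [wp_seq]
      refine (hstep j s p' hlt hij hf hI).mono fun t s' hf' ⟨p'', ht, hI'⟩ => ?_
      have hij' : s'.reg i = j := by rw [hf'.1 i hi, hij]
      rw [wp_set]
      refine ⟨⟨trivial, hW, ?_⟩, p'' + (n - (j + 1)) * 8, ⟨j + 1, p'', hlt, ?_, ?_, ?_, rfl⟩, ?_⟩
      · simp only [BinOp.Fits, Expr.eval, hij']; omega
      · simp [Expr.eval, BinOp.eval, hij']
      · refine hf.trans (hf'.of_for.trans ⟨fun r hr => ?_, fun _ _ => rfl⟩)
        have : r ≠ i := by rintro rfl; simp [Cmd.for, Cmd.wregs] at hr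
        simp [this]
      · simpa [Expr.eval, BinOp.eval, hij'] using hI'
      · simp only [Expr.cost]; omega
    · refine ⟨0, p₀, Nat.zero_le _, by simp, ⟨fun r hr => ?_, fun _ _ => rfl⟩, h0, by simp⟩
      have : r ≠ i := by rintro rfl; simp [Cmd.for, Cmd.wregs] at hr
      simp [this]
    · rintro t s' - ⟨p, ⟨j, p', hj, hij, hf, hI, rfl⟩, he, ht⟩
      have hℓs : s'.reg ℓ = n := by
        rw [hf.1 ℓ (by simp [Cmd.for, Cmd.wregs, hℓ, hiℓ]), hn]
      simp only [Expr.eval, BinOp.eval, hij, hℓs] at he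
      have : j = n := by
        by_contra h; simp [show j < n by omega] at he
      subst this
      simp only [Expr.cost] at ht
      exact ⟨p', by omega, hI⟩
  rw [Cmd.for, wp_seq, wp_set]
  refine ⟨by simp [Expr.Ok], ?_⟩
  refine key.mono fun t s' _ ⟨p', h, h'⟩ => ⟨p', ?_, h'⟩
  simp only [Expr.cost]; omega

theorem wp_for {W i ℓ n T : ℕ} {c : Cmd} {s₀ : State} (I : ℕ → State → Prop)
    (hn : s₀.reg ℓ = n) (hnW : n ≤ W) (hW : 1 ≤ W) (hi : i ∉ c.wregs) (hℓ : ℓ ∉ c.wregs)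
    (hiℓ : ℓ ≠ i) (h0 : I 0 (s₀.setReg i 0))
    (hstep : ∀ j s, j < n → s.reg i = j → Frame (.for i ℓ c) s₀ s → I j s →
      wp W c s fun t s' => t ≤ T ∧ I (j + 1) (s'.setReg i (j + 1))) :
    wp W (.for i ℓ c) s₀ fun t s' => t ≤ n * (T + 8) + 6 ∧ I n s' := by
  refine (wp_for_credit (p₀ := n * T) (fun j s p => I j s ∧ p = (n - j) * T) hn hnW hW hi hℓ hiℓ
    ⟨h0, by simp⟩ ?_).mono ?_
  · rintro j s p hj hij hf ⟨hI, rfl⟩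
    refine (hstep j s hj hij hf hI).mono fun t s' _ h => ⟨_, ?_, h.2, rfl⟩
    rw [show n - j = n - (j + 1) + 1 by omega, add_mul, one_mul]
    have := h.1
    omega
  · rintro t s' - ⟨p, h, h', -⟩
    refine ⟨?_, h'⟩
    rw [mul_add]
    omega

end WordRAM

/-! ### Sparsification of hitting set instances -/

namespace Sparsify

/-- The inclusion-minimal members of a family. -/
def minimals (F : Finset (Finset ℕ)) : Finset (Finset ℕ) :=
  F.filter fun C => ∀ D ∈ F, D ⊆ C → D = C

/-- The number of members of size `c` that contain `H`. -/
def deg (F : Finset (Finset ℕ)) (c : ℕ) (H : Finset ℕ) : ℕ :=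
  (F.filter fun C => C.card = c ∧ H ⊆ C).card

/-- The number of petals from which on a sunflower is branched on. -/
def θ (κ e : ℕ) : ℕ := 2 ^ (κ * (2 * e - 1))

/-- `H` is the heart of a large sunflower of sets of size `c`. -/
def Heavy (κ : ℕ) (F : Finset (Finset ℕ)) (c : ℕ) (H : Finset ℕ) : Prop :=
  1 ≤ H.card ∧ H.card < c ∧ θ κ (c - H.card) ≤ deg F c H

/-- A heart of largest size among those of large sunflowers of sets of smallest size. -/
def IsPick (κ : ℕ) (F : Finset (Finset ℕ)) (c : ℕ) (H : Finset ℕ) : Prop :=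
  Heavy κ F c H ∧ ∀ c' H', Heavy κ F c' H' → c < c' ∨ c = c' ∧ H'.card ≤ H.card

/-- The petals of the sunflower of sets of size `c` with heart `H`. -/
def petals (F : Finset (Finset ℕ)) (c : ℕ) (H : Finset ℕ) : Finset (Finset ℕ) :=
  (F.filter fun C => C.card = c ∧ H ⊆ C).image (· \ H)

/-- The set `S` meets all members of `F`. -/
def Hits (F : Finset (Finset ℕ)) (S : Finset ℕ) : Prop := ∀ C ∈ F, ¬ Disjoint C S

theorem exists_minimals_subset {F : Finset (Finset ℕ)} {C : Finset ℕ} (hC : C ∈ F) :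
    ∃ D ∈ minimals F, D ⊆ C := by
  induction h : C.card using Nat.strong_induction_on generalizing C with
  | _ n ih =>
    by_cases hm : C ∈ minimals F
    · exact ⟨C, hm, subset_rfl⟩
    · simp only [minimals, Finset.mem_filter, hC, true_and, not_forall] at hm
      obtain ⟨D, hD, hDC, hne⟩ := hm
      obtain ⟨D', h1, h2⟩ :=
        ih D.card (h ▸ Finset.card_lt_card (hDC.ssubset_of_ne hne)) hD rfl
      exact ⟨D', h1, h2.trans hDC⟩

theorem hits_minimals {F : Finset (Finset ℕ)} {S : Finset ℕ} : Hits (minimals F) S ↔ Hits F S := by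
  refine ⟨fun h C hC => ?_, fun h C hC => h C (Finset.mem_filter.1 hC).1⟩
  obtain ⟨D, hD, hDC⟩ := exists_minimals_subset hC
  exact fun hd => h D hD (hd.mono_left hDC)

/-- If `S` misses the heart, it must meet every set of the sunflower inside its petal. Conversely,
additional sets only make hitting harder. -/
theorem hits_branch {F : Finset (Finset ℕ)} {S : Finset ℕ} (c : ℕ) (H : Finset ℕ) :
    Hits F S ↔ Hits (F ∪ {H}) S ∨ Hits (F ∪ petals F c H) S := by
  constructor
  · intro h
    by_cases hH : Disjoint H S
    · refine Or.inr fun C hC => ?_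
      rcases Finset.mem_union.1 hC with hC | hC
      · exact h C hC
      · simp only [petals, Finset.mem_image, Finset.mem_filter] at hC
        obtain ⟨D, hD, rfl⟩ := hC
        have := h D hD.1
        rw [Finset.not_disjoint_iff] at this ⊢
        obtain ⟨x, hx, hxS⟩ := this
        exact ⟨x, Finset.mem_sdiff.2 ⟨hx, fun hxH => Finset.disjoint_left.1 hH hxH hxS⟩, hxS⟩
    · refine Or.inl fun C hC => ?_
      rcases Finset.mem_union.1 hC with hC | hC
      · exact h C hC
      · rw [Finset.mem_singleton.1 hC]; exact hH
  · rintro (h | h) <;> exact fun C hC => h C (Finset.mem_union_left _ hC)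

theorem one_le_θ (κ e : ℕ) : 1 ≤ θ κ e := Nat.one_le_two_pow

theorem θ_mono {κ e e' : ℕ} (h : e ≤ e') : θ κ e ≤ θ κ e' :=
  Nat.pow_le_pow_right (by norm_num) (Nat.mul_le_mul_left _ (by omega))

/-- For `e = 1` truncated subtraction makes `θ κ 0 = 1`, so the bound is also valid there. -/
theorem two_pow_mul_θ_le (κ : ℕ) {e : ℕ} (he : 1 ≤ e) : 2 ^ κ * θ κ (e - 1) ≤ θ κ e := by
  rw [θ, θ, ← pow_add]
  refine Nat.pow_le_pow_right (by norm_num) ?_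
  rcases Nat.lt_or_ge e 2 with h | h
  · obtain rfl : e = 1 := by omega
    simp
  · obtain ⟨x, hx⟩ : ∃ x, 2 * (e - 1) - 1 = x := ⟨_, rfl⟩
    rw [hx, show 2 * e - 1 = x + 2 by omega]
    nlinarith

/-- The exponent `2 e - 1` in `θ` is chosen for the identity `1 + (2 e - 1) + (2 e' - 1) = 2 (e +
e') - 1`. The gain of a factor `2 ^ κ` keeps the weight lost by deletions small. -/
theorem two_pow_mul_θ_mul_θ_le (κ : ℕ) {e e' : ℕ} (he : 1 ≤ e) (he' : 1 ≤ e') :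
    2 ^ κ * (θ κ e * θ κ e') = θ κ (e + e') := by
  rw [θ, θ, θ, ← pow_add, ← pow_add]
  congr 1
  obtain ⟨x, rfl⟩ : ∃ x, e = x + 1 := ⟨e - 1, by omega⟩
  obtain ⟨y, rfl⟩ : ∃ y, e' = y + 1 := ⟨e' - 1, by omega⟩
  rw [show 2 * (x + 1) - 1 = 2 * x + 1 by omega, show 2 * (y + 1) - 1 = 2 * y + 1 by omega,
    show 2 * (x + 1 + (y + 1)) - 1 = 2 * x + 2 * y + 3 by omega]
  ring

theorem deg_mono {F G : Finset (Finset ℕ)} (h : F ⊆ G) (c : ℕ) (H : Finset ℕ) :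
    deg F c H ≤ deg G c H :=
  Finset.card_le_card (Finset.filter_subset_filter _ h)

theorem deg_union_le (F G : Finset (Finset ℕ)) (c : ℕ) (H : Finset ℕ) :
    deg (F ∪ G) c H ≤ deg F c H + deg G c H := by
  rw [deg, Finset.filter_union]; exact Finset.card_union_le _ _

theorem deg_card_le_one (F : Finset (Finset ℕ)) (H : Finset ℕ) : deg F H.card H ≤ 1 := by
  refine Finset.card_le_one.2 fun C hC D hD => ?_
  simp only [Finset.mem_filter] at hC hD
  rw [← Finset.eq_of_subset_of_card_le hC.2.2 hC.2.1.le,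
    ← Finset.eq_of_subset_of_card_le hD.2.2 hD.2.1.le]

theorem card_le_sum_deg {F : Finset (Finset ℕ)} {L i : ℕ} (hF : ∀ C ∈ F, C ⊆ Finset.range L)
    (hi : 1 ≤ i) : (F.filter fun C => C.card = i).card ≤ ∑ x ∈ Finset.range L, deg F i {x} := by
  have h : (F.filter fun C => C.card = i) ⊆ (Finset.range L).biUnion
      fun x => F.filter fun C => C.card = i ∧ {x} ⊆ C := by
    intro C hC
    simp only [Finset.mem_filter] at hC
    obtain ⟨x, hx⟩ := Finset.card_pos.1 (by omega : 0 < C.card)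
    simp only [Finset.mem_biUnion, Finset.mem_filter]
    exact ⟨x, hF C hC.1 hx, hC.1, hC.2, by simpa using hx⟩
  exact (Finset.card_le_card h).trans Finset.card_biUnion_le

/-- If all sets of `F` are subsets of `{0, …, L - 1}` of size at most `k` and there is no large
sunflower, then `F` has at most `1 + k L θ_k` members. -/
theorem card_le_of_not_heavy {κ k L : ℕ} {F : Finset (Finset ℕ)}
    (hF : ∀ C ∈ F, C ⊆ Finset.range L ∧ C.card ≤ k) (h : ∀ c H, ¬ Heavy κ F c H) :
    F.card ≤ 1 + k * L * θ κ k := by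
  have h1 : F ⊆ (F.filter fun C => C.card = 0) ∪
      (Finset.Icc 1 k).biUnion fun i => F.filter fun C => C.card = i := by
    intro C hC
    simp only [Finset.mem_union, Finset.mem_filter, Finset.mem_biUnion, Finset.mem_Icc]
    rcases Nat.eq_zero_or_pos C.card with h0 | h0
    · exact Or.inl ⟨hC, h0⟩
    · exact Or.inr ⟨C.card, ⟨h0, (hF C hC).2⟩, hC, rfl⟩
  refine (Finset.card_le_card h1).trans ((Finset.card_union_le _ _).trans (add_le_add ?_ ?_))
  · refine Finset.card_le_one.2 fun C hC D hD => ?_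
    simp only [Finset.mem_filter, Finset.card_eq_zero] at hC hD
    rw [hC.2, hD.2]
  · refine Finset.card_biUnion_le.trans ?_
    refine (Finset.sum_le_card_nsmul _ _ (L * θ κ k) fun i hi => ?_).trans
      (by simp [mul_assoc])
    rw [Finset.mem_Icc] at hi
    refine (card_le_sum_deg (fun C hC => (hF C hC).1) hi.1).trans ?_
    refine (Finset.sum_le_card_nsmul _ _ (θ κ k) fun x _ => ?_).trans (by simp)
    rcases Nat.lt_or_ge 1 i with h2 | h2
    · have := h i {x}
      simp only [Heavy, Finset.card_singleton, le_refl, true_and, h2, not_le] at this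
      exact this.le.trans (θ_mono (by omega))
    · obtain rfl : i = 1 := by omega
      exact (deg_card_le_one F {x}).trans (one_le_θ _ _)

/-- A heart of a large sunflower of largest size is the intersection of two sets. -/
theorem Heavy.exists_inter {κ k : ℕ} {F : Finset (Finset ℕ)} {c : ℕ} {H : Finset ℕ}
    (hκ : k + 1 ≤ κ) (hck : c ≤ k) (h : Heavy κ F c H) :
    ∃ C ∈ F, ∃ D ∈ F, C.card = c ∧ D.card = c ∧ H.card ≤ (C ∩ D).card ∧ Heavy κ F c (C ∩ D) := by
  induction hn : c - H.card using Nat.strong_induction_on generalizing H with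
  | _ e ih =>
    by_contra! hcon
    -- A larger heavy set would, by induction, produce the required intersection.
    have hnot : ∀ H', H.card < H'.card → ¬ Heavy κ F c H' := by
      intro H' hlt hH'
      obtain ⟨C, hC, D, hD, h1, h2, h3, h4⟩ := ih (c - H'.card) (by have := h.2.1; omega) hH' rfl
      exact hcon C hC D hD h1 h2 (by omega) h4
    have hpos : 0 < (F.filter fun C => C.card = c ∧ H ⊆ C).card :=
      lt_of_lt_of_le (one_le_θ κ _) h.2.2
    obtain ⟨C, hC⟩ := Finset.card_pos.1 hpos
    have hC' := Finset.mem_filter.1 hC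
    -- Every other set of the sunflower meets the fixed set `C` in more than `H`; otherwise `H`
    -- would itself be an intersection.
    have hsub : (F.filter fun C => C.card = c ∧ H ⊆ C) ⊆
        {C} ∪ (C.powerset.filter fun H' => H.card < H'.card ∧ H'.card < c).biUnion
          fun H' => F.filter fun C => C.card = c ∧ H' ⊆ C := by
      intro D hD
      have hD' := Finset.mem_filter.1 hD
      by_cases hDC : D = C
      · simp [hDC]
      refine Finset.mem_union_right _ (Finset.mem_biUnion.2 ⟨C ∩ D, ?_, ?_⟩)
      · simp only [Finset.mem_filter, Finset.mem_powerset, Finset.inter_subset_left, true_and]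
        have hHs : H ⊆ C ∩ D := Finset.subset_inter hC'.2.2 hD'.2.2
        constructor
        · refine lt_of_le_of_ne (Finset.card_le_card hHs) fun heq => ?_
          have : H = C ∩ D := Finset.eq_of_subset_of_card_le hHs heq.ge
          exact hcon C hC'.1 D hD'.1 hC'.2.1 hD'.2.1 heq.le (this ▸ h)
        · rw [← hC'.2.1]
          refine Finset.card_lt_card (Finset.inter_subset_left.ssubset_of_ne fun heq => hDC ?_)
          exact (Finset.eq_of_subset_of_card_le (Finset.inter_eq_left.1 heq)
            (by rw [hC'.2.1, hD'.2.1])).symm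
      · exact Finset.mem_filter.2 ⟨hD'.1, hD'.2.1, Finset.inter_subset_right⟩
    -- At most `2 ^ k` subsets of `C` occur, and none of them is heavy. As `2 ^ κ` is at least `2 ^
    -- (k + 1)`, this is too few sets for `H` to be heavy.
    have hle : deg F c H ≤ 1 + 2 ^ k * (θ κ (c - H.card - 1) - 1) := by
      refine (Finset.card_le_card hsub).trans ((Finset.card_union_le _ _).trans ?_)
      refine add_le_add (by simp) (Finset.card_biUnion_le.trans ?_)
      refine (Finset.sum_le_card_nsmul _ _ (θ κ (c - H.card - 1) - 1) fun H' hH' => ?_).trans ?_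
      · simp only [Finset.mem_filter] at hH'
        have := hnot H' hH'.2.1
        simp only [Heavy, not_and, not_le] at this
        have h3 := this (by omega) hH'.2.2
        have h4 : θ κ (c - H'.card) ≤ θ κ (c - H.card - 1) := θ_mono (by omega)
        have h5 := h3.trans_le h4
        rw [deg] at h5
        omega
      · rw [smul_eq_mul]
        refine Nat.mul_le_mul_right _ ((Finset.card_filter_le _ _).trans ?_)
        rw [Finset.card_powerset, hC'.2.1]
        exact Nat.pow_le_pow_right (by norm_num) hck
    have h1 := h.2.2.trans hle
    have h2 := two_pow_mul_θ_le κ (e := c - H.card) (by have := h.2.1; omega)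
    have h3 : 2 ^ (k + 1) ≤ 2 ^ κ := Nat.pow_le_pow_right (by norm_num) hκ
    have h4 := one_le_θ κ (c - H.card - 1)
    obtain ⟨y, hy⟩ : ∃ y, θ κ (c - H.card - 1) = y + 1 := ⟨_, (Nat.sub_add_cancel h4).symm⟩
    rw [hy] at h1 h2
    have h5 : 1 ≤ 2 ^ k := Nat.one_le_two_pow
    rw [pow_succ] at h3
    simp only [Nat.add_sub_cancel] at h1
    nlinarith

end Sparsify

/-! ### The potential that bounds the number of branchings -/

namespace Sparsify

/-- The weight of an added set of size `i`. -/
noncomputable def weight (κ k i : ℕ) : ℝ := 4 * k * κ / θ κ i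

/-- The total weight of a family of added sets. -/
noncomputable def Wt (κ k : ℕ) (A : Finset (Finset ℕ)) : ℝ := ∑ C ∈ A, weight κ k C.card

/-- `F` is an antichain of sets of size at most `k`, and `A` consists of the sets of `F` that were
added in branchings; the degrees of `A` are bounded. -/
structure Inv (κ k L : ℕ) (F A : Finset (Finset ℕ)) : Prop where
  sub : A ⊆ F
  antichain : ∀ C ∈ F, ∀ D ∈ F, D ⊆ C → D = C
  ground : ∀ C ∈ F, C ⊆ Finset.range L ∧ C.card ≤ k
  card : ∀ C ∈ A, 1 ≤ C.card ∧ C.card < k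
  deg_le : ∀ i H, 1 ≤ H.card → H.card ≤ i → deg A i H ≤ 2 * θ κ (i - H.card)

theorem sum_biUnion_le {f : Finset ℕ → ℝ} (P : Finset (Finset ℕ))
    (g : Finset ℕ → Finset (Finset ℕ)) (hf : ∀ C, 0 ≤ f C) :
    ∑ C ∈ P.biUnion g, f C ≤ ∑ Q ∈ P, ∑ C ∈ g Q, f C := by
  induction P using Finset.induction_on with
  | empty => simp
  | insert Q P hQ ih =>
    rw [Finset.biUnion_insert, Finset.sum_insert hQ]
    have := Finset.sum_union_inter (s₁ := g Q) (s₂ := P.biUnion g) (f := f)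
    have h0 : 0 ≤ ∑ C ∈ g Q ∩ P.biUnion g, f C := Finset.sum_nonneg fun C _ => hf C
    linarith

theorem weight_nonneg (κ k i : ℕ) : 0 ≤ weight κ k i := by unfold weight; positivity

/-- The left side bounds the weight of the added sets of size `i` that contain a given set of size
`j`: their number is at most `2 θ_{i-j}` by the degree condition. This is what a new set of size `j`
can destroy. -/
theorem weight_mul_θ_le {κ k i j : ℕ} (hj : 1 ≤ j) (hij : j < i) :
    weight κ k i * (2 * θ κ (i - j)) = weight κ k j * (2 / 2 ^ κ) := by
  have h : (2 ^ κ * (θ κ j * θ κ (i - j)) : ℝ) = θ κ i := by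
    have := two_pow_mul_θ_mul_θ_le κ hj (show 1 ≤ i - j by omega)
    rw [Nat.add_sub_cancel' hij.le] at this
    exact_mod_cast this
  have h1 : (0 : ℝ) < θ κ j := by exact_mod_cast one_le_θ κ j
  have h2 : (0 : ℝ) < θ κ (i - j) := by exact_mod_cast one_le_θ κ (i - j)
  rw [weight, weight, ← h]
  field_simp

/-- The degrees of singletons show that there are at most `2 L θ_{i-1}` added sets of size `i`, and
`θ_{i-1} ≤ θ_i / 2 ^ κ`. Each of the at most `k` sizes therefore contributes at most `8 k κ L / 2 ^
κ`. -/
theorem Inv.Wt_le {κ k L : ℕ} {F A : Finset (Finset ℕ)} (h : Inv κ k L F A) :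
    Wt κ k A ≤ 8 * k ^ 2 * κ * L / 2 ^ κ := by
  have h1 : Wt κ k A = ∑ i ∈ Finset.Icc 1 k, ∑ C ∈ A with C.card = i, weight κ k C.card :=
    (Finset.sum_fiberwise_of_maps_to (fun C hC => Finset.mem_Icc.2
      ⟨(h.card C hC).1, (h.card C hC).2.le⟩) _).symm
  rw [h1]
  have h0 : ∀ i ∈ Finset.Icc 1 k, ∑ C ∈ A with C.card = i, weight κ k C.card ≤
      8 * k * κ * L / 2 ^ κ := by
    intro i hi
    rw [Finset.mem_Icc] at hi
    rw [Finset.sum_congr rfl (g := fun _ => weight κ k i) fun C hC => by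
      rw [(Finset.mem_filter.1 hC).2], Finset.sum_const, nsmul_eq_mul]
    have h2 : (A.filter fun C => C.card = i).card ≤ L * (2 * θ κ (i - 1)) := by
      refine (card_le_sum_deg (fun C hC => (h.ground C (h.sub hC)).1) hi.1).trans ?_
      refine (Finset.sum_le_card_nsmul _ _ (2 * θ κ (i - 1)) fun x _ => ?_).trans (by simp)
      simpa using h.deg_le i {x} (by simp) (by simpa using hi.1)
    have h3 : (2 ^ κ * θ κ (i - 1) : ℝ) ≤ θ κ i := by exact_mod_cast two_pow_mul_θ_le κ hi.1
    have h4 : (0 : ℝ) < θ κ i := by exact_mod_cast one_le_θ κ i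
    have h5 : ((A.filter fun C => C.card = i).card : ℝ) ≤ L * (2 * θ κ (i - 1)) := by
      exact_mod_cast h2
    refine (mul_le_mul_of_nonneg_right h5 (weight_nonneg _ _ _)).trans ?_
    rw [weight, mul_div_assoc', div_le_div_iff₀ h4 (by positivity)]
    have h6 : (0 : ℝ) ≤ 8 * k * κ * L := by positivity
    nlinarith
  refine (Finset.sum_le_card_nsmul _ _ _ h0).trans (le_of_eq ?_)
  simp only [Nat.card_Icc, Nat.add_sub_cancel, nsmul_eq_mul]; ring

/-- New sets of size `j` affect only the degrees for that size. There `F` and `P` contribute at most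
`θ` each, which is the origin of the factor 2 in `deg_le`. Passing to minimal sets may delete
earlier added sets, but each new set destroys at most half of its own weight, because `4 k ≤ 2 ^ κ`.
-/
theorem Inv.add {κ k L j : ℕ} {F A P : Finset (Finset ℕ)} (h : Inv κ k L F A)
    (hk : 4 * k ≤ 2 ^ κ) (hj : 1 ≤ j) (hjk : j < k)
    (hP : ∀ Q ∈ P, Q ⊆ Finset.range L ∧ Q.card = j ∧ ∀ D ∈ F, ¬ D ⊆ Q)
    (hdeg : ∀ H : Finset ℕ, 1 ≤ H.card → H.card < j →
      deg F j H ≤ θ κ (j - H.card) ∧ deg P j H ≤ θ κ (j - H.card)) :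
    Inv κ k L (minimals (F ∪ P)) ((A ∪ P) ∩ minimals (F ∪ P)) ∧
      Wt κ k A + P.card * weight κ k j / 2 ≤ Wt κ k ((A ∪ P) ∩ minimals (F ∪ P)) := by
  have hPF : Disjoint A P := Finset.disjoint_left.2 fun Q hQA hQ =>
    (hP Q hQ).2.2 Q (h.sub hQA) subset_rfl
  refine ⟨⟨Finset.inter_subset_right, fun C hC D hD => ?_, fun C hC => ?_, fun C hC => ?_,
    fun i H h1 h2 => ?_⟩, ?_⟩
  · exact (Finset.mem_filter.1 hC).2 D (Finset.mem_filter.1 hD).1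
  · rcases Finset.mem_union.1 (Finset.mem_filter.1 hC).1 with hC | hC
    · exact h.ground C hC
    · exact ⟨(hP C hC).1, by rw [(hP C hC).2.1]; exact hjk.le⟩
  · rcases Finset.mem_union.1 (Finset.mem_inter.1 hC).1 with hC | hC
    · exact h.card C hC
    · rw [(hP C hC).2.1]; exact ⟨hj, hjk⟩
  · refine (deg_mono Finset.inter_subset_left i H).trans ?_
    by_cases hij : i = j
    · subst hij
      refine (deg_union_le A P i H).trans ?_
      rw [two_mul]
      rcases h2.lt_or_eq with h2 | rfl
      · exact add_le_add ((deg_mono h.sub _ _).trans (hdeg H h1 h2).1) (hdeg H h1 h2).2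
      · exact add_le_add ((deg_card_le_one _ _).trans (one_le_θ _ _))
          ((deg_card_le_one _ _).trans (one_le_θ _ _))
    · refine (deg_union_le A P i H).trans ?_
      have : deg P i H = 0 := Finset.card_eq_zero.2 <| Finset.filter_eq_empty_iff.2 fun C hC h' =>
        hij (h'.1.symm.trans (hP C hC).2.1)
      rw [this, add_zero]
      exact h.deg_le i H h1 h2
  -- An added set is deleted only if it contains a new one. All of `P` survives, since its members
  -- contain no set of `F` and have equal size.
  · have hsub : (A \ P.biUnion fun Q => A.filter fun C => Q ⊆ C) ∪ P ⊆
        (A ∪ P) ∩ minimals (F ∪ P) := by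
      intro C hC
      rcases Finset.mem_union.1 hC with hC | hC
      · simp only [Finset.mem_sdiff, Finset.mem_biUnion, Finset.mem_filter, not_exists,
          not_and] at hC
        refine Finset.mem_inter.2 ⟨Finset.mem_union_left _ hC.1, Finset.mem_filter.2
          ⟨Finset.mem_union_left _ (h.sub hC.1), fun D hD hDC => ?_⟩⟩
        rcases Finset.mem_union.1 hD with hD | hD
        · exact h.antichain C (h.sub hC.1) D hD hDC
        · exact absurd hDC (hC.2 D hD hC.1)
      · refine Finset.mem_inter.2 ⟨Finset.mem_union_right _ hC, Finset.mem_filter.2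
          ⟨Finset.mem_union_right _ hC, fun D hD hDC => ?_⟩⟩
        rcases Finset.mem_union.1 hD with hD | hD
        · exact absurd hDC ((hP C hC).2.2 D hD)
        · exact Finset.eq_of_subset_of_card_le hDC (by rw [(hP C hC).2.1, (hP D hD).2.1])
    -- Every size between `j` and `k` loses at most the fraction `2 / 2 ^ κ` of the weight of `Q`.
    have hkill : ∀ Q ∈ P, ∑ C ∈ A with Q ⊆ C, weight κ k C.card ≤ weight κ k j / 2 := by
      intro Q hQ
      have hcard : ∀ C ∈ A.filter (Q ⊆ ·), C.card ∈ Finset.Ioo j k := by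
        intro C hC
        rw [Finset.mem_filter] at hC
        refine Finset.mem_Ioo.2 ⟨?_, (h.card C hC.1).2⟩
        rw [← (hP Q hQ).2.1]
        refine Finset.card_lt_card (hC.2.ssubset_of_ne ?_)
        rintro rfl
        exact Finset.disjoint_left.1 hPF hC.1 hQ
      rw [← Finset.sum_fiberwise_of_maps_to hcard]
      refine (Finset.sum_le_card_nsmul _ _ (weight κ k j * (2 / 2 ^ κ)) fun i hi => ?_).trans ?_
      · rw [Finset.mem_Ioo] at hi
        rw [Finset.sum_congr rfl (g := fun _ => weight κ k i) fun C hC => by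
          rw [(Finset.mem_filter.1 hC).2], Finset.sum_const, nsmul_eq_mul,
          ← weight_mul_θ_le hj hi.1, mul_comm]
        refine mul_le_mul_of_nonneg_left ?_ (weight_nonneg _ _ _)
        have h1 := h.deg_le i Q (by rw [(hP Q hQ).2.1]; exact hj) (by rw [(hP Q hQ).2.1]; omega)
        rw [(hP Q hQ).2.1, deg] at h1
        rw [Finset.filter_filter]
        simp only [and_comm] at h1 ⊢
        exact_mod_cast h1
      · rw [nsmul_eq_mul]
        have h1 : ((Finset.Ioo j k).card : ℝ) ≤ k := by
          rw [Nat.card_Ioo]; exact_mod_cast (by omega : k - j - 1 ≤ k)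
        have h2 : (4 * k : ℝ) ≤ 2 ^ κ := by exact_mod_cast hk
        have h3 : ((Finset.Ioo j k).card : ℝ) * (2 / 2 ^ κ) ≤ 1 / 2 := by
          rw [mul_div_assoc', div_le_div_iff₀ (by positivity) (by norm_num)]
          linarith
        have := weight_nonneg κ k j
        nlinarith
    have hW : Wt κ k A ≤ Wt κ k (A \ P.biUnion fun Q => A.filter fun C => Q ⊆ C) +
        P.card * (weight κ k j / 2) := by
      have hB : (P.biUnion fun Q => A.filter fun C => Q ⊆ C) ⊆ A := by
        intro C hC
        simp only [Finset.mem_biUnion, Finset.mem_filter] at hC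
        obtain ⟨_, _, h, _⟩ := hC
        exact h
      rw [Wt, Wt, ← Finset.sum_sdiff hB]
      refine add_le_add le_rfl ?_
      refine (sum_biUnion_le _ _ fun _ => weight_nonneg _ _ _).trans ?_
      exact (Finset.sum_le_card_nsmul _ _ _ hkill).trans (by rw [nsmul_eq_mul])
    have hW2 : Wt κ k (A \ P.biUnion fun Q => A.filter fun C => Q ⊆ C) + P.card * weight κ k j ≤
        Wt κ k ((A ∪ P) ∩ minimals (F ∪ P)) := by
      refine le_trans (le_of_eq ?_)
        (Finset.sum_le_sum_of_subset_of_nonneg hsub fun _ _ _ => weight_nonneg _ _ _)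
      rw [Finset.sum_union (hPF.mono_left Finset.sdiff_subset), Wt, add_right_inj,
        Finset.sum_congr rfl (g := fun _ => weight κ k j) fun C hC => by rw [(hP C hC).2.1],
        Finset.sum_const, nsmul_eq_mul]
    linarith

/-- Petals that contain `H'` come from sets of `F` that contain `H ∪ H'`. That union is larger than
`H`, so it is not heavy, because a pick has the largest possible heart. No petal contains `H'` if
`H'` meets `H`. -/
theorem deg_petals_le {κ c : ℕ} {F : Finset (Finset ℕ)} {H H' : Finset ℕ} (h : IsPick κ F c H)
    (h1 : 1 ≤ H'.card) (h2 : H'.card < c - H.card) :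
    deg (petals F c H) (c - H.card) H' ≤ θ κ (c - H.card - H'.card) := by
  by_cases hd : Disjoint H H'
  · have hcard : (H ∪ H').card = H.card + H'.card := Finset.card_union_of_disjoint hd
    have hlt : deg F c (H ∪ H') < θ κ (c - (H ∪ H').card) := by
      by_contra hcon
      have := h.2 c (H ∪ H') ⟨by omega, by omega, not_lt.1 hcon⟩
      omega
    rw [hcard, ← Nat.sub_sub] at hlt
    refine le_trans ?_ hlt.le
    refine (Finset.card_le_card (t := (F.filter fun C => C.card = c ∧ H ∪ H' ⊆ C).image (· \ H))
      fun Q hQ => ?_).trans Finset.card_image_le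
    simp only [petals, Finset.mem_filter, Finset.mem_image] at hQ ⊢
    obtain ⟨⟨C, ⟨hC, hCc, hHC⟩, rfl⟩, -, hH'⟩ := hQ
    exact ⟨C, ⟨hC, hCc, Finset.union_subset hHC (hH'.trans Finset.sdiff_subset)⟩, rfl⟩
  · have : deg (petals F c H) (c - H.card) H' = 0 := by
      refine Finset.card_eq_zero.2 (Finset.filter_eq_empty_iff.2 fun Q hQ h' => hd ?_)
      simp only [petals, Finset.mem_filter, Finset.mem_image] at hQ
      obtain ⟨C, -, rfl⟩ := hQ
      exact (Finset.disjoint_sdiff).mono_right h'.2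
    omega

/-- The bound for the exponent of the number of leaves. -/
noncomputable def expo (κ k L : ℕ) : ℝ := 8 * k ^ 2 * κ * L / 2 ^ κ

/-- An upper bound `N` for the number of branchings that start from `X`. -/
def Budget (κ k L : ℕ) (X : Finset (Finset ℕ)) (N : ℕ) : Prop :=
  ∃ A, Inv κ k L (minimals X) A ∧ ⌊2 * (2 : ℝ) ^ (expo κ k L - Wt κ k A) - 1⌋₊ ≤ N

/-- By `Inv.Wt_le` the exponent is nonnegative, so a leaf still has one unit to pay for itself. -/
theorem Budget.pos {κ k L N : ℕ} {X : Finset (Finset ℕ)} (h : Budget κ k L X N) : 1 ≤ N := by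
  obtain ⟨A, hA, hN⟩ := h
  refine le_trans (Nat.le_floor ?_) hN
  have : (1 : ℝ) ≤ 2 ^ (expo κ k L - Wt κ k A) :=
    Real.one_le_rpow (by norm_num) (sub_nonneg.2 hA.Wt_le)
  push_cast; linarith

theorem Budget.ground {κ k L N : ℕ} {X : Finset (Finset ℕ)} (h : Budget κ k L X N) :
    ∀ C ∈ minimals X, C ⊆ Finset.range L ∧ C.card ≤ k := by
  obtain ⟨A, hA, -⟩ := h
  exact hA.ground

theorem budget_init {κ k L : ℕ} {X : Finset (Finset ℕ)}
    (h : ∀ C ∈ X, C ⊆ Finset.range L ∧ C.card ≤ k) :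
    Budget κ k L X ⌊2 * (2 : ℝ) ^ expo κ k L⌋₊ := by
  refine ⟨∅, ⟨Finset.empty_subset _, fun C hC D hD => ?_, fun C hC => ?_, by simp,
    by simp [deg]⟩, Nat.floor_mono ?_⟩
  · exact (Finset.mem_filter.1 hC).2 D (Finset.mem_filter.1 hD).1
  · exact h C (Finset.mem_filter.1 hC).1
  · simp [Wt]

/-- The recurrence of the tree: the heart raises the potential by at least `s = 1 / θ_k`, the petals
by at least `2 k κ`. Bernoulli's inequality gives `2 ^ (-s) ≤ 1 - s / 2`, and the second term is at
most `s / 2` because `2 θ_k ≤ 2 ^ (2 k κ)`. -/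
theorem two_rpow_neg_add_le {κ k : ℕ} (hκ : 1 ≤ κ) (hk : 1 ≤ k) :
    (2 : ℝ) ^ (-(1 / θ κ k : ℝ)) + 2 ^ (-(2 * k * κ : ℝ)) ≤ 1 := by
  have h1 : (2 : ℝ) ^ (-(2 * k * κ : ℝ)) ≤ 1 / (2 * θ κ k) := by
    rw [Real.rpow_neg (by norm_num), ← one_div]
    refine one_div_le_one_div_of_le ?_ ?_
    · have : (0 : ℝ) < θ κ k := by exact_mod_cast one_le_θ κ k
      positivity
    · have : 2 * θ κ k ≤ 2 ^ (2 * k * κ) := by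
        rw [θ, ← pow_succ']
        refine Nat.pow_le_pow_right (by norm_num) ?_
        obtain ⟨x, rfl⟩ : ∃ x, k = x + 1 := ⟨k - 1, by omega⟩
        rw [show 2 * (x + 1) - 1 = 2 * x + 1 by omega]
        nlinarith
      have h' : ((2 * θ κ k : ℕ) : ℝ) ≤ ((2 ^ (2 * k * κ) : ℕ) : ℝ) := by exact_mod_cast this
      rw [show (2 * k * κ : ℝ) = ((2 * k * κ : ℕ) : ℝ) by push_cast; ring, Real.rpow_natCast]
      exact_mod_cast h'
  have hθ : (1 : ℝ) ≤ θ κ k := by exact_mod_cast one_le_θ κ k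
  set s : ℝ := 1 / θ κ k with hs
  have hs0 : 0 < s := by positivity
  have hs1 : s ≤ 1 := by rw [hs, div_le_one (by linarith)]; exact hθ
  have h2 : (2 : ℝ) ^ (-s) ≤ 1 - s / 2 := by
    have h3 : (1 / 2 : ℝ) ^ s ≤ 1 + s * (-1 / 2) := by
      have := rpow_one_add_le_one_add_mul_self (s := -1 / 2) (by norm_num) hs0.le hs1
      norm_num at this ⊢
      exact this
    rw [Real.rpow_neg (by norm_num), ← Real.inv_rpow (by norm_num), ← one_div]
    linarith
  have h4 : 1 / (2 * θ κ k : ℝ) = s / 2 := by rw [hs]; ring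
  linarith

/-- The two branches of a sunflower have together a smaller budget. -/
theorem Budget.branch {κ k L N c : ℕ} {X : Finset (Finset ℕ)} {H : Finset ℕ}
    (h : Budget κ k L X N) (hk : 4 * k ≤ 2 ^ κ) (hκ : 1 ≤ κ) (hH : IsPick κ (minimals X) c H) :
    ∃ N₁ N₂, N₁ + N₂ + 1 ≤ N ∧ Budget κ k L (minimals X ∪ {H}) N₁ ∧
      Budget κ k L (minimals X ∪ petals (minimals X) c H) N₂ := by
  obtain ⟨A, hA, hN⟩ := h
  set F := minimals X with hF
  obtain ⟨⟨hH1, hHc, hHd⟩, hmin⟩ := id hH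
  have hpos : 0 < (F.filter fun C => C.card = c ∧ H ⊆ C).card :=
    lt_of_lt_of_le (one_le_θ κ _) hHd
  obtain ⟨C₀, hC₀⟩ := Finset.card_pos.1 hpos
  rw [Finset.mem_filter] at hC₀
  have hck : c ≤ k := hC₀.2.1 ▸ (hA.ground C₀ hC₀.1).2
  -- By the choice of `c` there is no large sunflower of smaller sets, and both the heart and the
  -- petals are smaller than `c`.
  have hclean : ∀ j H', j < c → 1 ≤ H'.card → H'.card < j → deg F j H' ≤ θ κ (j - H'.card) := by
    intro j H' hj h1 h2
    by_contra hcon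
    have := hmin j H' ⟨h1, h2, (not_le.1 hcon).le⟩
    omega
  have hC₀H : C₀ ≠ H := by rintro rfl; omega
  obtain ⟨I₁, W₁⟩ := hA.add (P := {H}) (j := H.card) hk hH1 (by omega)
    (by
      intro Q hQ
      rw [Finset.mem_singleton] at hQ
      subst hQ
      refine ⟨hC₀.2.2.trans (hA.ground C₀ hC₀.1).1, rfl, fun D hD hDH => hC₀H ?_⟩
      have := hA.antichain C₀ hC₀.1 D hD (hDH.trans hC₀.2.2)
      exact (hC₀.2.2.antisymm (this ▸ hDH)).symm)
    (fun H' h1 h2 => ⟨hclean _ _ hHc h1 h2, le_trans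
      ((Finset.card_filter_le _ _).trans (by simp)) (one_le_θ _ _)⟩)
  obtain ⟨I₂, W₂⟩ := hA.add (P := petals F c H) (j := c - H.card) hk (by omega) (by omega)
    (by
      intro Q hQ
      simp only [petals, Finset.mem_filter, Finset.mem_image] at hQ
      obtain ⟨C, ⟨hC, hCc, hHC⟩, rfl⟩ := hQ
      refine ⟨Finset.sdiff_subset.trans (hA.ground C hC).1, ?_, fun D hD hDC => ?_⟩
      · rw [Finset.card_sdiff_of_subset hHC, hCc]
      · obtain rfl := hA.antichain C hC D hD (hDC.trans Finset.sdiff_subset)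
        have := Finset.card_le_card hDC
        rw [Finset.card_sdiff_of_subset hHC] at this
        omega)
    (fun H' h1 h2 => ⟨hclean _ _ (by omega) h1 h2, deg_petals_le hH h1 h2⟩)
  refine ⟨_, _, ?_, ⟨_, I₁, le_rfl⟩, ⟨_, I₂, le_rfl⟩⟩
  have hcardP : (petals F c H).card = deg F c H := by
    refine Finset.card_image_of_injOn fun C hC D hD h' => ?_
    simp only [Finset.coe_filter, Set.mem_ofPred_eq] at hC hD h'
    rw [← Finset.sdiff_union_of_subset hC.2.2, h', Finset.sdiff_union_of_subset hD.2.2]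
  rw [hcardP] at W₂
  rw [Finset.card_singleton, Nat.cast_one, one_mul] at W₁
  have hk1 : (1 : ℝ) ≤ k := by exact_mod_cast (by omega : 1 ≤ k)
  have hκ1 : (1 : ℝ) ≤ κ := by exact_mod_cast hκ
  have hkκ : (1 : ℝ) ≤ k * κ := one_le_mul_of_one_le_of_one_le hk1 hκ1
  have hw1 : (1 / θ κ k : ℝ) ≤ weight κ k H.card / 2 := by
    have h1 : (θ κ H.card : ℝ) ≤ θ κ k := by exact_mod_cast θ_mono (by omega : H.card ≤ k)
    have h2 : (1 : ℝ) ≤ θ κ H.card := by exact_mod_cast one_le_θ κ H.card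
    rw [weight, div_div, div_le_div_iff₀ (by linarith) (by linarith)]
    nlinarith
  -- There are at least `θ_e` petals of size `e`, and each contributes half of `4 k κ / θ_e`.
  have hw2 : (2 * k * κ : ℝ) ≤ deg F c H * weight κ k (c - H.card) / 2 := by
    have h1 : (θ κ (c - H.card) : ℝ) ≤ deg F c H := by exact_mod_cast hHd
    have h2 : (1 : ℝ) ≤ θ κ (c - H.card) := by exact_mod_cast one_le_θ κ (c - H.card)
    rw [weight, mul_div_assoc', div_div, le_div_iff₀ (by linarith)]
    nlinarith
  set E := expo κ k L
  have hA1 : (2 : ℝ) ^ (E - Wt κ k ((A ∪ {H}) ∩ minimals (F ∪ {H}))) ≤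
      2 ^ (E - Wt κ k A) * 2 ^ (-(1 / θ κ k : ℝ)) := by
    rw [← Real.rpow_add (by norm_num)]
    exact Real.rpow_le_rpow_of_exponent_le (by norm_num) (by linarith)
  have hA2 : (2 : ℝ) ^ (E - Wt κ k ((A ∪ petals F c H) ∩ minimals (F ∪ petals F c H))) ≤
      2 ^ (E - Wt κ k A) * 2 ^ (-(2 * k * κ : ℝ)) := by
    rw [← Real.rpow_add (by norm_num)]
    exact Real.rpow_le_rpow_of_exponent_le (by norm_num) (by linarith)
  have hsum := two_rpow_neg_add_le hκ (by omega : 1 ≤ k)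
  have hge1 := (Real.one_le_rpow (by norm_num : (1 : ℝ) ≤ 2) (sub_nonneg.2 I₁.Wt_le))
  have hge2 := (Real.one_le_rpow (by norm_num : (1 : ℝ) ≤ 2) (sub_nonneg.2 I₂.Wt_le))
  have hge0 := (Real.one_le_rpow (by norm_num : (1 : ℝ) ≤ 2) (sub_nonneg.2 hA.Wt_le))
  -- If the leaf bounds satisfy `x₁ + x₂ ≤ x`, then the node bounds satisfy `(2 x₁ - 1) + (2 x₂ - 1)
  -- + 1 ≤ 2 x - 1`.
  refine le_trans (Nat.le_floor ?_) hN
  push_cast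
  change 1 ≤ (2 : ℝ) ^ (E - _) at hge1 hge2 hge0
  have hf1 := Nat.floor_le (a := 2 * (2 : ℝ) ^ (E - Wt κ k ((A ∪ {H}) ∩ minimals (F ∪ {H}))) - 1)
    (by linarith)
  have hf2 := Nat.floor_le (a := 2 * (2 : ℝ) ^ (E - Wt κ k ((A ∪ petals F c H) ∩
    minimals (F ∪ petals F c H))) - 1) (by linarith)
  nlinarith

end Sparsify

/-! ### Unread cells -/

namespace WordRAM

theorem Exec.det {W : ℕ} {p : Prog} {s s₁ s₂ : State} {t₁ t₂ : ℕ} (h₁ : Exec W p s t₁ s₁)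
    (h₂ : Exec W p s t₂ s₂) : t₁ = t₂ ∧ s₁ = s₂ := by
  induction h₁ generalizing t₂ s₂ with
  | nop | const | op | load | store => cases h₂; exact ⟨rfl, rfl⟩
  | seq _ _ ih1 ih2 =>
    cases h₂ with
    | seq hp hq =>
      obtain ⟨rfl, rfl⟩ := ih1 hp
      obtain ⟨rfl, rfl⟩ := ih2 hq
      exact ⟨rfl, rfl⟩
  | iteTrue h _ ih =>
    cases h₂ with
    | iteTrue _ hp => obtain ⟨rfl, rfl⟩ := ih hp; exact ⟨rfl, rfl⟩
    | iteFalse h' _ => exact absurd h' h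
  | iteFalse h _ ih =>
    cases h₂ with
    | iteTrue h' _ => exact absurd h h'
    | iteFalse _ hp => obtain ⟨rfl, rfl⟩ := ih hp; exact ⟨rfl, rfl⟩
  | loopStop h =>
    cases h₂ with
    | loopStop => exact ⟨rfl, rfl⟩
    | loopStep h' => exact absurd h h'
  | loopStep h _ _ ih1 ih2 =>
    cases h₂ with
    | loopStop h' => exact absurd h' h
    | loopStep _ hp hl =>
      obtain ⟨rfl, rfl⟩ := ih1 hp
      obtain ⟨rfl, rfl⟩ := ih2 hl
      exact ⟨rfl, rfl⟩

/-- The states agree except perhaps in cell `j` of array `0`. -/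
def AgreeOff (j : ℕ) (s s' : State) : Prop :=
  s'.reg = s.reg ∧ ∀ a i, ¬ (a = 0 ∧ i = j) → s'.mem a i = s.mem a i

theorem AgreeOff.setReg {j : ℕ} {s s' : State} (h : AgreeOff j s s') {r v v' : ℕ} (hv : v' = v) :
    AgreeOff j (s.setReg r v) (s'.setReg r v') := by
  subst hv
  exact ⟨by simp [State.setReg, h.1], h.2⟩

/-- A computation reads at most one cell per step, and it does not depend on the others. -/
theorem Exec.unread {W : ℕ} {p : Prog} {s s' : State} {t : ℕ} (h : Exec W p s t s') :
    ∃ R : Finset ℕ, R.card ≤ t ∧ ∀ j ∉ R, ∀ s₁, AgreeOff j s s₁ →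
      ∃ s₁', Exec W p s₁ t s₁' ∧ AgreeOff j s' s₁' := by
  induction h with
  | nop s => exact ⟨∅, by simp, fun j _ s₁ h => ⟨s₁, .nop _, h⟩⟩
  | const r v s h => exact ⟨∅, by simp, fun j _ s₁ h' => ⟨_, .const _ _ _ h, h'.setReg rfl⟩⟩
  | op o r x y s h =>
    refine ⟨∅, by simp, fun j _ s₁ h' => ⟨_, .op _ _ _ _ _ (by rwa [h'.1]), h'.setReg ?_⟩⟩
    rw [h'.1]
  | load r a x s =>
    refine ⟨{s.reg x}, by simp, fun j hj s₁ h' => ⟨_, .load _ _ _ _, h'.setReg ?_⟩⟩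
    rw [h'.1]
    exact h'.2 _ _ fun hh => hj (by simp [hh.2])
  | store a x y s =>
    refine ⟨∅, by simp, fun j _ s₁ h' => ⟨_, .store _ _ _ _, by simpa using h'.1, ?_⟩⟩
    intro a' i' hne
    rw [State.setMem_mem_apply, State.setMem_mem_apply, h'.1, h'.2 _ _ hne]
  | seq _ _ ih1 ih2 =>
    obtain ⟨R₁, c₁, h₁⟩ := ih1
    obtain ⟨R₂, c₂, h₂⟩ := ih2
    refine ⟨R₁ ∪ R₂, (Finset.card_union_le _ _).trans (add_le_add c₁ c₂), fun j hj s₁ h' => ?_⟩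
    rw [Finset.notMem_union] at hj
    obtain ⟨s₂, e₂, a₂⟩ := h₁ j hj.1 s₁ h'
    obtain ⟨s₃, e₃, a₃⟩ := h₂ j hj.2 s₂ a₂
    exact ⟨s₃, .seq e₂ e₃, a₃⟩
  | iteTrue h _ ih =>
    obtain ⟨R, c, h₁⟩ := ih
    refine ⟨R, by omega, fun j hj s₁ h' => ?_⟩
    obtain ⟨s₂, e₂, a₂⟩ := h₁ j hj s₁ h'
    exact ⟨s₂, .iteTrue (by rwa [h'.1]) e₂, a₂⟩
  | iteFalse h _ ih =>
    obtain ⟨R, c, h₁⟩ := ih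
    refine ⟨R, by omega, fun j hj s₁ h' => ?_⟩
    obtain ⟨s₂, e₂, a₂⟩ := h₁ j hj s₁ h'
    exact ⟨s₂, .iteFalse (by rwa [h'.1]) e₂, a₂⟩
  | loopStop h => exact ⟨∅, by simp, fun j _ s₁ h' => ⟨s₁, .loopStop (by rwa [h'.1]), h'⟩⟩
  | loopStep h _ _ ih1 ih2 =>
    obtain ⟨R₁, c₁, h₁⟩ := ih1
    obtain ⟨R₂, c₂, h₂⟩ := ih2
    refine ⟨R₁ ∪ R₂, (Finset.card_union_le _ _).trans (by omega), fun j hj s₁ h' => ?_⟩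
    rw [Finset.notMem_union] at hj
    obtain ⟨s₂, e₂, a₂⟩ := h₁ j hj.1 s₁ h'
    obtain ⟨s₃, e₃, a₃⟩ := h₂ j hj.2 s₂ a₂
    exact ⟨s₃, .loopStep (by rwa [h'.1]) e₂ e₃, a₃⟩

end WordRAM

/-! ### The dimension is at most the running time -/

open WordRAM

theorem matVecInput_mem_zero {n d : ℕ} (x : Fin n → Fin d → Fin 3) (z : Fin n → Fin 2)
    (i : ℕ) : (matVecInput x z).mem 0 i =
      if h : i / d < n ∧ 0 < d then
        (x ⟨i / d, h.1⟩ ⟨i % d, Nat.mod_lt _ h.2⟩ : ℕ) else 0 := by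
  by_cases hd : 0 < d
  · by_cases h : i < n * d
    · have h' : i / d < n := (Nat.div_lt_iff_lt_mul hd).2 h
      rw [dif_pos ⟨h', hd⟩]
      simp only [matVecInput, dif_pos h]
      rfl
    · have h' : ¬ i / d < n := fun h' => h ((Nat.div_lt_iff_lt_mul hd).1 h')
      rw [dif_neg fun hh => h' hh.1]
      simp only [matVecInput, dif_neg h]
  · obtain rfl : d = 0 := by omega
    simp [matVecInput]

/-- A program must read all coordinates of a point. -/
theorem ComputesLinftyMatVec.dim_le {P : Prog} {D T : ℕ → ℕ} (h : ComputesLinftyMatVec P D T)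
    {n : ℕ} (hn : 2 ≤ n) : D n ≤ T n := by
  obtain ⟨C, hC⟩ := h
  by_contra hlt
  set d := D n with hd
  -- All points coincide and all outputs are 0. A run of fewer than `d` steps leaves a coordinate of
  -- point 0 unread; raising it to 1 must change the output of row 1, but the run cannot notice.
  obtain ⟨t, s, he, ht, hout⟩ := hC n d le_rfl (fun _ _ => 0) (fun _ => 1)
  obtain ⟨R, hRc, hR⟩ := he.unread
  have ht := ht rfl
  obtain ⟨j, hj, hjR⟩ : ∃ j ∈ Finset.range d, j ∉ R := by
    by_contra! hcon
    have := Finset.card_le_card (show Finset.range d ⊆ R from hcon)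
    rw [Finset.card_range] at this
    omega
  rw [Finset.mem_range] at hj
  let x' : Fin n → Fin d → Fin 3 := fun i r => if (i : ℕ) = 0 ∧ (r : ℕ) = j then 1 else 0
  obtain ⟨s₁, e₁, a₁⟩ := hR j hjR (matVecInput x' fun _ => 1) (by
    refine ⟨rfl, fun a i hne => ?_⟩
    rcases a with _ | _ | a
    · rw [matVecInput_mem_zero, matVecInput_mem_zero]
      split_ifs with h
      · have : ¬ (i / d = 0 ∧ i % d = j) := by
          rintro ⟨h1, h2⟩
          refine hne ⟨rfl, ?_⟩
          rw [← Nat.div_add_mod i d, h1, h2]; simp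
        simp only [x', if_neg this]
      · rfl
    · rfl
    · rfl)
  obtain ⟨t₂, s₂, e₂, -, hout₂⟩ := hC n d le_rfl x' (fun _ => 1)
  obtain ⟨-, rfl⟩ := e₁.det e₂
  have h0 := hout ⟨1, by omega⟩
  have h1 := hout₂ ⟨1, by omega⟩
  rw [a₁.2 2 _ (by simp), h0] at h1
  have h2 : (linftyDistMatrix fun (i : Fin n) (j : Fin d) => (((0 : Fin 3) : ℕ) : ℝ)).mulVec
      (fun j => (((1 : Fin 2) : ℕ) : ℝ)) ⟨1, by omega⟩ = 0 := by
    simp [Matrix.mulVec, dotProduct, linftyDistMatrix]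
  rw [h2] at h1
  simp only [Matrix.mulVec, dotProduct, linftyDistMatrix, Matrix.of_apply, Fin.val_one,
    Nat.cast_one, mul_one] at h1
  have h3 := (Finset.sum_eq_zero_iff_of_nonneg fun _ _ => norm_nonneg _).1 h1.symm
    ⟨0, by omega⟩ (Finset.mem_univ _)
  have h4 := congrFun (norm_eq_zero.1 h3) ⟨j, hj⟩
  simp [x'] at h4

/-! ### Clocked simulation -/

namespace WordRAM

namespace Prog

/-- All registers and constants that occur are smaller than `B`. -/
def Below (B : ℕ) : Prog → Prop
  | nop => True
  | const r v => r < B ∧ v < B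
  | op _ r x y => r < B ∧ x < B ∧ y < B
  | load r _ x => r < B ∧ x < B
  | store _ x y => x < B ∧ y < B
  | seq p q => p.Below B ∧ q.Below B
  | ite x p q => x < B ∧ p.Below B ∧ q.Below B
  | loop x p => x < B ∧ p.Below B

theorem Below.mono {B B' : ℕ} (h : B ≤ B') {p : Prog} (hp : p.Below B) : p.Below B' := by
  induction p with
  | nop => trivial
  | const | op | load | store => simp only [Below] at hp ⊢; omega
  | seq p q ihp ihq => exact ⟨ihp hp.1, ihq hp.2⟩
  | ite x p q ihp ihq => exact ⟨hp.1.trans_le h, ihp hp.2.1, ihq hp.2.2⟩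
  | loop x p ih => exact ⟨hp.1.trans_le h, ih hp.2⟩

theorem exists_below (p : Prog) : ∃ B, p.Below B := by
  induction p with
  | nop => exact ⟨0, trivial⟩
  | const r v => exact ⟨r + v + 1, by simp only [Below]; omega⟩
  | op o r x y => exact ⟨r + x + y + 1, by simp only [Below]; omega⟩
  | load r a x => exact ⟨r + x + 1, by simp only [Below]; omega⟩
  | store a x y => exact ⟨x + y + 1, by simp only [Below]; omega⟩
  | seq p q ihp ihq =>
    obtain ⟨B, hB⟩ := ihp
    obtain ⟨B', hB'⟩ := ihq
    exact ⟨max B B', hB.mono (le_max_left _ _), hB'.mono (le_max_right _ _)⟩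
  | ite x p q ihp ihq =>
    obtain ⟨B, hB⟩ := ihp
    obtain ⟨B', hB'⟩ := ihq
    exact ⟨max (x + 1) (max B B'), by simp, hB.mono (by simp), hB'.mono (by simp)⟩
  | loop x p ih =>
    obtain ⟨B, hB⟩ := ih
    exact ⟨max (x + 1) B, by simp, hB.mono (by simp)⟩

/-- Register `x` of the simulated machine, kept in array `10`. -/
def simReg (ba x : ℕ) : Expr := .load 10 (.op .add (.reg ba) (.lit x))

/-- Take one unit of fuel. -/
def tick (fu : ℕ) : Cmd := .set fu (.op .sub (.reg fu) (.lit 1))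

/-- Execute the command only if there is fuel left, and take one unit of fuel. -/
def guarded (fu : ℕ) (c : Cmd) : Cmd := .seq (.ite (.reg fu) c .skip) (tick fu)

/-- The condition of a simulated loop. -/
def simCond (fu ba x : ℕ) : Expr :=
  .op .and (.op .lt (.lit 0) (.reg fu)) (.op .lt (.lit 0) (simReg ba x))

/-- Simulation of `p`, with the fuel in register `fu`, in the memory from the address in register
`ba` on; array `a` is kept in array `a + 11`. -/
def sim (fu ba : ℕ) : Prog → Cmd
  | nop => guarded fu .skip
  | const r v => guarded fu (.store 10 (.op .add (.reg ba) (.lit r)) (.lit v))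
  | op o r x y => guarded fu
      (.store 10 (.op .add (.reg ba) (.lit r)) (.op o (simReg ba x) (simReg ba y)))
  | load r a x => guarded fu (.store 10 (.op .add (.reg ba) (.lit r))
      (.load (a + 11) (.op .add (.reg ba) (simReg ba x))))
  | store a x y => guarded fu
      (.store (a + 11) (.op .add (.reg ba) (simReg ba x)) (simReg ba y))
  | seq p q => .seq (p.sim fu ba) (q.sim fu ba)
  | ite x p q => .seq (tick fu) (.ite (simReg ba x) (p.sim fu ba) (q.sim fu ba))
  | loop x p => .seq (.while (simCond fu ba x) (.seq (tick fu) (p.sim fu ba))) (tick fu)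

/-- The number of steps of the simulation without fuel. -/
def simCost : Prog → ℕ
  | nop => 20
  | const _ _ => 20
  | op _ _ _ _ => 30
  | load _ _ _ => 30
  | store _ _ _ => 30
  | seq p q => p.simCost + q.simCost
  | ite _ p q => p.simCost + q.simCost + 20
  | loop _ p => p.simCost + 20

theorem sim_wregs (fu ba : ℕ) (p : Prog) : ∀ r ∈ (p.sim fu ba).wregs, r = fu := by
  induction p with
  | nop | const | op | load | store => simp [sim, guarded, tick, Cmd.wregs]
  | seq p q ihp ihq =>
    intro r hr
    rcases List.mem_append.1 hr with h | h
    exacts [ihp r h, ihq r h]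
  | ite x p q ihp ihq =>
    intro r hr
    simp only [sim, tick, Cmd.wregs, List.mem_append, List.mem_singleton] at hr
    rcases hr with h | h | h
    exacts [h, ihp r h, ihq r h]
  | loop x p ih =>
    intro r hr
    simp only [sim, tick, Cmd.wregs, List.mem_append, List.mem_singleton] at hr
    rcases hr with (h | h) | h
    exacts [h, ih r h, h]

theorem sim_warrs (fu ba : ℕ) (p : Prog) : ∀ a ∈ (p.sim fu ba).warrs, 10 ≤ a := by
  induction p with
  | nop | const | op | load | store => simp [sim, guarded, tick, Cmd.warrs]
  | seq p q ihp ihq =>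
    intro r hr
    rcases List.mem_append.1 hr with h | h
    exacts [ihp r h, ihq r h]
  | ite x p q ihp ihq =>
    intro r hr
    simp only [sim, tick, Cmd.warrs, List.mem_append, List.not_mem_nil, false_or] at hr
    rcases hr with h | h
    exacts [ihp r h, ihq r h]
  | loop x p ih =>
    intro r hr
    simp only [sim, tick, Cmd.warrs, List.mem_append, List.not_mem_nil, false_or, or_false] at hr
    exact ih r hr

theorem setReg_self {s : State} {r v : ℕ} (h : s.reg r = v) : s.setReg r v = s := by
  subst h
  simp [State.setReg]

theorem tick_exec {W fu : ℕ} (hW : 1 ≤ W) (s : State) :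
    CExec W (tick fu) s 4 (s.setReg fu (s.reg fu - 1)) :=
  CExec.set (e := .op .sub (.reg fu) (.lit 1)) ⟨trivial, hW, trivial⟩

theorem tick_zero {W fu : ℕ} (hW : 1 ≤ W) {s : State} (h : s.reg fu = 0) :
    CExec W (tick fu) s 4 s := by
  have := tick_exec (fu := fu) hW s
  rwa [setReg_self (by rw [h])] at this

theorem guarded_zero {W fu : ℕ} (hW : 1 ≤ W) {s : State} (h : s.reg fu = 0) (c : Cmd) :
    CExec W (guarded fu c) s 7 s :=
  .seq (.iteFalse (e := .reg fu) trivial h (.skip s)) (tick_zero hW h)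

theorem simReg_ok {W ba x B : ℕ} {s : State} (hB : s.reg ba + B ≤ W) (hx : x < B) :
    (simReg ba x).Ok W s := by
  simp only [simReg, Expr.Ok, BinOp.Fits, Expr.eval, true_and]; omega

/-- Without fuel every instruction is skipped and every loop guard fails. The rest of the program is
passed in a time that depends only on its text; it does not matter which branch of a conditional is
taken. -/
theorem sim_zero {W fu ba B : ℕ} {p : Prog} (hp : p.Below B) {s : State} (h : s.reg fu = 0)
    (hB : s.reg ba + B ≤ W) (hW : 1 ≤ W) : ∃ t ≤ p.simCost, CExec W (p.sim fu ba) s t s := by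
  induction p with
  | nop | const | op | load | store =>
    exact ⟨7, by simp [simCost], guarded_zero hW h _⟩
  | seq p q ihp ihq =>
    obtain ⟨t, ht, e⟩ := ihp hp.1
    obtain ⟨t', ht', e'⟩ := ihq hp.2
    exact ⟨t + t', add_le_add ht ht', .seq e e'⟩
  | ite x p q ihp ihq =>
    obtain ⟨t, ht, e⟩ := ihp hp.2.1
    obtain ⟨t', ht', e'⟩ := ihq hp.2.2
    have hok : (simReg ba x).Ok W s := simReg_ok hB hp.1
    by_cases h0 : (simReg ba x).eval s = 0
    · refine ⟨_, ?_, .seq (tick_zero hW h) (.iteFalse hok h0 e')⟩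
      simp only [simReg, Expr.cost, simCost]; omega
    · refine ⟨_, ?_, .seq (tick_zero hW h) (.iteTrue hok h0 e)⟩
      simp only [simReg, Expr.cost, simCost]; omega
  | loop x p ih =>
    have hok : (simCond fu ba x).Ok W s :=
      ⟨⟨Nat.zero_le _, trivial, trivial⟩, ⟨Nat.zero_le _, simReg_ok hB hp.1, trivial⟩,
        trivial⟩
    refine ⟨_, ?_, .seq (.whileStop hok ?_) (tick_zero hW h)⟩
    · simp only [simCond, simReg, Expr.cost, simCost]; omega
    · simp [simCond, Expr.eval, BinOp.eval, h]

/-- The memory of `s₁` from `base` on holds the configuration `s`. -/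
def Rel (base : ℕ) (s s₁ : State) : Prop :=
  (∀ r, s₁.mem 10 (base + r) = s.reg r) ∧ ∀ a i, s₁.mem (a + 11) (base + i) = s.mem a i

theorem Rel.setReg {base r v : ℕ} {s s₁ : State} (h : Rel base s s₁) :
    Rel base (s.setReg r v) (s₁.setMem 10 (base + r) v) := by
  refine ⟨fun r' => ?_, fun a i => ?_⟩
  · rw [State.setMem_mem_apply, State.setReg_reg]
    by_cases hr : r' = r
    · simp [hr]
    · rw [if_neg (by omega), if_neg hr, h.1]
  · rw [State.setMem_mem_apply, if_neg (by omega), h.2]; rfl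

theorem Rel.setMem {base a i v : ℕ} {s s₁ : State} (h : Rel base s s₁) :
    Rel base (s.setMem a i v) (s₁.setMem (a + 11) (base + i) v) := by
  refine ⟨fun r' => ?_, fun a' i' => ?_⟩
  · rw [State.setMem_mem_apply, if_neg (by omega), h.1]; rfl
  · rw [State.setMem_mem_apply, State.setMem_mem_apply]
    by_cases hr : a' = a ∧ i' = i
    · simp [hr]
    · rw [if_neg (by omega), if_neg hr, h.2]

/-- The result of the simulation of `t` steps that lead to `s'`. -/
def SimPost (fu base B : ℕ) (p : Prog) (t : ℕ) (s' s₁ : State) (t₁ : ℕ) (s₁' : State) : Prop :=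
  s₁'.reg fu = s₁.reg fu - t ∧ t₁ ≤ p.simCost * (s₁.reg fu - s₁'.reg fu + 1) ∧
    (∀ a i, base + B ≤ i → s₁'.mem a i = s₁.mem a i) ∧
    (0 < s₁'.reg fu → Rel base s' s₁')

theorem sim_exec_zero {W fu ba B base : ℕ} {p : Prog} (hp : p.Below B) {s' s₁ : State} (t : ℕ)
    (h : s₁.reg fu = 0) (hba : s₁.reg ba = base) (hB : base + B ≤ W) (hW : 1 ≤ W) :
    wp W (p.sim fu ba) s₁ (SimPost fu base B p t s' s₁) := by
  obtain ⟨t₁, ht, e⟩ := sim_zero (fu := fu) (ba := ba) hp h (hba ▸ hB) hW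
  exact ⟨t₁, s₁, e, by omega, by simpa using ht, fun _ _ _ => rfl, fun h' => by omega⟩

theorem sim_guarded {W fu ba B base : ℕ} {p : Prog} {c : Cmd} {s' s₁ s₂ : State} {t₁ : ℕ}
    (hW : 1 ≤ W) (hsim : p.sim fu ba = guarded fu c) (hc : CExec W c s₁ t₁ s₂)
    (ht : t₁ + 6 ≤ p.simCost) (hf : s₁.reg fu ≠ 0) (hreg : s₂.reg fu = s₁.reg fu)
    (hmem : ∀ a i, base + B ≤ i → s₂.mem a i = s₁.mem a i) (hR : Rel base s' s₂) :
    wp W (p.sim fu ba) s₁ (SimPost fu base B p 1 s' s₁) := by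
  rw [hsim]
  refine ⟨_, _, .seq (.iteTrue (e := .reg fu) trivial hf hc) (tick_exec hW _), ?_, ?_, hmem,
      fun _ => hR⟩
  · simp [hreg]
  · simp only [Expr.cost, State.setReg_reg, if_true, hreg]
    rw [show s₁.reg fu - (s₁.reg fu - 1) + 1 = 2 by omega]
    omega

/-- The configurations correspond only as long as fuel is left; afterwards `sim_zero` takes over.
Simulated addresses are words of the small machine, so only cells below `base + B` change, and the
memory above stays new for the next call. The time is charged to the fuel that was consumed, plus
one pass over the text. -/
theorem sim_exec {W W₀ fu ba B base : ℕ} (hfb : fu ≠ ba) (hWB : W₀ < B) (hB : base + B ≤ W)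
    {p : Prog} {s s' : State} {t : ℕ} (h : Exec W₀ p s t s') : ∀ {s₁ : State}, p.Below B →
      s.Bounded W₀ → s₁.reg ba = base → Rel base s s₁ →
      wp W (p.sim fu ba) s₁ (SimPost fu base B p t s' s₁) := by
  have hW : 1 ≤ W := by omega
  have hadd : ∀ (s₁ : State) (r : ℕ), s₁.reg ba = base → r < B →
      (Expr.op .add (.reg ba) (.lit r)).Ok W s₁ := fun s₁ r h1 h2 =>
    ⟨trivial, show r ≤ W by omega, show s₁.reg ba + r ≤ W by omega⟩
  have hreg : ∀ (s s₁ : State) (r : ℕ), s₁.reg ba = base → Rel base s s₁ →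
      (simReg ba r).eval s₁ = s.reg r := fun s s₁ r h1 h2 => by
    simp only [simReg, Expr.eval, BinOp.eval, h1, h2.1]
  induction h with
  | nop s =>
    intro s₁ hp hb hba hR
    by_cases hf : s₁.reg fu = 0
    · exact sim_exec_zero hp _ hf hba hB hW
    exact sim_guarded hW rfl (.skip s₁) (by simp [simCost]) hf rfl (fun _ _ _ => rfl) hR
  | const r v s hv =>
    intro s₁ hp hb hba hR
    by_cases hf : s₁.reg fu = 0
    · exact sim_exec_zero hp _ hf hba hB hW
    refine sim_guarded hW rfl (.store (hadd s₁ r hba hp.1) (show v ≤ W by omega)) ?_ hf rfl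
      (fun a i hi => ?_) ?_
    · simp [simCost, Expr.cost]
    · rw [State.setMem_mem_apply, if_neg]
      simp only [Expr.eval, BinOp.eval]
      have := hp.1
      omega
    · simp only [Expr.eval, BinOp.eval, hba]
      exact hR.setReg
  | op o r x y s hv =>
    intro s₁ hp hb hba hR
    by_cases hf : s₁.reg fu = 0
    · exact sim_exec_zero hp _ hf hba hB hW
    refine sim_guarded hW rfl (.store (hadd s₁ r hba hp.1)
      (show (Expr.op o (simReg ba x) (simReg ba y)).Ok W s₁ from
        ⟨hadd s₁ x hba hp.2.1, hadd s₁ y hba hp.2.2, ?_⟩)) ?_ hf rfl (fun a i hi => ?_) ?_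
    · rw [hreg s s₁ x hba hR, hreg s s₁ y hba hR]
      cases o <;> simp only [BinOp.Fits, BinOp.eval] at hv ⊢ <;> omega
    · simp [simCost, Expr.cost, simReg]
    · rw [State.setMem_mem_apply, if_neg]
      simp only [Expr.eval, BinOp.eval]
      have := hp.1
      omega
    · rw [show (Expr.op o (simReg ba x) (simReg ba y)).eval s₁ = o.eval (s.reg x) (s.reg y) by
        rw [Expr.eval, hreg s s₁ x hba hR, hreg s s₁ y hba hR]]
      simp only [Expr.eval, BinOp.eval, hba]
      exact hR.setReg
  | load r a x s =>
    intro s₁ hp hb hba hR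
    by_cases hf : s₁.reg fu = 0
    · exact sim_exec_zero hp _ hf hba hB hW
    have hx := hb.1 x
    refine sim_guarded hW rfl (.store (hadd s₁ r hba hp.1)
      (show (Expr.load (a + 11) (.op .add (.reg ba) (simReg ba x))).Ok W s₁ from
        ⟨trivial, hadd s₁ x hba hp.2, ?_⟩)) ?_ hf rfl (fun a i hi => ?_) ?_
    · rw [hreg s s₁ x hba hR]
      show s₁.reg ba + s.reg x ≤ W
      omega
    · simp [simCost, Expr.cost, simReg]
    · rw [State.setMem_mem_apply, if_neg]
      simp only [Expr.eval, BinOp.eval]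
      have := hp.1
      omega
    · rw [show (Expr.load (a + 11) (.op .add (.reg ba) (simReg ba x))).eval s₁ =
        s.mem a (s.reg x) by
          rw [Expr.eval, Expr.eval, hreg s s₁ x hba hR, ← hR.2, ← hba]; rfl]
      simp only [Expr.eval, BinOp.eval, hba]
      exact hR.setReg
  | store a x y s =>
    intro s₁ hp hb hba hR
    by_cases hf : s₁.reg fu = 0
    · exact sim_exec_zero hp _ hf hba hB hW
    have hx := hb.1 x
    have haddr : (Expr.op .add (.reg ba) (simReg ba x)).eval s₁ = base + s.reg x := by
      rw [Expr.eval, hreg s s₁ x hba hR, ← hba]; rfl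
    refine sim_guarded hW rfl (.store
      (show (Expr.op .add (.reg ba) (simReg ba x)).Ok W s₁ from
        ⟨trivial, hadd s₁ x hba hp.1, ?_⟩) (hadd s₁ y hba hp.2)) ?_ hf rfl (fun a i hi => ?_) ?_
    · rw [hreg s s₁ x hba hR]
      show s₁.reg ba + s.reg x ≤ W
      omega
    · simp [simCost, Expr.cost, simReg]
    · rw [State.setMem_mem_apply, if_neg]
      rw [haddr]
      omega
    · rw [haddr, ← hreg s s₁ y hba hR]
      exact hR.setMem
  | @seq p q s s' s'' t t' h1 h2 ih1 ih2 =>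
    intro s₁ hp hb hba hR
    by_cases hf : s₁.reg fu = 0
    · exact sim_exec_zero hp _ hf hba hB hW
    rw [sim, wp_seq]
    refine (ih1 hp.1 hb hba hR).mono fun t₁ s₂ fr h => ?_
    have hba2 : s₂.reg ba = base := by
      rw [fr.1 ba fun hh => hfb (sim_wregs fu ba p _ hh).symm, hba]
    -- Either the first part used up the fuel and the second is skipped, or the configurations still
    -- correspond.
    have key : wp W (q.sim fu ba) s₂ (SimPost fu base B q t' s'' s₂) := by
      rcases Nat.eq_zero_or_pos (s₂.reg fu) with h0 | h0
      · exact sim_exec_zero hp.2 _ h0 hba2 hB hW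
      · exact ih2 hp.2 (h1.bounded hb) hba2 (h.2.2.2 h0)
    refine key.mono fun t₂ s₃ _ h' => ⟨?_, ?_, fun a i hi => ?_, h'.2.2.2⟩
    · rw [h'.1, h.1]; omega
    · have a1 := h.2.1
      have a2 := h'.2.1
      have b1 := h.1
      have b2 := h'.1
      rw [simCost, add_mul]
      refine add_le_add (a1.trans (Nat.mul_le_mul_left _ ?_)) (a2.trans (Nat.mul_le_mul_left _ ?_))
        <;> omega
    · rw [h'.2.2.1 a i hi, h.2.2.1 a i hi]
  | @iteTrue x p q s s' t h h1 ih =>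
    intro s₁ hp hb hba hR
    by_cases hf : s₁.reg fu = 0
    · exact sim_exec_zero hp _ hf hba hB hW
    have hba2 : (s₁.setReg fu (s₁.reg fu - 1)).reg ba = base := by simp [hfb.symm, hba]
    obtain ⟨t₂, s₂, e₂, h₂⟩ := ih (s₁ := s₁.setReg fu (s₁.reg fu - 1)) hp.2.1 hb hba2 hR
    refine ⟨_, s₂, .seq (tick_exec hW _) (.iteTrue (hadd _ x hba2 hp.1) ?_ e₂), ?_, ?_,
      h₂.2.2.1, h₂.2.2.2⟩
    · rwa [hreg s _ x hba2 hR]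
    · have := h₂.1
      simp only [State.setReg_reg, if_true] at this
      omega
    · have b1 := h₂.1
      have b2 := h₂.2.1
      simp only [State.setReg_reg, if_true] at b1 b2
      have b3 := b2.trans (Nat.mul_le_mul_left p.simCost
        (by omega : s₁.reg fu - 1 - s₂.reg fu + 1 ≤ s₁.reg fu - s₂.reg fu + 1))
      simp only [simReg, Expr.cost, simCost]
      nlinarith [Nat.zero_le (q.simCost * (s₁.reg fu - s₂.reg fu + 1))]
  | @iteFalse x p q s s' t h h1 ih =>
    intro s₁ hp hb hba hR
    by_cases hf : s₁.reg fu = 0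
    · exact sim_exec_zero hp _ hf hba hB hW
    have hba2 : (s₁.setReg fu (s₁.reg fu - 1)).reg ba = base := by simp [hfb.symm, hba]
    obtain ⟨t₂, s₂, e₂, h₂⟩ := ih (s₁ := s₁.setReg fu (s₁.reg fu - 1)) hp.2.2 hb hba2 hR
    refine ⟨_, s₂, .seq (tick_exec hW _) (.iteFalse (hadd _ x hba2 hp.1) ?_ e₂), ?_, ?_,
      h₂.2.2.1, h₂.2.2.2⟩
    · rwa [hreg s _ x hba2 hR]
    · have := h₂.1
      simp only [State.setReg_reg, if_true] at this
      omega
    · have b1 := h₂.1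
      have b2 := h₂.2.1
      simp only [State.setReg_reg, if_true] at b1 b2
      have b3 := b2.trans (Nat.mul_le_mul_left q.simCost
        (by omega : s₁.reg fu - 1 - s₂.reg fu + 1 ≤ s₁.reg fu - s₂.reg fu + 1))
      simp only [simReg, Expr.cost, simCost]
      nlinarith [Nat.zero_le (p.simCost * (s₁.reg fu - s₂.reg fu + 1))]
  | @loopStop x p s h =>
    intro s₁ hp hb hba hR
    by_cases hf : s₁.reg fu = 0
    · exact sim_exec_zero hp _ hf hba hB hW
    refine ⟨_, _, .seq (.whileStop (e := simCond fu ba x)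
      ⟨⟨Nat.zero_le _, trivial, trivial⟩, ⟨Nat.zero_le _, hadd _ x hba hp.1, trivial⟩, trivial⟩ ?_)
      (tick_exec hW _), ?_, ?_, fun _ _ _ => rfl, fun _ => hR⟩
    · rw [simCond, Expr.eval, Expr.eval, Expr.eval.eq_3 _ _ _ (simReg ba x), hreg s _ x hba hR, h]
      simp [BinOp.eval]
    · simp
    · simp only [simCond, simReg, Expr.cost, simCost]
      nlinarith [Nat.zero_le (s₁.reg fu - (s₁.setReg fu (s₁.reg fu - 1)).reg fu),
        Nat.zero_le (p.simCost * (s₁.reg fu - (s₁.setReg fu (s₁.reg fu - 1)).reg fu))]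
  | @loopStep x p s s' s'' t t' h h1 h2 ih1 ih2 =>
    intro s₁ hp hb hba hR
    by_cases hf : s₁.reg fu = 0
    · exact sim_exec_zero hp _ hf hba hB hW
    have hba2 : (s₁.setReg fu (s₁.reg fu - 1)).reg ba = base := by simp [hfb.symm, hba]
    obtain ⟨t₂, s₂, e₂, h₂⟩ := ih1 (s₁ := s₁.setReg fu (s₁.reg fu - 1)) hp.2 hb hba2 hR
    have hba3 : s₂.reg ba = base := by
      rw [e₂.frame.1 ba fun hh => hfb (sim_wregs fu ba p _ hh).symm, hba2]
    have key : wp W ((loop x p).sim fu ba) s₂ (SimPost fu base B (loop x p) t' s'' s₂) := by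
      rcases Nat.eq_zero_or_pos (s₂.reg fu) with h0 | h0
      · exact sim_exec_zero hp _ h0 hba3 hB hW
      · exact ih2 hp (h1.bounded hb) hba3 (h₂.2.2.2 h0)
    obtain ⟨t₃, s₃, e₃, h₃⟩ := key
    -- The simulation of a loop is a `while` followed by one `tick` for the failing test. The two
    -- are separated, so that the first round can be put in front of the `while`.
    cases e₃ with
    | @seq _ _ _ s₄ _ t₄ t₅ e₄ e₅ =>
      refine ⟨_, s₃, .seq (.whileStep (e := simCond fu ba x)
        ⟨⟨Nat.zero_le _, trivial, trivial⟩, ⟨Nat.zero_le _, hadd _ x hba hp.1, trivial⟩, trivial⟩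
        ?_ (.seq (tick_exec hW _) e₂) e₄) e₅, ?_, ?_, fun a i hi => ?_, h₃.2.2.2⟩
      · rw [simCond, Expr.eval, Expr.eval, Expr.eval.eq_3 _ _ _ (simReg ba x), hreg s _ x hba hR]
        simp [BinOp.eval, Expr.eval, Nat.pos_of_ne_zero hf, Nat.pos_of_ne_zero h]
      · have b1 := h₂.1
        have b3 := h₃.1
        simp only [State.setReg_reg, if_true] at b1
        omega
      · have b1 := h₂.1
        have b2 := h₂.2.1
        have b3 := h₃.1
        have b4 := h₃.2.1
        simp only [State.setReg_reg, if_true] at b1 b2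
        obtain ⟨u, hu⟩ : ∃ u, s₁.reg fu - 1 - s₂.reg fu = u := ⟨_, rfl⟩
        obtain ⟨v, hv⟩ : ∃ v, s₂.reg fu - s₃.reg fu = v := ⟨_, rfl⟩
        rw [hu] at b2
        rw [hv] at b4
        rw [show s₁.reg fu - s₃.reg fu + 1 = (u + 1) + (v + 1) by omega]
        simp only [simCond, simReg, Expr.cost, simCost] at b4 ⊢
        nlinarith
      · rw [h₃.2.2.1 a i hi, h₂.2.2.1 a i hi]; rfl

end Prog

end WordRAM

/-! ### Sets as bit masks -/

namespace Sparsify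

/-- The set of the positions of the ones of `x`. -/
def bits (x : ℕ) : Finset ℕ := (Finset.range x).filter (x.testBit ·)

theorem mem_bits {x i : ℕ} : i ∈ bits x ↔ x.testBit i = true := by
  simp only [bits, Finset.mem_filter, Finset.mem_range, and_iff_right_iff_imp]
  exact fun h => Nat.lt_two_pow_self.trans_le (Nat.ge_two_pow_of_testBit h)

theorem bits_injective : Function.Injective bits := fun x y h =>
  Nat.eq_of_testBit_eq fun i => by
    have : i ∈ bits x ↔ i ∈ bits y := by rw [h]
    rw [mem_bits, mem_bits] at this
    exact Bool.eq_iff_iff.2 this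

theorem bits_zero : bits 0 = ∅ := rfl

theorem bits_eq_empty {x : ℕ} : bits x = ∅ ↔ x = 0 :=
  ⟨fun h => bits_injective (h.trans bits_zero.symm), fun h => h ▸ bits_zero⟩

theorem bits_and (x y : ℕ) : bits (x &&& y) = bits x ∩ bits y := by
  ext i; simp [mem_bits, Nat.testBit_and]

theorem bits_or (x y : ℕ) : bits (x ||| y) = bits x ∪ bits y := by
  ext i; simp [mem_bits, Nat.testBit_or]

theorem bits_subset_iff {x y : ℕ} : bits y ⊆ bits x ↔ x &&& y = y := by
  rw [← bits_injective.eq_iff, bits_and, Finset.inter_eq_right]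

theorem and_eq_zero_iff {x y : ℕ} : x &&& y = 0 ↔ Disjoint (bits x) (bits y) := by
  rw [← bits_eq_empty, bits_and, Finset.disjoint_iff_inter_eq_empty]

theorem bits_xor {x y : ℕ} (h : bits y ⊆ bits x) : bits (x ^^^ y) = bits x \ bits y := by
  ext i
  have := @h i
  simp only [mem_bits, Finset.mem_sdiff, Nat.testBit_xor] at this ⊢
  cases hx : x.testBit i <;> cases hy : y.testBit i <;> simp_all

theorem bits_subset_range {x L : ℕ} (h : x < 2 ^ L) : bits x ⊆ Finset.range L := fun i hi => by
  rw [mem_bits] at hi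
  rw [Finset.mem_range]
  by_contra hcon
  have h1 := Nat.ge_two_pow_of_testBit hi
  have h2 := Nat.pow_le_pow_right (n := 2) (by norm_num) (not_lt.1 hcon)
  omega

theorem card_bits_two_pow_le (x p : ℕ) : (bits (x ||| 1 <<< p)).card ≤ (bits x).card + 1 := by
  rw [bits_or]
  refine (Finset.card_union_le _ _).trans (Nat.add_le_add_left ?_ _)
  refine Finset.card_le_one.2 fun i hi j hj => ?_
  rw [mem_bits, Nat.one_shiftLeft, Nat.testBit_two_pow] at hi hj
  simp only [decide_eq_true_eq] at hi hj
  omega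

theorem card_bits_eq_sum {x L : ℕ} (h : x < 2 ^ L) :
    (bits x).card = ∑ p ∈ Finset.range L, (x >>> p &&& 1) := by
  have h1 : bits x = (Finset.range L).filter (x.testBit ·) := by
    ext i
    simp only [mem_bits, Finset.mem_filter, iff_and_self]
    exact fun hi => bits_subset_range h (mem_bits.2 hi)
  rw [h1, Finset.card_filter]
  refine Finset.sum_congr rfl fun p _ => ?_
  have h2 : x >>> p &&& 1 = (x.testBit p).toNat := by
    rw [Nat.testBit, Nat.and_comm 1, Nat.and_one_is_mod]
    rcases Nat.mod_two_eq_zero_or_one (x >>> p) with h | h <;> simp [h]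
  rw [h2]
  cases x.testBit p <;> rfl

/-- The family of sets described by a list of masks. -/
def fam (l : List ℕ) : Finset (Finset ℕ) := (l.map bits).toFinset

theorem mem_fam {l : List ℕ} {C : Finset ℕ} : C ∈ fam l ↔ ∃ x ∈ l, bits x = C := by
  simp [fam]

theorem fam_append (l l' : List ℕ) : fam (l ++ l') = fam l ∪ fam l' := by
  simp [fam]

theorem fam_singleton (x : ℕ) : fam [x] = {bits x} := by simp [fam]

theorem card_fam {l : List ℕ} (h : l.Nodup) : (fam l).card = l.length := by
  rw [fam, List.toFinset_card_of_nodup (h.map bits_injective), List.length_map]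

theorem deg_fam {l : List ℕ} (h : l.Nodup) (c H : ℕ) :
    deg (fam l) c (bits H) = (l.filter fun x => (bits x).card = c ∧ x &&& H = H).length := by
  rw [← card_fam (h.filter _), deg]
  congr 1
  ext C
  simp only [Finset.mem_filter, mem_fam, List.mem_filter, decide_eq_true_eq]
  constructor
  · rintro ⟨⟨x, hx, rfl⟩, h1, h2⟩
    exact ⟨x, ⟨hx, h1, bits_subset_iff.1 h2⟩, rfl⟩
  · rintro ⟨x, ⟨hx, h1, h2⟩, rfl⟩
    exact ⟨⟨x, hx, rfl⟩, h1, bits_subset_iff.2 h2⟩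

theorem petals_fam (l : List ℕ) (c H : ℕ) : petals (fam l) c (bits H) =
    fam ((l.filter fun x => (bits x).card = c ∧ x &&& H = H).map (· ^^^ H)) := by
  ext C
  simp only [petals, Finset.mem_image, Finset.mem_filter, mem_fam, List.mem_map, List.mem_filter,
    decide_eq_true_eq]
  constructor
  · rintro ⟨_, ⟨⟨x, hx, rfl⟩, h1, h2⟩, rfl⟩
    exact ⟨_, ⟨x, ⟨hx, h1, bits_subset_iff.1 h2⟩, rfl⟩, bits_xor h2⟩
  · rintro ⟨_, ⟨x, ⟨hx, h1, h2⟩, rfl⟩, rfl⟩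
    exact ⟨bits x, ⟨⟨x, hx, rfl⟩, h1, bits_subset_iff.2 h2⟩, (bits_xor (bits_subset_iff.2 h2)).symm⟩

/-- The entries `f p, …, f (p + l - 1)`. -/
def seg (f : ℕ → ℕ) (p l : ℕ) : List ℕ := (List.range l).map fun i => f (p + i)

theorem seg_length (f : ℕ → ℕ) (p l : ℕ) : (seg f p l).length = l := by simp [seg]

theorem seg_zero (f : ℕ → ℕ) (p : ℕ) : seg f p 0 = [] := rfl

theorem seg_succ (f : ℕ → ℕ) (p l : ℕ) : seg f p (l + 1) = seg f p l ++ [f (p + l)] := by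
  simp [seg, List.range_succ]

theorem seg_congr {f g : ℕ → ℕ} {p l : ℕ} (h : ∀ i, p ≤ i → i < p + l → g i = f i) :
    seg g p l = seg f p l := by
  refine List.map_congr_left fun i hi => h _ (by omega) ?_
  rw [List.mem_range] at hi
  omega

theorem seg_update (f : ℕ → ℕ) (p l v : ℕ) :
    seg (Function.update f (p + l) v) p (l + 1) = seg f p l ++ [v] := by
  rw [seg_succ, Function.update_self, seg_congr (f := f) (g := Function.update f (p + l) v)]
  intro i _ hi
  rw [Function.update_of_ne (by omega)]

theorem mem_seg {f : ℕ → ℕ} {p l v : ℕ} : v ∈ seg f p l ↔ ∃ i < l, f (p + i) = v := by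
  simp [seg]

/-- The entry `X i` is minimal, and it has not occurred before. -/
def Keep (X : ℕ → ℕ) (l i : ℕ) : Prop := ∀ j < l, X i &&& X j = X j → X j = X i ∧ i ≤ j

instance (X : ℕ → ℕ) (l : ℕ) : DecidablePred (Keep X l) := fun i => by
  unfold Keep; infer_instance

/-- The list of the minimal entries, without repetitions. -/
def normList (X : ℕ → ℕ) (l : ℕ) : List ℕ := ((List.range l).filter (Keep X l)).map X

theorem normList_nodup (X : ℕ → ℕ) (l : ℕ) : (normList X l).Nodup := by
  refine List.Nodup.map_on (fun i hi j hj hij => ?_) (List.nodup_range.filter _)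
  simp only [List.mem_filter, List.mem_range, decide_eq_true_eq] at hi hj
  have h1 := (hi.2 j hj.1 (by rw [hij, Nat.and_self])).2
  have h2 := (hj.2 i hi.1 (by rw [hij, Nat.and_self])).2
  omega

/-- Of several equal masks `Keep` retains the first, so every minimal set is represented exactly
once, and list lengths are cardinalities. -/
theorem fam_normList (f : ℕ → ℕ) (p l : ℕ) :
    fam (normList (fun i => f (p + i)) l) = minimals (fam (seg f p l)) := by
  ext C
  simp only [mem_fam, minimals, Finset.mem_filter, normList, List.mem_map, List.mem_filter,
    List.mem_range, decide_eq_true_eq, mem_seg]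
  constructor
  · rintro ⟨_, ⟨i, ⟨hi, hk⟩, rfl⟩, rfl⟩
    refine ⟨⟨_, ⟨i, hi, rfl⟩, rfl⟩, ?_⟩
    rintro _ ⟨_, ⟨j, hj, rfl⟩, rfl⟩ hsub
    exact congrArg bits (hk j hj (bits_subset_iff.1 hsub)).1
  · rintro ⟨⟨_, ⟨i, hi, rfl⟩, rfl⟩, hmin⟩
    have hex : ∃ j, j < l ∧ f (p + j) = f (p + i) := ⟨i, hi, rfl⟩
    obtain ⟨h1, h2⟩ := Nat.find_spec hex
    refine ⟨_, ⟨Nat.find hex, ⟨h1, fun j hj hsub => ?_⟩, rfl⟩, by rw [h2]⟩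
    have h3 := bits_injective (hmin _ ⟨_, ⟨j, hj, rfl⟩, rfl⟩ (by
      rw [bits_subset_iff, ← h2]; exact hsub))
    exact ⟨h3.trans h2.symm, Nat.find_min' hex ⟨hj, h3⟩⟩

/-- A bound for the number of masks of length `L` with at most `k` ones. -/
theorem card_le_of_ground {F : Finset (Finset ℕ)} {L k : ℕ}
    (h : ∀ C ∈ F, C ⊆ Finset.range L ∧ C.card ≤ k) : F.card ≤ (k + 1) * (L + 1) ^ k := by
  have h1 : F ⊆ (Finset.range (k + 1)).biUnion fun i => (Finset.range L).powersetCard i := by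
    intro C hC
    simp only [Finset.mem_biUnion, Finset.mem_range, Finset.mem_powersetCard]
    exact ⟨C.card, Nat.lt_succ_of_le (h C hC).2, (h C hC).1, rfl⟩
  refine (Finset.card_le_card h1).trans ((Finset.card_biUnion_le_card_mul _ _
    ((L + 1) ^ k) fun i hi => ?_).trans (by rw [Finset.card_range]))
  rw [Finset.mem_range] at hi
  rw [Finset.card_powersetCard, Finset.card_range]
  refine (Nat.choose_le_pow L i).trans ?_
  exact (Nat.pow_le_pow_left (Nat.le_succ L) i).trans
    (Nat.pow_le_pow_right (Nat.succ_pos L) (by omega))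

end Sparsify

/-! ### The program -/

namespace WordRAM

attribute [simp] Expr.eval Expr.Ok Expr.cost BinOp.eval BinOp.Fits wp_skip wp_set wp_store wp_seq
  wp_ite Cmd.wregs Cmd.warrs Cmd.for

notation "R[" r "]" => Expr.reg r
notation "K[" v "]" => Expr.lit v
notation "A[" a ", " e "]" => Expr.load a e
infixl:65 " +ₑ " => Expr.op BinOp.add
infixl:65 " -ₑ " => Expr.op BinOp.sub
infixl:70 " *ₑ " => Expr.op BinOp.mul
infixl:70 " /ₑ " => Expr.op BinOp.div
infixl:60 " &ₑ " => Expr.op BinOp.and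
infixl:58 " |ₑ " => Expr.op BinOp.or
infixl:58 " ^ₑ " => Expr.op BinOp.xor
infixl:62 " <<ₑ " => Expr.op BinOp.shl
infixl:62 " >>ₑ " => Expr.op BinOp.shr
infix:50 " <ₑ " => Expr.op BinOp.lt
infix:50 " =ₑ " => Expr.op BinOp.eq
infix:35 " ::= " => Cmd.set
infixr:30 " ;; " => Cmd.seq

open Sparsify

/-! ### Truth values as numbers, and reduction of a list of clauses to its minimal members -/

theorem ind_and (p q : Prop) [Decidable p] [Decidable q] :
    ((if p then 1 else 0) &&& (if q then 1 else 0) : ℕ) = if p ∧ q then 1 else 0 := by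
  by_cases hp : p <;> by_cases hq : q <;> simp [hp, hq]

theorem ind_not (p : Prop) [Decidable p] :
    (1 - (if p then 1 else 0) : ℕ) = if ¬ p then 1 else 0 := by
  by_cases hp : p <;> simp [hp]

theorem ind_eq_zero (p : Prop) [Decidable p] : ((if p then 1 else 0 : ℕ) = 0) ↔ ¬ p := by
  by_cases hp : p <;> simp [hp]

theorem ind_ne_zero (p : Prop) [Decidable p] : ((if p then 1 else 0 : ℕ) ≠ 0) ↔ p := by
  by_cases hp : p <;> simp [hp]


/-- `reg 40 := card (bits (reg 41))`, for a mask of length `reg 8`. -/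
def popc : Cmd :=
  40 ::= K[0] ;; .for 42 8 (40 ::= R[40] +ₑ ((R[41] >>ₑ R[42]) &ₑ K[1]))

theorem popc_spec {W L x : ℕ} {s : State} (hx : s.reg 41 = x) (hxL : x < 2 ^ L)
    (hL : s.reg 8 = L) (hLW : L < W) :
    wp W popc s fun t s' => t ≤ 20 * L + 10 ∧ s'.reg 40 = (bits x).card := by
  have key := wp_for (W := W) (i := 42) (ℓ := 8) (n := L) (T := 12)
    (c := 40 ::= R[40] +ₑ ((R[41] >>ₑ R[42]) &ₑ K[1])) (s₀ := s.setReg 40 0)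
    (fun j s' => s'.reg 40 = ∑ p ∈ Finset.range j, (x >>> p &&& 1)) (by simp [hL]) hLW.le
    (by omega) (by simp) (by simp) (by simp) (by simp) (by
      intro j s' hj hij hf hI
      have h41 : s'.reg 41 = x := by rw [hf.1 41 (by simp)]; simp [hx]
      have hle : ∑ p ∈ Finset.range (j + 1), (x >>> p &&& 1) ≤ j + 1 := by
        refine (Finset.sum_le_card_nsmul _ _ 1 fun _ _ => Nat.and_le_right).trans (by simp)
      rw [Finset.sum_range_succ] at hle
      simp only [wp_seq, wp_set, wp_ite, wp_store, wp_skip, Expr.eval, Expr.Ok, Expr.cost,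
        BinOp.eval, BinOp.Fits, State.setReg_reg, State.setReg_mem, State.setMem_reg,
        Nat.reduceEqDiff, if_true, if_false, ind_and, ind_not, ind_eq_zero, ind_ne_zero,
        true_and, and_true, hI, h41, hij, Finset.sum_range_succ]
      omega)
  rw [popc, wp_seq, wp_set]
  refine ⟨Nat.zero_le _, key.mono fun t s' _ h => ?_⟩
  rw [card_bits_eq_sum hxL]
  simp only [Expr.cost]
  exact ⟨by omega, h.2⟩

/-- The inner loop of `norm`. -/
def normInner : Cmd := .for 25 21 (27 ::= A[1, R[20] +ₑ R[25]] ;;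
  .ite (((R[26] &ₑ R[27]) =ₑ R[27]) &ₑ (K[1] -ₑ ((R[27] =ₑ R[26]) &ₑ (K[1] -ₑ (R[25] <ₑ R[24])))))
    (28 ::= K[0]) .skip)

/-- The list of `reg 21` clauses at address `reg 20` is reduced to its minimal elements, and the
result written at the address `reg 14`. -/
def norm : Cmd :=
  22 ::= R[14] ;; 23 ::= K[0] ;;
  .for 24 21 (26 ::= A[1, R[20] +ₑ R[24]] ;; 28 ::= K[1] ;; normInner ;;
    .ite R[28] (.store 1 (R[22] +ₑ R[23]) R[26] ;; 23 ::= R[23] +ₑ K[1]) .skip) ;;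
  14 ::= R[22] +ₑ R[23]

theorem normInner_spec {W p l i : ℕ} {X : ℕ → ℕ} {s : State} (hp : s.reg 20 = p)
    (hl : s.reg 21 = l) (hi : s.reg 24 = i) (hX : ∀ j < l, s.mem 1 (p + j) = X j)
    (hx : s.reg 26 = X i) (h28 : s.reg 28 = 1) (hW : p + l < W) :
    wp W normInner s fun t s' => t ≤ 50 * l + 10 ∧
      s'.reg 28 = if Keep X l i then 1 else 0 := by
  refine (wp_for (n := l) (T := 40)
    (fun j s' => s'.reg 28 = if ∀ j' < j, X i &&& X j' = X j' → X j' = X i ∧ i ≤ j' then 1 else 0)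
    hl (by omega) (by omega) (by simp) (by simp) (by simp) (by simp [h28]) ?_).mono ?_
  · intro j s' hj hij hf hI
    have h20 : s'.reg 20 = p := by rw [hf.1 20 (by simp)]; exact hp
    have h24 : s'.reg 24 = i := by rw [hf.1 24 (by simp)]; exact hi
    have h26 : s'.reg 26 = X i := by rw [hf.1 26 (by simp)]; exact hx
    have h1 : s'.mem 1 (p + j) = X j := by rw [hf.2 1 (by simp)]; exact hX j hj
    have hiff : (∀ j' < j + 1, X i &&& X j' = X j' → X j' = X i ∧ i ≤ j') ↔
        (∀ j' < j, X i &&& X j' = X j' → X j' = X i ∧ i ≤ j') ∧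
          (X i &&& X j = X j → X j = X i ∧ i ≤ j) := by
      constructor
      · exact fun h => ⟨fun j' hj' => h j' (by omega), h j (by omega)⟩
      · rintro ⟨h1, h2⟩ j' hj'
        rcases Nat.lt_succ_iff_lt_or_eq.1 hj' with h | rfl
        exacts [h1 j' h, h2]
    simp only [wp_seq, wp_set, wp_ite, wp_store, wp_skip, Expr.eval, Expr.Ok, Expr.cost,
      BinOp.eval, BinOp.Fits, State.setReg_reg, State.setReg_mem, State.setMem_reg,
      Nat.reduceEqDiff, if_true, if_false, ind_and, ind_not, ind_eq_zero, ind_ne_zero,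
      true_and, and_true, h20, h24, h26, h1, hij, hiff]
    refine ⟨by omega, by omega, fun h => ⟨by omega, by omega, ?_⟩, fun h => ⟨by omega, ?_⟩⟩
    · rw [if_neg]
      rintro ⟨-, h2⟩
      have := h2 h.1
      exact h.2 ⟨this.1, by omega⟩
    · rw [hI]
      refine if_congr ?_ rfl rfl
      rw [iff_self_and]
      intro _ h3
      by_contra h4
      exact h ⟨h3, fun h5 => h4 ⟨h5.1, not_lt.1 h5.2⟩⟩
  · intro t s' _ h
    exact ⟨by omega, h.2⟩

/-- The result is written above all existing lists (`p + l ≤ m`), so the input can still be read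
while the result grows, and older stack entries stay valid. -/
theorem norm_spec {W p l m : ℕ} {X : ℕ → ℕ} {s : State} (hp : s.reg 20 = p) (hl : s.reg 21 = l)
    (hm : s.reg 14 = m) (hX : ∀ j < l, s.mem 1 (p + j) = X j) (hpl : p + l ≤ m)
    (hW : m + l < W) :
    wp W norm s fun t s' => t ≤ l * (50 * l + 100) + 50 ∧ s'.reg 22 = m ∧
      s'.reg 23 = (normList X l).length ∧ s'.reg 14 = m + (normList X l).length ∧
      seg (s'.mem 1) m (normList X l).length = normList X l ∧
      ∀ i < m, s'.mem 1 i = s.mem 1 i := by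
  have key := wp_for (W := W) (i := 24) (ℓ := 21) (n := l) (T := 50 * l + 50)
    (c := 26 ::= A[1, R[20] +ₑ R[24]] ;; 28 ::= K[1] ;; normInner ;;
      .ite R[28] (.store 1 (R[22] +ₑ R[23]) R[26] ;; 23 ::= R[23] +ₑ K[1]) .skip)
    (s₀ := (s.setReg 22 m).setReg 23 0)
    (fun i s' => s'.reg 23 = (((List.range i).filter (Keep X l)).map X).length ∧
      seg (s'.mem 1) m (((List.range i).filter (Keep X l)).map X).length =
        ((List.range i).filter (Keep X l)).map X ∧ ∀ i < m, s'.mem 1 i = s.mem 1 i)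
    (by simp [hl]) (by omega) (by omega) (by simp [normInner]) (by simp [normInner]) (by simp)
    (by simp [seg_zero]) (by
      rintro i s' hi hii hf ⟨h23, hseg, hmem⟩
      have h20 : s'.reg 20 = p := by rw [hf.1 20 (by simp [normInner])]; simp [hp]
      have h21 : s'.reg 21 = l := by rw [hf.1 21 (by simp [normInner])]; simp [hl]
      have h22 : s'.reg 22 = m := by rw [hf.1 22 (by simp [normInner])]; simp
      have hXi : ∀ j < l, s'.mem 1 (p + j) = X j := fun j hj => by
        rw [hmem _ (by omega), hX j hj]
      have hlen : (((List.range i).filter (Keep X l)).map X).length ≤ i := by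
        rw [List.length_map]
        exact (List.length_filter_le _ _).trans (by simp)
      simp only [wp_seq, wp_set, wp_ite, wp_store, wp_skip, Expr.eval, Expr.Ok, Expr.cost,
        BinOp.eval, BinOp.Fits, State.setReg_reg, State.setReg_mem, State.setMem_reg,
        Nat.reduceEqDiff, if_true, if_false, ind_and, ind_not, ind_eq_zero, ind_ne_zero,
        true_and, and_true, h20, hii, hXi i hi]
      refine ⟨by omega, by omega,
          (normInner_spec (p := p) (l := l) (i := i) (X := X) (by simp [h20])
        (by simp [h21]) (by simp [hii]) (by simpa using hXi) (by simp) (by simp)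
        (by omega)).mono fun t s₂ fr h2 => ?_⟩
      have g22 : s₂.reg 22 = m := by rw [fr.1 22 (by simp [normInner])]; simp [h22]
      have g23 := fr.1 23 (by simp [normInner])
      have g26 := fr.1 26 (by simp [normInner])
      have gm := fr.2 1 (by simp [normInner])
      simp only [State.setReg_reg, State.setReg_mem, Nat.reduceEqDiff, if_true, if_false, h23]
        at g23 g26 gm
      rw [List.range_succ, List.filter_append, List.map_append, List.length_append]
      simp only [wp_seq, wp_set, wp_ite, wp_store, wp_skip, Expr.eval, Expr.Ok, Expr.cost,
        BinOp.eval, BinOp.Fits, State.setReg_reg, State.setReg_mem, State.setMem_reg,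
        Nat.reduceEqDiff, if_true, if_false, ind_and, ind_not, ind_eq_zero, ind_ne_zero,
        true_and, and_true, h2.2, g22, g23, g26]
      refine ⟨fun hk => ⟨by omega, by omega, by omega, ?_, ?_, fun j hj => ?_⟩,
        fun hk => ⟨by omega, ?_, ?_, ?_⟩⟩
      · simp [hk]
      · simp only [List.filter_singleton, hk, decide_true, cond_true, List.map_singleton,
          List.length_singleton, State.setMem_mem, if_true]
        rw [seg_update, gm, hseg]
      · rw [State.setMem_mem_apply, if_neg (by omega), gm, hmem j hj]
      · simp [hk, g23]
      · simp only [List.filter_singleton, hk, decide_false, cond_false, List.map_nil,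
          List.append_nil, List.length_nil, add_zero]
        rw [gm, hseg]
      · rw [gm]; exact hmem)
  rw [norm, wp_seq, wp_set]
  refine ⟨trivial, ?_⟩
  rw [wp_seq, wp_set]
  refine ⟨Nat.zero_le _, ?_⟩
  rw [wp_seq]
  simp only [Expr.eval, hm]
  refine key.mono fun t s' fr h => ?_
  have h22 : s'.reg 22 = m := by rw [fr.1 22 (by simp [normInner])]; simp
  have hlen : (normList X l).length ≤ l := by
    rw [normList, List.length_map]
    exact (List.length_filter_le _ _).trans (by simp)
  have h23 : s'.reg 23 = (normList X l).length := h.2.1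
  have h1 := h.1
  simp only [wp_seq, wp_set, wp_ite, wp_store, wp_skip, Expr.eval, Expr.Ok, Expr.cost,
    BinOp.eval, BinOp.Fits, State.setReg_reg, State.setReg_mem, State.setMem_reg,
    Nat.reduceEqDiff, if_true, if_false, ind_and, ind_not, ind_eq_zero, ind_ne_zero,
    true_and, and_true, h22, h23]
  refine ⟨by omega, ?_, h.2.2.1, h.2.2.2⟩
  have : l * (50 * l + 50 + 8) ≤ l * (50 * l + 100) := Nat.mul_le_mul_left _ (by omega)
  omega

end WordRAM

/-! ### The search for a sunflower -/

namespace WordRAM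

open Sparsify


/-- `reg 31 :=` the number of clauses of size `reg 29` that contain `reg 28`. -/
def count : Cmd :=
  31 ::= K[0] ;;
  .for 32 23 (33 ::= A[1, R[22] +ₑ R[32]] ;; 41 ::= R[33] ;; popc ;;
    .ite (((R[33] &ₑ R[28]) =ₑ R[28]) &ₑ (R[40] =ₑ R[29])) (31 ::= R[31] +ₑ K[1]) .skip)

theorem count_spec {W L fp fl c H : ℕ} {s : State} (hL : s.reg 8 = L) (hfp : s.reg 22 = fp)
    (hfl : s.reg 23 = fl) (hH : s.reg 28 = H) (hc : s.reg 29 = c)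
    (hlt : ∀ x ∈ seg (s.mem 1) fp fl, x < 2 ^ L) (hnd : (seg (s.mem 1) fp fl).Nodup)
    (hLW : L < W) (hW : fp + fl < W) :
    wp W count s fun t s' => t ≤ fl * (20 * L + 50) + 10 ∧
      s'.reg 31 = deg (fam (seg (s.mem 1) fp fl)) c (bits H) := by
  have key := wp_for (W := W) (i := 32) (ℓ := 23) (n := fl) (T := 20 * L + 42)
    (c := 33 ::= A[1, R[22] +ₑ R[32]] ;; 41 ::= R[33] ;; popc ;;
      .ite (((R[33] &ₑ R[28]) =ₑ R[28]) &ₑ (R[40] =ₑ R[29])) (31 ::= R[31] +ₑ K[1]) .skip)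
    (s₀ := s.setReg 31 0)
    (fun j s' => s'.reg 31 = ((seg (s.mem 1) fp j).filter
      fun x => (bits x).card = c ∧ x &&& H = H).length)
    (by simp [hfl]) (by omega) (by omega) (by simp [popc]) (by simp [popc]) (by simp)
    (by simp [seg_zero]) (by
      intro j s' hj hij hf hI
      have h22 : s'.reg 22 = fp := by rw [hf.1 22 (by simp [popc])]; simp [hfp]
      have h28 : s'.reg 28 = H := by rw [hf.1 28 (by simp [popc])]; simp [hH]
      have h29 : s'.reg 29 = c := by rw [hf.1 29 (by simp [popc])]; simp [hc]
      have h8 : s'.reg 8 = L := by rw [hf.1 8 (by simp [popc])]; simp [hL]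
      have hm : s'.mem 1 = s.mem 1 := by rw [hf.2 1 (by simp [popc])]; simp
      simp only [wp_seq, wp_set, wp_ite, wp_store, wp_skip, Expr.eval, Expr.Ok, Expr.cost,
        BinOp.eval, BinOp.Fits, State.setReg_reg, State.setReg_mem, State.setMem_reg,
        Nat.reduceEqDiff, if_true, if_false, ind_and, ind_not, ind_eq_zero, ind_ne_zero,
        true_and, and_true, h22, hij, hm]
      have hle : ((seg (s.mem 1) fp j).filter
          fun x => (bits x).card = c ∧ x &&& H = H).length ≤ j :=
        (List.length_filter_le _ _).trans (seg_length _ _ _).le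
      refine ⟨by omega, (popc_spec (x := s.mem 1 (fp + j)) (by simp)
        (hlt _ (mem_seg.2 ⟨j, hj, rfl⟩)) (by simp [h8]) hLW).mono fun t s₂ fr h => ?_⟩
      have g28 := fr.1 28 (by simp [popc])
      have g29 := fr.1 29 (by simp [popc])
      have g31 := fr.1 31 (by simp [popc])
      have g33 := fr.1 33 (by simp [popc])
      simp only [State.setReg_reg, Nat.reduceEqDiff, if_true, if_false, h28, h29, hI]
        at g28 g29 g31 g33
      rw [seg_succ, List.filter_append, List.length_append, List.filter_singleton]
      simp only [wp_seq, wp_set, wp_ite, wp_store, wp_skip, Expr.eval, Expr.Ok, Expr.cost,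
        BinOp.eval, BinOp.Fits, State.setReg_reg, State.setReg_mem, State.setMem_reg,
        Nat.reduceEqDiff, if_true, if_false, ind_and, ind_not, ind_eq_zero, ind_ne_zero,
        true_and, and_true, h.2, g28, g29, g31, g33]
      have h1 := h.1
      refine ⟨fun hh => ⟨⟨by omega, by omega⟩, by omega, ?_⟩, fun hh => ⟨by omega, ?_⟩⟩
      · simp [hh.1, hh.2]
      · rw [and_comm] at hh
        simp [hh])
  rw [count, wp_seq, wp_set]
  refine ⟨Nat.zero_le _, key.mono fun t s' _ h => ⟨?_, by rw [h.2, deg_fam hnd]⟩⟩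
  have := h.1
  simp only [Expr.cost]
  rw [show 20 * L + 42 + 8 = 20 * L + 50 by omega] at this
  omega

/-- The order in which sunflowers are branched on. -/
def key (k c h : ℕ) : ℕ := c * (k + 1) + (k - h)

/-- If the set `reg 28` is the heart of a large sunflower of sets of size `reg 29`, and its key is
smaller than `reg 35`, then it becomes the best heart. -/
def evalHeart (κ k : ℕ) : Cmd :=
  41 ::= R[28] ;; popc ;; 30 ::= R[40] ;; count ;;
  34 ::= R[29] *ₑ K[k + 1] +ₑ (K[k] -ₑ R[30]) ;;
  .ite ((K[1] -ₑ (R[31] <ₑ (K[1] <<ₑ (K[κ] *ₑ (K[2] *ₑ (R[29] -ₑ R[30]) -ₑ K[1]))))) &ₑ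
      (R[34] <ₑ R[35]))
    (35 ::= R[34] ;; 36 ::= R[28] ;; 37 ::= R[29]) .skip

theorem evalHeart_spec {W L fp fl c H κ k : ℕ} {s : State} (hL : s.reg 8 = L)
    (hfp : s.reg 22 = fp) (hfl : s.reg 23 = fl) (hH : s.reg 28 = H) (hc : s.reg 29 = c)
    (hlt : ∀ x ∈ seg (s.mem 1) fp fl, x < 2 ^ L) (hnd : (seg (s.mem 1) fp fl).Nodup)
    (hLW : L < W) (hW : fp + fl < W) (hHL : H < 2 ^ L) (hck : c ≤ k) (h1 : 1 ≤ (bits H).card)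
    (h2 : (bits H).card < c) (hkW : (k + 1) * (k + 1) ≤ W) (hκW : κ ≤ W)
    (hθW : 2 ^ (2 * κ * k) ≤ W) :
    wp W (evalHeart κ k) s fun t s' => t ≤ (fl + 1) * (20 * L + 100) ∧
      ((Heavy κ (fam (seg (s.mem 1) fp fl)) c (bits H) ∧ key k c (bits H).card < s.reg 35 ∧
        s'.reg 35 = key k c (bits H).card ∧ s'.reg 36 = H ∧ s'.reg 37 = c) ∨
      (¬ (Heavy κ (fam (seg (s.mem 1) fp fl)) c (bits H) ∧ key k c (bits H).card < s.reg 35) ∧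
        s'.reg 35 = s.reg 35 ∧ s'.reg 36 = s.reg 36 ∧ s'.reg 37 = s.reg 37)) := by
  rw [evalHeart, wp_seq, wp_set]
  refine ⟨trivial, ?_⟩
  rw [wp_seq]
  refine (popc_spec (x := H) (by simp [hH]) hHL (by simp [hL]) hLW).mono fun t₁ s₁ f₁ p₁ => ?_
  rw [wp_seq, wp_set]
  refine ⟨trivial, ?_⟩
  rw [wp_seq]
  have g : ∀ r, r ∉ [40, 42, 41, 30] → ((s₁.setReg 30 (R[40].eval s₁)).reg r = s.reg r) := by
    intro r hr
    simp only [List.mem_cons, not_or, List.not_mem_nil] at hr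
    rw [State.setReg_reg, if_neg hr.2.2.2.1, f₁.1 r (by simp [popc]; omega), State.setReg_reg,
      if_neg hr.2.2.1]
  have gm : (s₁.setReg 30 (R[40].eval s₁)).mem 1 = s.mem 1 := by
    simp [f₁.2 1 (by simp [popc])]
  refine (count_spec (L := L) (fp := fp) (fl := fl) (c := c) (H := H) (by rw [g 8 (by simp), hL])
    (by rw [g 22 (by simp), hfp]) (by rw [g 23 (by simp), hfl]) (by rw [g 28 (by simp), hH])
    (by rw [g 29 (by simp), hc]) (by rwa [gm]) (by rwa [gm]) hLW hW).mono fun t₂ s₂ f₂ p₂ => ?_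
  have g28 : s₂.reg 28 = H := by rw [f₂.1 28 (by simp [count, popc]), g 28 (by simp), hH]
  have g29 : s₂.reg 29 = c := by rw [f₂.1 29 (by simp [count, popc]), g 29 (by simp), hc]
  have g35 : s₂.reg 35 = s.reg 35 := by rw [f₂.1 35 (by simp [count, popc]), g 35 (by simp)]
  have g36 : s₂.reg 36 = s.reg 36 := by rw [f₂.1 36 (by simp [count, popc]), g 36 (by simp)]
  have g37 : s₂.reg 37 = s.reg 37 := by rw [f₂.1 37 (by simp [count, popc]), g 37 (by simp)]
  have g30 : s₂.reg 30 = (bits H).card := by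
    rw [f₂.1 30 (by simp [count, popc])]; simp [p₁.2]
  rw [gm] at p₂
  have e1 : c * (k + 1) + (k - (bits H).card) = key k c (bits H).card := rfl
  have e2 : 1 <<< (κ * (2 * (c - (bits H).card) - 1)) = θ κ (c - (bits H).card) := by
    rw [Nat.one_shiftLeft]; rfl
  have b0 : c * (k + 1) ≤ k * (k + 1) := Nat.mul_le_mul_right _ hck
  have b5 : (k + 1) * (k + 1) = k * (k + 1) + (k + 1) := by ring
  have b1 : key k c (bits H).card ≤ W := by
    rw [← e1]; omega
  have b6 : 2 * k ≤ W := by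
    refine le_trans ?_ hkW
    nlinarith
  have b2 : κ * (2 * (c - (bits H).card) - 1) ≤ 2 * κ * k := by
    rw [mul_comm 2 κ, mul_assoc]; exact Nat.mul_le_mul_left _ (by omega)
  have b3 : θ κ (c - (bits H).card) ≤ W :=
    (Nat.pow_le_pow_right (by norm_num) b2).trans hθW
  have b4 : 2 * κ * k < 2 ^ (2 * κ * k) := Nat.lt_two_pow_self
  have hheavy : Heavy κ (fam (seg (s.mem 1) fp fl)) c (bits H) ↔
      ¬ deg (fam (seg (s.mem 1) fp fl)) c (bits H) < θ κ (c - (bits H).card) := by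
    rw [Heavy, not_lt]; simp [h1, h2]
  have t1 := p₁.1
  have t2 := p₂.1
  have ht : ∀ x, x ≤ 70 → t₁ + 1 + t₂ + x ≤ (fl + 1) * (20 * L + 100) := by
    intro x hx
    have : fl * (20 * L + 50) ≤ fl * (20 * L + 100) := Nat.mul_le_mul_left _ (by omega)
    rw [add_mul, one_mul]
    omega
  simp only [wp_seq, wp_set, wp_ite, wp_store, wp_skip, Expr.eval, Expr.Ok, Expr.cost,
    BinOp.eval, BinOp.Fits, State.setReg_reg, State.setReg_mem, State.setMem_reg,
    Nat.reduceEqDiff, if_true, if_false, ind_and, ind_not, ind_eq_zero, ind_ne_zero,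
    true_and, and_true, g28, g29, g30, g35, g36, g37, p₂.2, e1, e2]
  refine ⟨?_, ?_, fun hh => ⟨?_, Or.inl ⟨hheavy.2 hh.1, hh.2⟩⟩,
    fun hh => ⟨?_, Or.inr ?_⟩⟩
  · exact ⟨⟨by omega, by omega⟩, by omega, b1⟩
  · have b7 : 1 ≤ W := by omega
    exact ⟨b7, b7, ⟨hκW, ⟨⟨(by omega : 2 ≤ 2 * k).trans b6,
      (Nat.mul_le_mul_left 2 (by omega)).trans b6⟩, b7⟩, b2.trans (b4.le.trans hθW)⟩, b3⟩
  · have := ht 60 (by omega); omega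
  · have := ht 60 (by omega); omega
  · rw [hheavy]; exact hh

/-- Examine the intersection of the clauses number `reg 24` and `reg 25`. -/
def searchBody (κ k : ℕ) : Cmd :=
  26 ::= A[1, R[22] +ₑ R[24]] ;; 27 ::= A[1, R[22] +ₑ R[25]] ;; 28 ::= R[26] &ₑ R[27] ;;
  41 ::= R[27] ;; popc ;; 30 ::= R[40] ;; 41 ::= R[26] ;; popc ;; 29 ::= R[40] ;;
  .ite ((R[29] =ₑ R[30]) &ₑ ((K[0] <ₑ R[28]) &ₑ (K[1] -ₑ (R[28] =ₑ R[26])))) (evalHeart κ k) .skip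

/-- If `b` is small enough, it is the key of the large sunflower `H` of sets of size `c`. -/
def Valid (κ k L : ℕ) (F : Finset (Finset ℕ)) (b H c : ℕ) : Prop :=
  b < (k + 1) * (k + 1) → H < 2 ^ L ∧ Heavy κ F c (bits H) ∧ b = key k c (bits H).card

/-- The key `b` is at most that of the intersection of `C` and `D`. -/
def Seen (κ k : ℕ) (F : Finset (Finset ℕ)) (b : ℕ) (C D : Finset ℕ) : Prop :=
  C.card = D.card → Heavy κ F C.card (C ∩ D) → b ≤ key k C.card (C ∩ D).card

theorem Seen.mono {κ k : ℕ} {F : Finset (Finset ℕ)} {b b' : ℕ} {C D : Finset ℕ}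
    (h : Seen κ k F b C D) (hb : b' ≤ b) : Seen κ k F b' C D :=
  fun h1 h2 => hb.trans (h h1 h2)

/-- A heart is nonempty and smaller than the sets around it. Pairs of sets of different sizes, or
with an empty or improper intersection, can therefore be passed over. -/
theorem searchBody_spec {W L fp fl i j κ k : ℕ} {s : State} (hL : s.reg 8 = L)
    (hfp : s.reg 22 = fp) (hfl : s.reg 23 = fl) (hi : s.reg 24 = i) (hj : s.reg 25 = j)
    (hil : i < fl) (hjl : j < fl)
    (hlt : ∀ x ∈ seg (s.mem 1) fp fl, x < 2 ^ L ∧ (bits x).card ≤ k)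
    (hnd : (seg (s.mem 1) fp fl).Nodup) (hLW : L < W) (hW : fp + fl < W)
    (hkW : (k + 1) * (k + 1) ≤ W) (hκW : κ ≤ W) (hθW : 2 ^ (2 * κ * k) ≤ W)
    (hv : Valid κ k L (fam (seg (s.mem 1) fp fl)) (s.reg 35) (s.reg 36) (s.reg 37)) :
    wp W (searchBody κ k) s fun t s' => t ≤ (fl + 4) * (20 * L + 100) ∧ s'.reg 35 ≤ s.reg 35 ∧
      Valid κ k L (fam (seg (s.mem 1) fp fl)) (s'.reg 35) (s'.reg 36) (s'.reg 37) ∧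
      Seen κ k (fam (seg (s.mem 1) fp fl)) (s'.reg 35) (bits (s.mem 1 (fp + i)))
        (bits (s.mem 1 (fp + j))) := by
  have hx := hlt _ (mem_seg.2 ⟨i, hil, rfl⟩)
  have hy := hlt _ (mem_seg.2 ⟨j, hjl, rfl⟩)
  set x := s.mem 1 (fp + i) with hxd
  set y := s.mem 1 (fp + j) with hyd
  have hxyL : x &&& y < 2 ^ L := Nat.and_le_left.trans_lt hx.1
  rw [searchBody]
  simp only [wp_seq, wp_set, wp_ite, wp_store, wp_skip, Expr.eval, Expr.Ok, Expr.cost,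
    BinOp.eval, BinOp.Fits, State.setReg_reg, State.setReg_mem, State.setMem_reg,
    Nat.reduceEqDiff, if_true, if_false, ind_and, ind_not, ind_eq_zero, ind_ne_zero,
    true_and, and_true, hfp, hi, hj]
  refine ⟨by omega, by omega, (popc_spec (x := y) (by simp [hyd]) hy.1 (by simp [hL])
    hLW).mono fun t₁ s₁ f₁ p₁ => ?_⟩
  have g1 : ∀ r, r ∉ [26, 27, 28, 40, 41, 42] → s₁.reg r = s.reg r := by
    intro r hr
    simp only [List.mem_cons, not_or, List.not_mem_nil] at hr
    rw [f₁.1 r (by simp [popc]; omega)]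
    simp [hr]
  have g26 := f₁.1 26 (by simp [popc])
  have g28 := f₁.1 28 (by simp [popc])
  have gm1 := f₁.2 1 (by simp [popc])
  simp only [State.setReg_reg, State.setReg_mem, Nat.reduceEqDiff, if_true, if_false]
    at g26 g28 gm1
  rw [← hxd] at g26 g28
  rw [← hyd] at g28
  refine (popc_spec (x := x) (by simp [g26]) hx.1 (by simp [g1 8, hL]) hLW).mono
    fun t₂ s₂ f₂ p₂ => ?_
  have g2 : ∀ r, r ∉ [30, 40, 41, 42] → s₂.reg r = s₁.reg r := by
    intro r hr
    simp only [List.mem_cons, not_or, List.not_mem_nil] at hr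
    rw [f₂.1 r (by simp [popc]; omega)]
    simp [hr]
  have g30 := f₂.1 30 (by simp [popc])
  have gm2 := f₂.2 1 (by simp [popc])
  simp only [State.setReg_reg, State.setReg_mem, Nat.reduceEqDiff, if_true, if_false, p₁.2, gm1]
    at g30 gm2
  have k28 : s₂.reg 28 = x &&& y := by rw [g2 28 (by simp), g28]
  have k26 : s₂.reg 26 = x := by rw [g2 26 (by simp), g26]
  have k35 : s₂.reg 35 = s.reg 35 := by rw [g2 35 (by simp), g1 35 (by simp)]
  have k36 : s₂.reg 36 = s.reg 36 := by rw [g2 36 (by simp), g1 36 (by simp)]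
  have k37 : s₂.reg 37 = s.reg 37 := by rw [g2 37 (by simp), g1 37 (by simp)]
  have k8 : s₂.reg 8 = L := by rw [g2 8 (by simp), g1 8 (by simp), hL]
  have k22 : s₂.reg 22 = fp := by rw [g2 22 (by simp), g1 22 (by simp), hfp]
  have k23 : s₂.reg 23 = fl := by rw [g2 23 (by simp), g1 23 (by simp), hfl]
  have t1 := p₁.1
  have t2 := p₂.1
  simp only [wp_seq, wp_set, wp_ite, wp_store, wp_skip, Expr.eval, Expr.Ok, Expr.cost,
    BinOp.eval, BinOp.Fits, State.setReg_reg, State.setReg_mem, State.setMem_reg,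
    Nat.reduceEqDiff, if_true, if_false, ind_and, ind_not, ind_eq_zero, ind_ne_zero,
    true_and, and_true, k28, k26, g30, p₂.2]
  refine ⟨by omega, fun hh => ?_, fun hh => ⟨?_, ?_, ?_, fun h1 h2 => ?_⟩⟩
  · obtain ⟨hcard, hpos, hne⟩ := hh
    have hpos' : 1 ≤ (bits (x &&& y)).card := by
      rw [Nat.one_le_iff_ne_zero, Ne, Finset.card_eq_zero, bits_eq_empty]
      omega
    have hlt' : (bits (x &&& y)).card < (bits x).card := by
      rw [bits_and]
      refine Finset.card_lt_card (Finset.inter_subset_left.ssubset_of_ne fun h => hne ?_)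
      rw [← bits_and] at h
      exact bits_injective h
    refine (evalHeart_spec (L := L) (fp := fp) (fl := fl) (c := (bits x).card) (H := x &&& y)
      (by simp [k8]) (by simp [k22]) (by simp [k23]) (by simp [k28]) (by simp)
      (by simpa [gm2] using fun x hx => (hlt x hx).1) (by simpa [gm2] using hnd) hLW hW hxyL hx.2
      hpos' hlt' hkW hκW hθW).mono fun t₃ s₃ f₃ p₃ => ?_
    simp only [State.setReg_reg, State.setReg_mem, Nat.reduceEqDiff, if_false, gm2, k35, k36,
      k37] at p₃
    have t3 := p₃.1
    refine ⟨?_, ?_⟩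
    · rw [show fl + 4 = (fl + 1) + 3 by omega, add_mul]; omega
    · rcases p₃.2 with ⟨q1, q2, q3, q4, q5⟩ | ⟨q1, q3, q4, q5⟩
      · rw [q3, q4, q5]
        exact ⟨q2.le, fun _ => ⟨hxyL, q1, rfl⟩, fun _ _ => by rw [bits_and]⟩
      · rw [q3, q4, q5]
        refine ⟨le_rfl, hv, fun h1 h2 => ?_⟩
        rw [← bits_and] at h2 ⊢
        by_contra hcon
        exact q1 ⟨h2, not_le.1 hcon⟩
  · rw [show fl + 4 = (fl + 1) + 3 by omega, add_mul]; omega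
  · exact k35.le
  · rwa [k35, k36, k37]
  · exfalso
    rw [← bits_and] at h2
    refine hh ⟨h1, ?_, fun h => ?_⟩
    · have := h2.1
      rw [Nat.one_le_iff_ne_zero, Ne, Finset.card_eq_zero, bits_eq_empty] at this
      omega
    · have := h2.2.1
      rw [h] at this
      omega

/-- Search for the sunflower with the smallest key. -/
def search (κ k : ℕ) : Cmd :=
  35 ::= K[(k + 1) * (k + 1)] ;; .for 24 23 (.for 25 23 (searchBody κ k))

theorem search_wregs (κ k : ℕ) : ∀ r ∈ (searchBody κ k).wregs, 26 ≤ r ∧ r ≤ 42 := by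
  simp [searchBody, evalHeart, popc, count]

theorem search_warrs (κ k : ℕ) : (searchBody κ k).warrs = [] := by
  simp [searchBody, evalHeart, popc, count]

/-- By `Heavy.exists_inter` every large sunflower is matched by one whose heart is the intersection
of two sets and is at least as large. Polynomially many candidates thus suffice. The key orders
hearts lexicographically, first by increasing `c` and then by decreasing size, so a minimal key is a
pick. The initial value `(k + 1) * (k + 1)` exceeds all keys and means that nothing was found. -/
theorem search_spec {W L fp fl κ k : ℕ} {s : State} (hL : s.reg 8 = L)
    (hfp : s.reg 22 = fp) (hfl : s.reg 23 = fl)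
    (hlt : ∀ x ∈ seg (s.mem 1) fp fl, x < 2 ^ L ∧ (bits x).card ≤ k)
    (hnd : (seg (s.mem 1) fp fl).Nodup) (hLW : L < W) (hW : fp + fl < W)
    (hkW : (k + 1) * (k + 1) ≤ W) (hκW : κ ≤ W) (hθW : 2 ^ (2 * κ * k) ≤ W) (hκ : k + 1 ≤ κ) :
    wp W (search κ k) s fun t s' => t ≤ fl * (fl * ((fl + 5) * (20 * L + 100)) + 20) + 20 ∧
      ((s'.reg 35 < (k + 1) * (k + 1) ∧ s'.reg 36 < 2 ^ L ∧
          IsPick κ (fam (seg (s.mem 1) fp fl)) (s'.reg 37) (bits (s'.reg 36))) ∨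
        (¬ s'.reg 35 < (k + 1) * (k + 1) ∧
          ∀ c H, ¬ Heavy κ (fam (seg (s.mem 1) fp fl)) c H)) := by
  set f := s.mem 1 with hf
  set F := fam (seg f fp fl) with hF
  have hr := search_wregs κ k
  have ha := search_warrs κ k
  have nin : ∀ r, r < 26 → r ∉ (searchBody κ k).wregs := fun r h h' => by
    have := (hr r h').1; omega
  have key := wp_for (W := W) (i := 24) (ℓ := 23) (n := fl)
    (T := fl * ((fl + 5) * (20 * L + 100)) + 10)
    (c := .for 25 23 (searchBody κ k)) (s₀ := s.setReg 35 ((k + 1) * (k + 1)))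
    (fun i s' => Valid κ k L F (s'.reg 35) (s'.reg 36) (s'.reg 37) ∧
      ∀ i' < i, ∀ j' < fl, Seen κ k F (s'.reg 35) (bits (f (fp + i'))) (bits (f (fp + j'))))
    (by simp [hfl]) (by omega) (by omega)
    (by simpa using nin 24 (by omega)) (by simpa using nin 23 (by omega)) (by simp)
    (by simp [Valid]) (by
      rintro i s' hi hii hfr ⟨hV, hS⟩
      have r8 : s'.reg 8 = L := by
        rw [hfr.1 8 (by simpa using nin 8 (by omega))]; simp [hL]
      have r22 : s'.reg 22 = fp := by
        rw [hfr.1 22 (by simpa using nin 22 (by omega))]; simp [hfp]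
      have r23 : s'.reg 23 = fl := by
        rw [hfr.1 23 (by simpa using nin 23 (by omega))]; simp [hfl]
      have m1 : s'.mem 1 = f := by rw [hfr.2 1 (by simp [ha])]; simp [hf]
      refine (wp_for (n := fl) (T := (fl + 4) * (20 * L + 100))
        (fun j s₁ => Valid κ k L F (s₁.reg 35) (s₁.reg 36) (s₁.reg 37) ∧
          (∀ i' < i, ∀ j' < fl,
            Seen κ k F (s₁.reg 35) (bits (f (fp + i'))) (bits (f (fp + j')))) ∧
          ∀ j' < j, Seen κ k F (s₁.reg 35) (bits (f (fp + i))) (bits (f (fp + j'))))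
        r23 (by omega) (by omega) (nin 25 (by omega)) (nin 23 (by omega)) (by simp)
        ⟨by simpa using hV, by simpa using hS, by simp⟩ ?_).mono ?_
      · rintro j s₁ hj hjj hfr₁ ⟨hV₁, hS₁, hS₂⟩
        have q : ∀ r, r < 25 → s₁.reg r = s'.reg r := fun r h =>
          hfr₁.1 r (by simpa using ⟨by omega, nin r (by omega), by omega⟩)
        have m2 : s₁.mem 1 = f := by rw [hfr₁.2 1 (by simp [ha]), m1]
        refine (searchBody_spec (L := L) (fp := fp) (fl := fl) (i := i) (j := j) (κ := κ) (k := k)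
          (by rw [q 8 (by omega), r8]) (by rw [q 22 (by omega), r22]) (by rw [q 23 (by omega), r23])
          (by rw [q 24 (by omega), hii]) hjj hi hj (by rwa [m2]) (by rwa [m2]) hLW hW hkW hκW hθW
          (by rwa [m2])).mono ?_
        rintro t s₂ - ⟨h1, h2, h3, h4⟩
        rw [m2] at h3 h4
        refine ⟨h1, by simpa using h3, ?_, ?_⟩
        · simp only [State.setReg_reg, Nat.reduceEqDiff, if_false]
          exact fun i' hi' j' hj' => (hS₁ i' hi' j' hj').mono h2
        · simp only [State.setReg_reg, Nat.reduceEqDiff, if_false]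
          intro j' hj'
          rcases Nat.lt_succ_iff_lt_or_eq.1 hj' with h | rfl
          · exact (hS₂ j' h).mono h2
          · exact h4
      · rintro t s₁ - ⟨h1, h2, h3, h4⟩
        refine ⟨h1.trans ?_, by simpa using h2, ?_⟩
        · have : fl * ((fl + 4) * (20 * L + 100) + 8) ≤ fl * ((fl + 5) * (20 * L + 100)) := by
            refine Nat.mul_le_mul_left _ ?_
            rw [show fl + 5 = fl + 4 + 1 by omega, add_mul (fl + 4)]; omega
          omega
        · simp only [State.setReg_reg, Nat.reduceEqDiff, if_false]
          intro i' hi' j' hj'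
          rcases Nat.lt_succ_iff_lt_or_eq.1 hi' with h | rfl
          · exact h3 i' h j' hj'
          · exact h4 j' hj')
  rw [search, wp_seq, wp_set]
  refine ⟨hkW, key.mono fun t s' _ h => ⟨?_, ?_⟩⟩
  · have := h.1
    simp only [Expr.cost]
    have h2 : fl * (fl * ((fl + 5) * (20 * L + 100)) + 10 + 8) ≤
      fl * (fl * ((fl + 5) * (20 * L + 100)) + 20) := Nat.mul_le_mul_left _ (by omega)
    omega
  · obtain ⟨-, hV, hS⟩ := h
    have hgr : ∀ C ∈ F, C.card ≤ k := fun C hC => by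
      obtain ⟨x, hx, rfl⟩ := mem_fam.1 hC
      exact (hlt x hx).2
    have hall : ∀ c H, Heavy κ F c H → ∃ h, H.card ≤ h ∧ h < c ∧ c ≤ k ∧
        s'.reg 35 ≤ WordRAM.key k c h := by
      intro c H hH
      have hpos : 0 < (F.filter fun C => C.card = c ∧ H ⊆ C).card :=
        lt_of_lt_of_le (one_le_θ κ _) hH.2.2
      obtain ⟨C₀, hC₀⟩ := Finset.card_pos.1 hpos
      rw [Finset.mem_filter] at hC₀
      have hck : c ≤ k := hC₀.2.1 ▸ hgr C₀ hC₀.1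
      obtain ⟨C, hC, D, hD, h1, h2, h3, h4⟩ := hH.exists_inter hκ hck
      obtain ⟨x, hx, rfl⟩ := mem_fam.1 hC
      obtain ⟨y, hy, rfl⟩ := mem_fam.1 hD
      obtain ⟨i, hi, rfl⟩ := mem_seg.1 hx
      obtain ⟨j, hj, rfl⟩ := mem_seg.1 hy
      refine ⟨_, h3, h4.2.1, hck, ?_⟩
      have := hS i hi j hj (h1.trans h2.symm) (by rwa [h1])
      rwa [h1] at this
    by_cases hb : s'.reg 35 < (k + 1) * (k + 1)
    · refine Or.inl ⟨hb, (hV hb).1, (hV hb).2.1, fun c' H' hH' => ?_⟩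
      obtain ⟨h, h1, h2, h3, h4⟩ := hall c' H' hH'
      rw [(hV hb).2.2, WordRAM.key, WordRAM.key] at h4
      -- The second component of a key is at most `k`, so the comparison of keys is lexicographic.
      have h5 := (hV hb).2.1.2.1
      have h6 : s'.reg 37 ≤ c' := by
        by_contra hcon
        have : (c' + 1) * (k + 1) ≤ s'.reg 37 * (k + 1) :=
          Nat.mul_le_mul_right _ (by omega)
        rw [add_mul] at this
        omega
      rcases h6.lt_or_eq with h7 | h7
      · exact Or.inl h7
      · rw [h7] at h4
        exact Or.inr ⟨h7, by omega⟩
    · refine Or.inr ⟨hb, fun c H hH => ?_⟩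
      obtain ⟨h, h1, h2, h3, h4⟩ := hall c H hH
      rw [WordRAM.key] at h4
      have : c * (k + 1) ≤ k * (k + 1) := Nat.mul_le_mul_right _ h3
      have h5 : (k + 1) * (k + 1) = k * (k + 1) + (k + 1) := by ring
      omega

end WordRAM

/-! ### The two successors of a node are written to the stack -/

namespace WordRAM

open Sparsify


/-- Append a copy of the list of `reg 23` clauses at address `reg 22`. -/
def copyList : Cmd := .for 24 23 (.store 1 R[14] (A[1, R[22] +ₑ R[24]]) ;; 14 ::= R[14] +ₑ K[1])

theorem copyList_spec {W fp fl m : ℕ} {s : State} (hfp : s.reg 22 = fp) (hfl : s.reg 23 = fl)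
    (hm : s.reg 14 = m) (hle : fp + fl ≤ m) (hW : m + fl < W) :
    wp W copyList s fun t s' => t ≤ fl * 30 + 10 ∧ s'.reg 14 = m + fl ∧
      seg (s'.mem 1) m fl = seg (s.mem 1) fp fl ∧ ∀ i < m, s'.mem 1 i = s.mem 1 i := by
  refine (wp_for (n := fl) (T := 20)
    (fun j s' => s'.reg 14 = m + j ∧ seg (s'.mem 1) m j = seg (s.mem 1) fp j ∧
      ∀ i < m, s'.mem 1 i = s.mem 1 i) hfl (by omega) (by omega) (by simp) (by simp) (by simp)
      (by simp [seg_zero, hm]) ?_).mono ?_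
  · rintro j s' hj hij hf ⟨h14, hs, hmem⟩
    have h22 : s'.reg 22 = fp := by rw [hf.1 22 (by simp)]; exact hfp
    simp only [wp_seq, wp_set, wp_ite, wp_store, wp_skip, Expr.eval, Expr.Ok, Expr.cost,
      BinOp.eval, BinOp.Fits, State.setReg_reg, State.setReg_mem, State.setMem_reg,
      Nat.reduceEqDiff, if_true, if_false, ind_and, ind_not, ind_eq_zero, ind_ne_zero,
      true_and, and_true, h22, hij, h14]
    refine ⟨by omega, by omega, by omega, by omega, ?_, fun i hi => ?_⟩
    · simp only [State.setMem_mem, if_true]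
      rw [seg_update, hs, seg_succ, hmem _ (by omega)]
    · rw [State.setMem_mem_apply, if_neg (by omega), hmem i hi]
  · rintro t s' - ⟨h1, h2⟩
    exact ⟨by omega, h2⟩

/-- Push the list from address `reg 20` up to `reg 14` on the stack. -/
def push : Cmd :=
  .store 2 R[15] R[20] ;; .store 3 R[15] (R[14] -ₑ R[20]) ;; 15 ::= R[15] +ₑ K[1]

/-- The stack has grown from `s` to `s'` by the list `l`. -/
structure Pushed (l : List ℕ) (s s' : State) : Prop where
  reg15 : s'.reg 15 = s.reg 15 + 1
  reg14 : s'.reg 14 = s.reg 14 + l.length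
  mem2 : s'.mem 2 = Function.update (s.mem 2) (s.reg 15) (s.reg 14)
  mem3 : s'.mem 3 = Function.update (s.mem 3) (s.reg 15) l.length
  seg : seg (s'.mem 1) (s.reg 14) l.length = l
  mem1 : ∀ i < s.reg 14, s'.mem 1 i = s.mem 1 i

/-- Push the current list together with the set `reg 36`. -/
def pushHeart : Cmd :=
  20 ::= R[14] ;; copyList ;; .store 1 R[14] R[36] ;; 14 ::= R[14] +ₑ K[1] ;; push

theorem pushHeart_spec {W fp fl : ℕ} {s : State} (hfp : s.reg 22 = fp) (hfl : s.reg 23 = fl)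
    (hle : fp + fl ≤ s.reg 14) (hW : s.reg 14 + fl + 1 < W) (hW' : s.reg 15 < W) :
    wp W pushHeart s fun t s' => t ≤ fl * 30 + 50 ∧
      Pushed (seg (s.mem 1) fp fl ++ [s.reg 36]) s s' := by
  rw [pushHeart, wp_seq, wp_set]
  refine ⟨trivial, ?_⟩
  rw [wp_seq]
  refine (copyList_spec (fp := fp) (fl := fl) (m := s.reg 14) (by simp [hfp]) (by simp [hfl])
    (by simp) hle (by omega)).mono fun t s₁ f h => ?_
  obtain ⟨h1, h2, h3, h4⟩ := h
  have g15 := f.1 15 (by simp [copyList])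
  have g20 := f.1 20 (by simp [copyList])
  have g36 := f.1 36 (by simp [copyList])
  have gm2 := f.2 2 (by simp [copyList])
  have gm3 := f.2 3 (by simp [copyList])
  simp only [State.setReg_reg, State.setReg_mem, Nat.reduceEqDiff, if_true, if_false, Expr.eval]
    at g15 g20 g36 gm2 gm3 h3 h4
  have hlen : (seg (s.mem 1) fp fl ++ [s.reg 36]).length = fl + 1 := by simp [seg_length]
  rw [push]
  simp only [wp_seq, wp_set, wp_ite, wp_store, wp_skip, Expr.eval, Expr.Ok, Expr.cost,
    BinOp.eval, BinOp.Fits, State.setReg_reg, State.setReg_mem, State.setMem_reg,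
    Nat.reduceEqDiff, if_true, if_false, ind_and, ind_not, ind_eq_zero, ind_ne_zero,
    true_and, and_true, g15, g20, g36, h2]
  refine ⟨⟨by omega, by omega⟩, ⟨by omega, by omega⟩, by omega, ⟨rfl, ?_, ?_, ?_, ?_, ?_⟩⟩
  · simp only [State.setReg_reg, State.setMem_reg, Nat.reduceEqDiff, if_true, if_false, hlen]; omega
  · simp [State.setMem_mem, gm2]
  · simp [State.setMem_mem, gm3, seg_length]; congr 1; omega
  · rw [hlen]
    simp only [State.setReg_mem, State.setMem_mem, Nat.reduceEqDiff, if_true, if_false,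
      OfNat.one_ne_ofNat]
    rw [seg_update, h3]
  · intro i hi
    simp only [State.setReg_mem, State.setMem_mem_apply, Nat.reduceEqDiff, if_false,
      OfNat.one_ne_ofNat, false_and, true_and]
    rw [if_neg (by omega), h4 i hi]

/-- Append the petals of the sunflower of sets of size `reg 37` with heart `reg 36`. -/
def addPetals : Cmd :=
  .for 24 23 (33 ::= A[1, R[22] +ₑ R[24]] ;; 41 ::= R[33] ;; popc ;;
    .ite (((R[33] &ₑ R[36]) =ₑ R[36]) &ₑ (R[40] =ₑ R[37]))
      (.store 1 R[14] (R[33] ^ₑ R[36]) ;; 14 ::= R[14] +ₑ K[1]) .skip)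

/-- The petals as a list. -/
def petalList (l : List ℕ) (c H : ℕ) : List ℕ :=
  (l.filter fun x => (bits x).card = c ∧ x &&& H = H).map (· ^^^ H)

theorem petalList_length (l : List ℕ) (c H : ℕ) : (petalList l c H).length ≤ l.length := by
  rw [petalList, List.length_map]; exact List.length_filter_le _ _

theorem addPetals_spec {W L fp fl m c H : ℕ} {s : State} (hL : s.reg 8 = L) (hfp : s.reg 22 = fp)
    (hfl : s.reg 23 = fl) (hm : s.reg 14 = m) (hH : s.reg 36 = H) (hc : s.reg 37 = c)
    (hle : fp + fl ≤ m) (hW : m + fl < W) (hLW : L < W) (hLW' : 2 ^ L ≤ W) (hHL : H < 2 ^ L)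
    (hlt : ∀ x ∈ seg (s.mem 1) fp fl, x < 2 ^ L) :
    wp W addPetals s fun t s' => t ≤ fl * (20 * L + 60) + 10 ∧
      s'.reg 14 = m + (petalList (seg (s.mem 1) fp fl) c H).length ∧
      seg (s'.mem 1) m (petalList (seg (s.mem 1) fp fl) c H).length =
        petalList (seg (s.mem 1) fp fl) c H ∧ ∀ i < m, s'.mem 1 i = s.mem 1 i := by
  refine (wp_for (n := fl) (T := 20 * L + 50)
    (fun j s' => s'.reg 14 = m + (petalList (seg (s.mem 1) fp j) c H).length ∧
      seg (s'.mem 1) m (petalList (seg (s.mem 1) fp j) c H).length =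
        petalList (seg (s.mem 1) fp j) c H ∧ ∀ i < m, s'.mem 1 i = s.mem 1 i)
      hfl (by omega) (by omega) (by simp [popc]) (by simp [popc]) (by simp)
      (by simp [seg_zero, petalList, hm]) ?_).mono ?_
  · rintro j s' hj hij hf ⟨h14, hs, hmem⟩
    have h22 : s'.reg 22 = fp := by rw [hf.1 22 (by simp [popc])]; exact hfp
    have h36 : s'.reg 36 = H := by rw [hf.1 36 (by simp [popc])]; exact hH
    have h37 : s'.reg 37 = c := by rw [hf.1 37 (by simp [popc])]; exact hc
    have h8 : s'.reg 8 = L := by rw [hf.1 8 (by simp [popc])]; exact hL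
    have hx := hlt _ (mem_seg.2 ⟨j, hj, rfl⟩)
    simp only [wp_seq, wp_set, wp_ite, wp_store, wp_skip, Expr.eval, Expr.Ok, Expr.cost,
      BinOp.eval, BinOp.Fits, State.setReg_reg, State.setReg_mem, State.setMem_reg,
      Nat.reduceEqDiff, if_true, if_false, ind_and, ind_not, ind_eq_zero, ind_ne_zero,
      true_and, and_true, h22, hij, hmem (fp + j) (by omega)]
    refine ⟨by omega, (popc_spec (x := s.mem 1 (fp + j)) (by simp) hx (by simp [h8])
      hLW).mono fun t s₂ f h => ?_⟩
    have g14 := f.1 14 (by simp [popc])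
    have g36 := f.1 36 (by simp [popc])
    have g37 := f.1 37 (by simp [popc])
    have g33 := f.1 33 (by simp [popc])
    have gm := f.2 1 (by simp [popc])
    simp only [State.setReg_reg, State.setReg_mem, Nat.reduceEqDiff, if_true, if_false, h36, h37,
      h14] at g14 g36 g37 g33 gm
    have hp := petalList_length (seg (s.mem 1) fp j) c H
    rw [seg_length] at hp
    have hsucc : petalList (seg (s.mem 1) fp (j + 1)) c H = petalList (seg (s.mem 1) fp j) c H ++
        petalList [s.mem 1 (fp + j)] c H := by
      rw [petalList, seg_succ, List.filter_append, List.map_append]; rfl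
    have hxor : s.mem 1 (fp + j) ^^^ H ≤ W := (Nat.xor_lt_two_pow hx hHL).le.trans hLW'
    have t1 := h.1
    rw [hsucc, List.length_append]
    simp only [wp_seq, wp_set, wp_ite, wp_store, wp_skip, Expr.eval, Expr.Ok, Expr.cost,
      BinOp.eval, BinOp.Fits, State.setReg_reg, State.setReg_mem, State.setMem_reg,
      Nat.reduceEqDiff, if_true, if_false, ind_and, ind_not, ind_eq_zero, ind_ne_zero,
      true_and, and_true, h.2, g14, g36, g37, g33]
    refine ⟨fun hh => ⟨hxor, ⟨by omega, by omega⟩, by omega, ?_, ?_, fun i hi => ?_⟩,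
      fun hh => ⟨by omega, ?_, ?_, ?_⟩⟩
    · simp [petalList, hh.1, hh.2]; omega
    · have : petalList [s.mem 1 (fp + j)] c H = [s.mem 1 (fp + j) ^^^ H] := by
        simp [petalList, hh.1, hh.2]
      rw [this, List.length_singleton]
      simp only [State.setMem_mem, if_true]
      rw [seg_update, gm, hs]
    · rw [State.setMem_mem_apply, if_neg (by omega), gm, hmem i hi]
    · rw [and_comm] at hh
      simp [petalList, hh, g14]
    · have : petalList [s.mem 1 (fp + j)] c H = [] := by
        rw [and_comm] at hh
        simp [petalList, hh]
      rw [this, List.append_nil, List.length_nil, add_zero, gm, hs]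
    · rw [gm]; exact hmem
  · rintro t s' - ⟨h1, h2⟩
    refine ⟨?_, h2⟩
    have : fl * (20 * L + 50 + 8) ≤ fl * (20 * L + 60) := Nat.mul_le_mul_left _ (by omega)
    omega

/-- Push the current list together with the petals. -/
def pushPetals : Cmd := 20 ::= R[14] ;; copyList ;; addPetals ;; push

theorem pushPetals_spec {W L fp fl : ℕ} {s : State} (hL : s.reg 8 = L) (hfp : s.reg 22 = fp)
    (hfl : s.reg 23 = fl) (hle : fp + fl ≤ s.reg 14) (hW : s.reg 14 + 2 * fl < W)
    (hW' : s.reg 15 < W) (hLW : L < W) (hLW' : 2 ^ L ≤ W) (hHL : s.reg 36 < 2 ^ L)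
    (hlt : ∀ x ∈ seg (s.mem 1) fp fl, x < 2 ^ L) :
    wp W pushPetals s fun t s' => t ≤ fl * (20 * L + 90) + 50 ∧
      Pushed (seg (s.mem 1) fp fl ++ petalList (seg (s.mem 1) fp fl) (s.reg 37) (s.reg 36))
        s s' := by
  rw [pushPetals, wp_seq, wp_set]
  refine ⟨trivial, ?_⟩
  rw [wp_seq]
  refine (copyList_spec (fp := fp) (fl := fl) (m := s.reg 14) (by simp [hfp]) (by simp [hfl])
    (by simp) hle (by omega)).mono fun t s₁ f h => ?_
  obtain ⟨h1, h2, h3, h4⟩ := h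
  have g8 := f.1 8 (by simp [copyList])
  have g15 := f.1 15 (by simp [copyList])
  have g20 := f.1 20 (by simp [copyList])
  have g22 := f.1 22 (by simp [copyList])
  have g23 := f.1 23 (by simp [copyList])
  have g36 := f.1 36 (by simp [copyList])
  have g37 := f.1 37 (by simp [copyList])
  have gm2 := f.2 2 (by simp [copyList])
  have gm3 := f.2 3 (by simp [copyList])
  simp only [State.setReg_reg, State.setReg_mem, Nat.reduceEqDiff, if_true, if_false, Expr.eval]
    at g8 g15 g20 g22 g23 g36 g37 gm2 gm3 h3 h4
  have hseg : seg (s₁.mem 1) fp fl = seg (s.mem 1) fp fl :=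
    seg_congr fun i _ hi => h4 i (by omega)
  rw [wp_seq]
  refine (addPetals_spec (L := L) (fp := fp) (fl := fl) (m := s.reg 14 + fl) (c := s.reg 37)
    (H := s.reg 36) (by rw [g8, hL]) (by rw [g22, hfp]) (by rw [g23, hfl]) h2 g36 g37 (by omega)
    (by omega) hLW hLW' hHL (by rwa [hseg])).mono fun t₂ s₂ f₂ p => ?_
  rw [hseg] at p
  obtain ⟨p1, p2, p3, p4⟩ := p
  have k15 := f₂.1 15 (by simp [addPetals, popc])
  have k20 := f₂.1 20 (by simp [addPetals, popc])
  have km2 := f₂.2 2 (by simp [addPetals, popc])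
  have km3 := f₂.2 3 (by simp [addPetals, popc])
  rw [g15] at k15
  rw [g20] at k20
  rw [gm2] at km2
  rw [gm3] at km3
  set pl := petalList (seg (s.mem 1) fp fl) (s.reg 37) (s.reg 36) with hpl
  have hpl' : pl.length ≤ fl := (petalList_length _ _ _).trans (seg_length _ _ _).le
  have hlen : (seg (s.mem 1) fp fl ++ pl).length = fl + pl.length := by simp [seg_length]
  rw [push]
  simp only [wp_seq, wp_set, wp_ite, wp_store, wp_skip, Expr.eval, Expr.Ok, Expr.cost,
    BinOp.eval, BinOp.Fits, State.setReg_reg, State.setReg_mem, State.setMem_reg,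
    Nat.reduceEqDiff, if_true, if_false, ind_and, ind_not, ind_eq_zero, ind_ne_zero,
    true_and, and_true, k15, k20, p2]
  refine ⟨by omega, ?_, ⟨rfl, ?_, ?_, ?_, ?_, ?_⟩⟩
  · have : fl * (20 * L + 90) = fl * (20 * L + 60) + fl * 30 := by ring
    omega
  · simp only [State.setReg_reg, State.setMem_reg, Nat.reduceEqDiff, if_false, hlen, p2]; omega
  · simp [State.setMem_mem, km2]
  · rw [hlen]; simp [State.setMem_mem, km3]; congr 1; omega
  · rw [hlen]
    simp only [State.setReg_mem, State.setMem_mem, Nat.reduceEqDiff, if_true, if_false,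
      OfNat.one_ne_ofNat]
    rw [← h3] at hpl ⊢
    rw [seg, List.range_add, List.map_append]
    congr 1
    · exact List.map_congr_left fun i hi => p4 _ (by rw [List.mem_range] at hi; omega)
    · refine Eq.trans ?_ p3
      rw [List.map_map]
      simp [seg, add_assoc]
  · intro i hi
    simp only [State.setReg_mem, State.setMem_mem_apply, Nat.reduceEqDiff, if_false,
      OfNat.one_ne_ofNat, false_and, true_and]
    rw [p4 i (by omega), h4 i hi]

end WordRAM

/-! ### Orthogonality of bit masks and distances -/

namespace Sparsify

/-- Coordinate `r` of point number `i`: the clause `X r` and the mask `M i` are compared. -/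
def entry (X : ℕ → ℕ) (fl : ℕ) (M : ℕ → ℕ) (G i r : ℕ) : Fin 3 :=
  if r < fl then if X r &&& M i ≠ 0 then 1 else if i < G then 0 else 2 else 0

/-- The points given by `entry`. -/
def gadget (X : ℕ → ℕ) (fl : ℕ) (M : ℕ → ℕ) (G n d : ℕ) : Fin n → Fin d → Fin 3 :=
  fun i r => entry X fl M G i r

/-- The indicator vector of the second half. -/
def gadgetVec (G n : ℕ) : Fin n → Fin 2 := fun i => if (i : ℕ) < G then 0 else 1

/-- Since `p` has values 0 and 1 only, the pair 0 and 2 is the only one with a difference above 1.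
-/
theorem norm_sub_lt_two {d : ℕ} {p q : Fin d → ℕ} (hp : ∀ r, p r ≤ 1) (hq : ∀ r, q r ≤ 2) :
    ‖(fun r => (p r : ℝ)) - fun r => (q r : ℝ)‖ ≤ 2 ∧
      (‖(fun r => (p r : ℝ)) - fun r => (q r : ℝ)‖ < 2 ↔ ∀ r, ¬ (p r = 0 ∧ q r = 2)) := by
  have key : ∀ r, |(p r : ℝ) - q r| ≤ if p r = 0 ∧ q r = 2 then 2 else 1 := by
    intro r
    have h1 := hp r
    have h2 := hq r
    generalize p r = a at *
    generalize q r = b at *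
    interval_cases a <;> interval_cases b <;> norm_num
  refine ⟨(pi_norm_le_iff_of_nonneg (by norm_num)).2 fun r => ?_, fun h r hr => ?_, fun h => ?_⟩
  · refine (key r).trans ?_
    split_ifs <;> norm_num
  · have := (norm_le_pi_norm ((fun r => (p r : ℝ)) - fun r => (q r : ℝ)) r).trans_lt h
    simp [hr.1, hr.2] at this
  · refine lt_of_le_of_lt ((pi_norm_le_iff_of_nonneg zero_le_one).2 fun r => ?_) one_lt_two
    simpa [h r] using key r

/-- Each of the `G` points of the second half contributes at most 2 to row `u`, and less than 2
exactly if every clause is met by one of the two masks. The coordinates from `fl` on are 0 for all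
points, so the dimension can be raised at will. -/
theorem gadget_mulVec_lt {X M : ℕ → ℕ} {fl G d : ℕ} (hfl : fl ≤ d) {u : Fin (2 * G)}
    (hu : (u : ℕ) < G) :
    (linftyDistMatrix fun i j => ((gadget X fl M G (2 * G) d i j : ℕ) : ℝ)).mulVec
        (fun j => ((gadgetVec G (2 * G) j : ℕ) : ℝ)) u < (2 * G : ℕ) ↔
      ∃ v < G, ∀ r < fl, X r &&& M u ≠ 0 ∨ X r &&& M (G + v) ≠ 0 := by
  set x := gadget X fl M G (2 * G) d with hx
  have hxu : ∀ r, (x u r : ℕ) ≤ 1 := by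
    intro r
    simp only [hx, gadget, entry, hu, if_true]
    split_ifs <;> simp
  have hz : ∑ j : Fin (2 * G), 2 * ((gadgetVec G (2 * G) j : ℕ) : ℝ) = (2 * G : ℕ) := by
    have := Fin.sum_univ_eq_sum_range (fun j => 2 * (((if j < G then 0 else 1 : Fin 2) : ℕ) : ℝ))
      (2 * G)
    refine this.trans ?_
    rw [two_mul, Finset.sum_range_add, Finset.sum_eq_zero, zero_add,
      Finset.sum_congr rfl (g := fun _ => (2 : ℝ))]
    · simp; ring
    · intro j _; simp
    · intro j hj; simp [Finset.mem_range.1 hj]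
  have hrow : ∀ j, ‖(fun r => ((x u r : ℕ) : ℝ)) - fun r => ((x j r : ℕ) : ℝ)‖ ≤ 2 ∧ _ :=
    fun j => norm_sub_lt_two hxu fun r => by omega
  rw [← hz, Matrix.mulVec, dotProduct]
  simp only [linftyDistMatrix, Matrix.of_apply]
  have hval : ∀ v (hv : v < G) (r : Fin d), (x u r : ℕ) = 0 ∧ (x ⟨G + v, by omega⟩ r : ℕ) = 2 ↔
      (r : ℕ) < fl ∧ ¬ (X r &&& M u ≠ 0 ∨ X r &&& M (G + v) ≠ 0) := by
    intro v hv r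
    simp only [hx, gadget, entry, hu, if_true, show ¬ G + v < G by omega, if_false]
    split_ifs <;> simp_all
  constructor
  · intro h
    obtain ⟨j, -, hj⟩ := Finset.exists_lt_of_sum_lt h
    have hjG : ¬ (j : ℕ) < G := by
      intro h'
      simp [gadgetVec, h'] at hj
    simp only [gadgetVec, hjG, if_false, Fin.val_one, Nat.cast_one, mul_one] at hj
    refine ⟨j - G, by omega, fun r hr => ?_⟩
    by_contra hcon
    refine (hrow j).2.1 hj ⟨r, by omega⟩ ?_
    have := (hval (j - G) (by omega) ⟨r, by omega⟩).2 ⟨hr, hcon⟩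
    simpa only [show G + ((j : ℕ) - G) = j by omega] using this
  · rintro ⟨v, hv, h⟩
    refine Finset.sum_lt_sum (fun j _ => ?_) ⟨⟨G + v, by omega⟩, Finset.mem_univ _, ?_⟩
    · exact mul_le_mul_of_nonneg_right (hrow j).1 (Nat.cast_nonneg _)
    · simp only [gadgetVec, show ¬ G + v < G by omega, if_false, Fin.val_one, Nat.cast_one, mul_one]
      exact (hrow _).2.2 fun r hr => ((hval v hv r).1 hr).2 (h r ((hval v hv r).1 hr).1)

/-! ### Assignments as masks -/

/-- The literals that are true under an assignment `u` to the first `g` of `nv` variables. -/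
def rowMask (nv g u : ℕ) : ℕ := u ||| ((2 ^ g - (u + 1)) <<< nv)

/-- The literals that are true under an assignment `w` to the variables from `g` on. -/
def colMask (nv g w : ℕ) : ℕ := (w <<< g) ||| ((2 ^ (nv - g) - (w + 1)) <<< (nv + g))

/-- The value of variable `v` under the assignment `(u, w)`. -/
def asgVal (g u w v : ℕ) : Bool := if v < g then u.testBit v else w.testBit (v - g)

/-- The number `2 ^ g - (u + 1)` is the complement of `u` on `g` bits. Shifted by `nv`, it marks the
negative literals that `u` makes true. -/
theorem mem_masks {nv g u w v : ℕ} (hg : g ≤ nv) (hu : u < 2 ^ g) (hw : w < 2 ^ (nv - g))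
    (hv : v < nv) (b : Bool) : (if b then v else v + nv) ∈ bits (rowMask nv g u) ∪
      bits (colMask nv g w) ↔ asgVal g u w v = b := by
  have hu' : ∀ i, g ≤ i → u.testBit i = false := fun i hi =>
    Nat.testBit_lt_two_pow (hu.trans_le (Nat.pow_le_pow_right (by norm_num) hi))
  have hw' : ∀ i, nv - g ≤ i → w.testBit i = false := fun i hi =>
    Nat.testBit_lt_two_pow (hw.trans_le (Nat.pow_le_pow_right (by norm_num) hi))
  simp only [Finset.mem_union, mem_bits, rowMask, colMask, Nat.testBit_or, Nat.testBit_shiftLeft,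
    asgVal, Nat.testBit_two_pow_sub_succ hu, Nat.testBit_two_pow_sub_succ hw]
  cases b
  · by_cases hvg : v < g
    · simp [hvg, show ¬ nv + g ≤ v + nv by omega, hu' (v + nv) (by omega),
        hw' (v + nv - g) (by omega)]
    · simp [hvg, show nv + g ≤ v + nv by omega, hu' (v + nv) (by omega),
        hw' (v + nv - g) (by omega), show v + nv - (nv + g) = v - g by omega,
        show v - g < nv - g by omega]
  · by_cases hvg : v < g
    · simp [hvg, show ¬ g ≤ v by omega, show ¬ nv ≤ v by omega, show ¬ nv + g ≤ v by omega]
    · simp [hvg, show g ≤ v by omega, show ¬ nv ≤ v by omega, show ¬ nv + g ≤ v by omega,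
        hu' v (by omega)]

/-- The position of a literal in a mask. -/
def litPos (nv : ℕ) (l : ℕ × Bool) : ℕ := if l.2 then l.1 else l.1 + nv

/-- The literals of a clause as a mask. -/
def clauseMask {k n : ℕ} (nv : ℕ) (c : Fin k → Fin n × Bool) (j : ℕ) : ℕ :=
  (List.range j).foldl (fun x i => if h : i < k then
    x ||| 1 <<< litPos nv ((c ⟨i, h⟩).1, (c ⟨i, h⟩).2) else x) 0

theorem clauseMask_succ {k n : ℕ} (nv : ℕ) (c : Fin k → Fin n × Bool) {j : ℕ} (h : j < k) :
    clauseMask nv c (j + 1) =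
      clauseMask nv c j ||| 1 <<< litPos nv ((c ⟨j, h⟩).1, (c ⟨j, h⟩).2) := by
  simp [clauseMask, List.range_succ, h]

theorem mem_bits_clauseMask {k n nv i : ℕ} {c : Fin k → Fin n × Bool} {j : ℕ} (hj : j ≤ k) :
    i ∈ bits (clauseMask nv c j) ↔
      ∃ r : Fin k, (r : ℕ) < j ∧ litPos nv ((c r).1, (c r).2) = i := by
  induction j with
  | zero => simp [clauseMask, bits_zero]
  | succ j ih =>
    rw [clauseMask_succ _ _ hj, bits_or, Finset.mem_union, ih (by omega), mem_bits,
      Nat.one_shiftLeft, Nat.testBit_two_pow]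
    constructor
    · rintro (⟨r, h1, h2⟩ | h)
      · exact ⟨r, by omega, h2⟩
      · exact ⟨⟨j, hj⟩, by simp, by simpa using h⟩
    · rintro ⟨r, h1, h2⟩
      by_cases h : (r : ℕ) = j
      · right
        have : r = ⟨j, hj⟩ := Fin.ext h
        subst this
        simpa using h2
      · exact Or.inl ⟨r, by omega, h2⟩

theorem card_clauseMask_le {k n nv : ℕ} {c : Fin k → Fin n × Bool} {j : ℕ} (hj : j ≤ k) :
    (bits (clauseMask nv c j)).card ≤ j := by
  induction j with
  | zero => simp [clauseMask, bits_zero]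
  | succ j ih =>
    rw [clauseMask_succ _ _ hj]
    have := ih (by omega)
    have := card_bits_two_pow_le (clauseMask nv c j) (litPos nv ((c ⟨j, hj⟩).1, (c ⟨j, hj⟩).2))
    omega

theorem litPos_lt {n nv : ℕ} (h : n ≤ nv) (l : Fin n × Bool) : litPos nv (l.1, l.2) < 2 * nv := by
  have := l.1.2
  unfold litPos
  split_ifs <;> simp <;> omega

theorem clauseMask_lt {k n nv : ℕ} (h : n ≤ nv) (c : Fin k → Fin n × Bool) {j : ℕ} (hj : j ≤ k) :
    clauseMask nv c j < 2 ^ (2 * nv) := by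
  refine Nat.lt_pow_two_of_testBit _ fun i hi => ?_
  by_contra hcon
  obtain ⟨r, -, hr⟩ := (mem_bits_clauseMask hj).1 (mem_bits.2 (by simpa using hcon))
  have := litPos_lt h (c r)
  omega

/-- Satisfiability as a hitting set problem. -/
theorem satisfiable_iff_hits {k n m nv g : ℕ} (φ : KCNF k n m) (hn : n ≤ nv) (hg : g ≤ nv) :
    φ.Satisfiable ↔ ∃ u < 2 ^ g, ∃ w < 2 ^ (nv - g), ∀ i, ¬ Disjoint
      (bits (clauseMask nv (φ i) k)) (bits (rowMask nv g u) ∪ bits (colMask nv g w)) := by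
  have key : ∀ u < 2 ^ g, ∀ w < 2 ^ (nv - g), ∀ i, ¬ Disjoint
      (bits (clauseMask nv (φ i) k)) (bits (rowMask nv g u) ∪ bits (colMask nv g w)) ↔
      ∃ j, asgVal g u w (φ i j).1 = (φ i j).2 := by
    intro u hu w hw i
    rw [Finset.not_disjoint_iff]
    constructor
    · rintro ⟨p, h1, h2⟩
      obtain ⟨r, -, rfl⟩ := (mem_bits_clauseMask le_rfl).1 h1
      exact ⟨r, (mem_masks hg hu hw ((φ i r).1.2.trans_le hn) _).1 h2⟩
    · rintro ⟨r, hr⟩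
      exact ⟨_, (mem_bits_clauseMask le_rfl).2 ⟨r, r.2, rfl⟩,
        (mem_masks hg hu hw ((φ i r).1.2.trans_le hn) _).2 hr⟩
  constructor
  · rintro ⟨a, ha⟩
    -- The padding variables occur in no clause; their value is irrelevant.
    set f : ℕ → Bool := fun v => if h : v < n then a ⟨v, h⟩ else false with hf
    refine ⟨Nat.ofBits fun i : Fin g => f i, Nat.ofBits_lt_two_pow _,
      Nat.ofBits fun i : Fin (nv - g) => f (g + i), Nat.ofBits_lt_two_pow _, fun i => ?_⟩
    rw [key _ (Nat.ofBits_lt_two_pow _) _ (Nat.ofBits_lt_two_pow _)]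
    obtain ⟨j, hj⟩ := ha i
    refine ⟨j, ?_⟩
    rw [← hj]
    have := (φ i j).1.2
    unfold asgVal
    split_ifs with h
    · rw [Nat.testBit_ofBits_lt _ _ h]
      simp [hf]
    · rw [Nat.testBit_ofBits_lt _ _ (by omega)]
      simp [hf, show g + ((φ i j).1 - g) = ((φ i j).1 : ℕ) by omega]
  · rintro ⟨u, hu, w, hw, h⟩
    exact ⟨fun v => asgVal g u w v, fun i => (key u hu w hw i).1 (h i)⟩

end Sparsify

/-! ### Calling the matrix-vector product -/

namespace WordRAM

open Sparsify


/-- The registers that stay constant after the initialisation. -/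
structure Const (nv g S T₀ : ℕ) (s : State) : Prop where
  reg2 : s.reg 2 = nv
  reg4 : s.reg 4 = g
  reg5 : s.reg 5 = 2 * 2 ^ g
  reg6 : s.reg 6 = S
  reg7 : s.reg 7 = T₀
  reg8 : s.reg 8 = 2 * nv
  reg9 : s.reg 9 = 2 ^ g
  reg16 : s.reg 16 = 2 ^ (nv - 2 * g)
  reg19 : s.reg 19 = 2 ^ (nv - g)

theorem Const.congr {nv g S T₀ : ℕ} {s s' : State} (h : Const nv g S T₀ s)
    (hr : ∀ r ∈ [2, 4, 5, 6, 7, 8, 9, 16, 19], s'.reg r = s.reg r) : Const nv g S T₀ s' :=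
  ⟨(hr 2 (by simp)).trans h.1, (hr 4 (by simp)).trans h.2, (hr 5 (by simp)).trans h.3,
    (hr 6 (by simp)).trans h.4, (hr 7 (by simp)).trans h.5, (hr 8 (by simp)).trans h.6,
    (hr 9 (by simp)).trans h.7, (hr 16 (by simp)).trans h.8, (hr 19 (by simp)).trans h.9⟩

/-- The mask of the row or column number `i` in block `ρ`. -/
def mask (nv g ρ i : ℕ) : ℕ :=
  if i < 2 ^ g then rowMask nv g i else colMask nv g (i - 2 ^ g + 2 ^ g * ρ)

/-- The mask of row `reg 43` is computed, and the vector is written. -/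
def maskRow : Cmd :=
  .ite (R[43] <ₑ R[9])
    (45 ::= R[43] |ₑ ((R[9] -ₑ (R[43] +ₑ K[1])) <<ₑ R[2]))
    (46 ::= (R[43] -ₑ R[9]) +ₑ R[9] *ₑ R[17] ;;
      45 ::= (R[46] <<ₑ R[4]) |ₑ ((R[19] -ₑ (R[46] +ₑ K[1])) <<ₑ (R[2] +ₑ R[4])) ;;
      .store 12 (R[13] +ₑ R[43]) K[1])

theorem shiftLeft_lt {x a b c : ℕ} (hx : x < 2 ^ a) (h : a + b ≤ c) : x <<< b < 2 ^ c := by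
  rw [Nat.shiftLeft_eq]
  refine lt_of_lt_of_le (Nat.mul_lt_mul_of_pos_right hx (by positivity)) ?_
  rw [← pow_add]
  exact Nat.pow_le_pow_right (by norm_num) h

theorem maskRow_spec {W nv g S T₀ ρ j base : ℕ} {s : State} (hc : Const nv g S T₀ s)
    (hj : s.reg 43 = j) (hj' : j < 2 * 2 ^ g) (hρ : s.reg 17 = ρ) (hρ' : ρ < 2 ^ (nv - 2 * g))
    (hg : 2 * g ≤ nv) (hW : 2 ^ (2 * nv) ≤ W) (hb : s.reg 13 = base)
    (hbW : base + 2 * 2 ^ g ≤ W) :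
    wp W maskRow s fun t s' => t ≤ 50 ∧ s'.reg 45 = mask nv g ρ j ∧
      ∀ i, s'.mem 12 i = if i = base + j ∧ 2 ^ g ≤ j then 1 else s.mem 12 i := by
  have hnW : 2 * nv < W := Nat.lt_two_pow_self.trans_le hW
  have hle : ∀ x, x < 2 ^ (2 * nv) → x ≤ W := fun x hx => hx.le.trans hW
  have hgn : 2 ^ g ≤ 2 ^ (nv - g) := Nat.pow_le_pow_right (by norm_num) (by omega)
  have hnn : 2 ^ (nv - g) ≤ 2 ^ (2 * nv) := Nat.pow_le_pow_right (by norm_num) (by omega)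
  have hpos : 0 < 2 ^ g := by positivity
  have hpos' : 0 < 2 ^ (nv - g) := by positivity
  rw [maskRow]
  simp only [wp_seq, wp_set, wp_ite, wp_store, wp_skip, Expr.eval, Expr.Ok, Expr.cost,
    BinOp.eval, BinOp.Fits, State.setReg_reg, State.setReg_mem, State.setMem_reg,
    Nat.reduceEqDiff, if_true, if_false, ind_and, ind_not, ind_eq_zero, ind_ne_zero,
    true_and, and_true, hj, hρ, hb, hc.reg9, hc.reg2, hc.reg19, hc.reg4]
  refine ⟨fun h => ⟨⟨⟨⟨by omega, by omega⟩, ?_⟩, ?_⟩, by omega, ?_, fun i => ?_⟩, fun h => ?_⟩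
  · refine hle _ (shiftLeft_lt (a := g) (by omega) (by omega))
  · refine hle _ (Nat.or_lt_two_pow ?_ (shiftLeft_lt (a := g) (by omega) (by omega)))
    exact h.trans_le (hgn.trans hnn)
  · rw [mask, if_pos h, rowMask]
  · rw [if_neg (by omega)]
  -- The `2 ^ (nv - 2 g)` blocks of `2 ^ g` columns exhaust the assignments of the second group.
  · have hw : j - 2 ^ g + 2 ^ g * ρ < 2 ^ (nv - g) := by
      have h1 : 2 ^ (nv - g) = 2 ^ g * 2 ^ (nv - 2 * g) := by
        rw [← pow_add]; congr 1; omega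
      have h2 : 2 ^ g * (ρ + 1) ≤ 2 ^ g * 2 ^ (nv - 2 * g) := Nat.mul_le_mul_left _ hρ'
      rw [mul_add] at h2
      omega
    have h1 := shiftLeft_lt (b := g) (c := 2 * nv) hw (by omega)
    have h2 := shiftLeft_lt (x := 2 ^ (nv - g) - (j - 2 ^ g + 2 ^ g * ρ + 1)) (a := nv - g)
      (b := nv + g) (c := 2 * nv) (by omega) (by omega)
    refine ⟨⟨by omega, by omega⟩, ⟨⟨hle _ h1, ⟨⟨by omega, by omega⟩, by omega, hle _ h2⟩,
      hle _ (Nat.or_lt_two_pow h1 h2)⟩, by omega, by omega, by omega, ?_, fun i => ?_⟩⟩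
    · rw [mask, if_neg h, colMask]
    · rw [State.setMem_mem_apply]
      simp [show 2 ^ g ≤ j by omega]

/-- The coordinates of point `reg 43` are written. -/
def fillRow : Cmd :=
  maskRow ;; 47 ::= R[13] +ₑ R[43] *ₑ R[12] ;;
  .for 44 23 (.ite (A[1, R[22] +ₑ R[44]] &ₑ R[45]) (.store 11 (R[47] +ₑ R[44]) K[1])
    (.ite (R[43] <ₑ R[9]) .skip (.store 11 (R[47] +ₑ R[44]) K[2])))

theorem div_mod_eq {d i j r : ℕ} (hr : r < d) : i = j * d + r ↔ i / d = j ∧ i % d = r := by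
  constructor
  · rintro rfl
    rw [mul_comm, Nat.mul_add_div (by omega), Nat.mul_add_mod, Nat.div_eq_of_lt hr,
      Nat.mod_eq_of_lt hr]
    simp
  · rintro ⟨rfl, rfl⟩
    rw [mul_comm, Nat.div_add_mod]

/-- The memory is new, so entries 0, among them all padding coordinates, need not be written; the
time depends on `fl` and not on `d`. -/
theorem fillRow_spec {W nv g S T₀ ρ j base fp fl d : ℕ} {X : ℕ → ℕ} {s : State}
    (hc : Const nv g S T₀ s)
    (hj : s.reg 43 = j) (hj' : j < 2 * 2 ^ g) (hρ : s.reg 17 = ρ) (hρ' : ρ < 2 ^ (nv - 2 * g))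
    (hg : 2 * g ≤ nv) (hW : 2 ^ (2 * nv) ≤ W) (hb : s.reg 13 = base)
    (hbW : base + 2 * 2 ^ g * (d + 1) ≤ W) (hfp : s.reg 22 = fp) (hfl : s.reg 23 = fl)
    (hfW : fp + fl ≤ W) (hd : s.reg 12 = d) (hfd : fl ≤ d)
    (hX : ∀ r < fl, s.mem 1 (fp + r) = X r)
    (h11 : ∀ i, s.mem 11 (base + i) =
      if i / d < j then (entry X fl (mask nv g ρ) (2 ^ g) (i / d) (i % d) : ℕ) else 0)
    (h12 : ∀ i, s.mem 12 (base + i) = if 2 ^ g ≤ i ∧ i < j then 1 else 0) :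
    wp W fillRow s fun t s' => t ≤ fl * 30 + 80 ∧
      (∀ i, s'.mem 11 (base + i) =
        if i / d < j + 1 then (entry X fl (mask nv g ρ) (2 ^ g) (i / d) (i % d) : ℕ) else 0) ∧
      ∀ i, s'.mem 12 (base + i) = if 2 ^ g ≤ i ∧ i < j + 1 then 1 else 0 := by
  have hpos : 0 < 2 ^ g := by positivity
  have hjd : j * d + d ≤ 2 * 2 ^ g * d := by
    rw [← Nat.succ_mul]; exact Nat.mul_le_mul_right _ hj'
  have hsum : 2 * 2 ^ g * (d + 1) = 2 * 2 ^ g * d + 2 * 2 ^ g := by ring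
  rw [fillRow, wp_seq]
  refine (maskRow_spec hc hj hj' hρ hρ' hg hW hb (by omega)).mono fun t₁ s₁ f₁ ⟨p1, p2, p3⟩ => ?_
  have e43 : s₁.reg 43 = j := by rw [f₁.1 43 (by simp [maskRow]), hj]
  have e13 : s₁.reg 13 = base := by rw [f₁.1 13 (by simp [maskRow]), hb]
  have e12 : s₁.reg 12 = d := by rw [f₁.1 12 (by simp [maskRow]), hd]
  have e9 : s₁.reg 9 = 2 ^ g := by rw [f₁.1 9 (by simp [maskRow]), hc.reg9]
  have e22 : s₁.reg 22 = fp := by rw [f₁.1 22 (by simp [maskRow]), hfp]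
  have e23 : s₁.reg 23 = fl := by rw [f₁.1 23 (by simp [maskRow]), hfl]
  have em1 := f₁.2 1 (by simp [maskRow])
  have em11 := f₁.2 11 (by simp [maskRow])
  rw [wp_seq, wp_set]
  refine ⟨⟨trivial, ⟨trivial, trivial, ?_⟩, ?_⟩, ?_⟩
  · simp only [BinOp.Fits, Expr.eval, e43, e12]; omega
  · simp only [BinOp.Fits, Expr.eval, BinOp.eval, e43, e12, e13]; omega
  simp only [Expr.eval, BinOp.eval, e43, e12, e13]
  refine (wp_for (n := fl) (T := 20) (fun r s' => ∀ i, s'.mem 11 (base + i) =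
    if i / d < j ∨ i / d = j ∧ i % d < r then
      (entry X fl (mask nv g ρ) (2 ^ g) (i / d) (i % d) : ℕ) else 0)
    (by simp [e23]) (by omega) (by omega) (by simp) (by simp) (by simp) ?_ ?_).mono ?_
  · intro i
    simp [em11, h11]
  · rintro r s' hr hrr hf hI
    have k43 : s'.reg 43 = j := by rw [hf.1 43 (by simp)]; simp [e43]
    have k47 : s'.reg 47 = base + j * d := by rw [hf.1 47 (by simp)]; simp
    have k9 : s'.reg 9 = 2 ^ g := by rw [hf.1 9 (by simp)]; simp [e9]
    have k45 : s'.reg 45 = mask nv g ρ j := by rw [hf.1 45 (by simp)]; simp [p2]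
    have k22 : s'.reg 22 = fp := by rw [hf.1 22 (by simp)]; simp [e22]
    have k1 : s'.mem 1 (fp + r) = X r := by rw [hf.2 1 (by simp)]; simp [em1, hX r hr]
    have hupd : ∀ v i, (entry X fl (mask nv g ρ) (2 ^ g) j r : ℕ) = v →
        (s'.setMem 11 (base + j * d + r) v).mem 11 (base + i) =
          if i / d < j ∨ i / d = j ∧ i % d < r + 1 then
            (entry X fl (mask nv g ρ) (2 ^ g) (i / d) (i % d) : ℕ) else 0 := by
      intro v i hv
      have hdm := div_mod_eq (i := i) (j := j) (hr.trans_le hfd)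
      rw [State.setMem_mem_apply]
      by_cases h : i = j * d + r
      · rw [if_pos ⟨rfl, by omega⟩]
        obtain ⟨h1, h2⟩ := hdm.1 h
        rw [if_pos (Or.inr ⟨h1, by omega⟩), h1, h2, hv]
      · rw [if_neg (by omega), hI]
        refine if_congr ?_ rfl rfl
        have : ¬ (i / d = j ∧ i % d = r) := fun h' => h (hdm.2 h')
        omega
    have hent : (entry X fl (mask nv g ρ) (2 ^ g) j r : ℕ) =
        if X r &&& mask nv g ρ j ≠ 0 then 1 else if j < 2 ^ g then 0 else 2 := by
      simp only [entry, hr, if_true]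
      split_ifs <;> rfl
    simp only [wp_seq, wp_set, wp_ite, wp_store, wp_skip, Expr.eval, Expr.Ok, Expr.cost,
      BinOp.eval, BinOp.Fits, State.setReg_reg, State.setReg_mem, State.setMem_reg,
      Nat.reduceEqDiff, if_true, if_false, ind_and, ind_not, ind_eq_zero, ind_ne_zero,
      true_and, and_true, k43, k47, k9, k45, k22, hrr, k1]
    refine ⟨by omega, fun h => ⟨by omega, by omega, by omega, ?_⟩,
      fun h => ⟨fun h' => ⟨by omega, fun i => ?_⟩, fun h' => ⟨by omega, by omega, by omega, ?_⟩⟩⟩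
    · exact fun i => hupd 1 i (by rw [hent, if_pos h])
    · have h0 : (entry X fl (mask nv g ρ) (2 ^ g) j r : ℕ) = 0 := by
        rw [hent, if_neg (by simpa using h), if_pos h']
      rw [hI]
      have hdm := div_mod_eq (i := i) (j := j) (hr.trans_le hfd)
      by_cases h2 : i / d = j ∧ i % d = r
      · rw [if_neg (by omega), if_pos (Or.inr ⟨h2.1, by omega⟩), h2.1, h2.2, h0]
      · refine if_congr ?_ rfl rfl
        omega
    · exact fun i => hupd 2 i (by rw [hent, if_neg (by simpa using h), if_neg h'])
  · rintro t s' hf ⟨h1, h2⟩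
    refine ⟨?_, fun i => ?_, fun i => ?_⟩
    · simp only [Expr.cost]; omega
    · rw [h2]
      by_cases hij : i / d = j
      · simp only [hij, lt_irrefl, true_and, false_or, Nat.lt_succ_self, if_true]
        split_ifs with h
        · rfl
        · simp [entry, h]
      · refine if_congr ?_ rfl rfl
        omega
    · rw [hf.2 12 (by simp)]
      simp only [State.setReg_mem, p3, h12]
      split_ifs <;> first | rfl | omega

/-- The points and the vector are written. -/
def fill : Cmd := .for 43 5 fillRow

theorem fill_spec {W nv g S T₀ ρ base fp fl d : ℕ} {X : ℕ → ℕ} {s : State}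
    (hc : Const nv g S T₀ s) (hρ : s.reg 17 = ρ) (hρ' : ρ < 2 ^ (nv - 2 * g))
    (hg : 2 * g ≤ nv) (hW : 2 ^ (2 * nv) ≤ W) (hb : s.reg 13 = base)
    (hbW : base + 2 * 2 ^ g * (d + 1) ≤ W) (hfp : s.reg 22 = fp) (hfl : s.reg 23 = fl)
    (hfW : fp + fl ≤ W) (hd : s.reg 12 = d) (hfd : fl ≤ d)
    (hX : ∀ r < fl, s.mem 1 (fp + r) = X r)
    (h11 : ∀ i, s.mem 11 (base + i) = 0) (h12 : ∀ i, s.mem 12 (base + i) = 0) :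
    wp W fill s fun t s' => t ≤ 2 * 2 ^ g * (fl * 30 + 90) + 10 ∧
      (∀ i, s'.mem 11 (base + i) =
        (matVecInput (gadget X fl (mask nv g ρ) (2 ^ g) (2 * 2 ^ g) d)
          (gadgetVec (2 ^ g) (2 * 2 ^ g))).mem 0 i) ∧
      ∀ i, s'.mem 12 (base + i) =
        (matVecInput (gadget X fl (mask nv g ρ) (2 ^ g) (2 * 2 ^ g) d)
          (gadgetVec (2 ^ g) (2 * 2 ^ g))).mem 1 i := by
  have hpos : 0 < 2 ^ g := by positivity
  have hsum : 2 * 2 ^ g * (d + 1) = 2 * 2 ^ g * d + 2 * 2 ^ g := by ring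
  refine (wp_for (n := 2 * 2 ^ g) (T := fl * 30 + 80) (fun j s' => (∀ i, s'.mem 11 (base + i) =
        if i / d < j then (entry X fl (mask nv g ρ) (2 ^ g) (i / d) (i % d) : ℕ) else 0) ∧
      ∀ i, s'.mem 12 (base + i) = if 2 ^ g ≤ i ∧ i < j then 1 else 0)
    hc.reg5 (by omega) (by omega) (by simp [fillRow, maskRow]) (by simp [fillRow, maskRow])
    (by simp) ?_ ?_).mono ?_
  · simp [h11, h12]
  · rintro j s' hj hjj hf ⟨hI, hI'⟩
    refine (fillRow_spec (S := S) (T₀ := T₀) (X := X) (fp := fp) (fl := fl) (hc.congr ?_) hjj hj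
      (ρ := ρ) ?_ hρ' hg hW ?_ hbW ?_ ?_ hfW ?_ hfd ?_ hI hI').mono fun t s₂ _ h => h
    · intro r hr
      refine hf.1 r fun h => ?_
      simp [fillRow, maskRow] at h hr
      omega
    · rw [hf.1 17 (by simp [fillRow, maskRow]), hρ]
    · rw [hf.1 13 (by simp [fillRow, maskRow]), hb]
    · rw [hf.1 22 (by simp [fillRow, maskRow]), hfp]
    · rw [hf.1 23 (by simp [fillRow, maskRow]), hfl]
    · rw [hf.1 12 (by simp [fillRow, maskRow]), hd]
    · rw [hf.2 1 (by simp [fillRow, maskRow])]; exact hX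
  · rintro t s' - ⟨h1, h2, h3⟩
    refine ⟨?_, fun i => ?_, fun i => ?_⟩
    · refine h1.trans ?_
      have : 2 * 2 ^ g * (fl * 30 + 80 + 8) ≤ 2 * 2 ^ g * (fl * 30 + 90) :=
        Nat.mul_le_mul_left _ (by omega)
      omega
    · rw [h2, matVecInput_mem_zero]
      by_cases h0 : 0 < d
      · split_ifs with h4 h5 h5
        · rfl
        · exact absurd ⟨h4, h0⟩ h5
        · exact absurd h5.1 h4
        · rfl
      -- In dimension 0 all quotients `i / 0` are 0, but there are no clauses either, so every entry
      -- vanishes.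
      · obtain rfl : fl = 0 := by omega
        simp [h0, entry]
    · rw [h3]
      simp only [matVecInput, gadgetVec]
      split_ifs <;> first | rfl | omega

end WordRAM

/-! ### One clocked call in new memory -/

namespace WordRAM

open Sparsify


/-- The simulated memory is unused from address `b` on. -/
def Fresh (b : ℕ) (s : State) : Prop := ∀ a i, 10 ≤ a → b ≤ i → s.mem a i = 0

/-- The program computes matrix-vector products, with an explicit exponent for the word size. -/
def Computes (C : ℕ) (P : Prog) (D T : ℕ → ℕ) : Prop :=
  ∀ n d : ℕ, d ≤ D n → ∀ (x : Fin n → Fin d → Fin 3) (z : Fin n → Fin 2), ∃ (t : ℕ) (s : State),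
    Exec ((n + d + 2) ^ C) P (matVecInput x z) t s ∧ (d = D n → t ≤ T n) ∧
    ∀ i : Fin n, (s.mem 2 i : ℝ) =
      (linftyDistMatrix (fun i j => ((x i j : ℕ) : ℝ))).mulVec (fun j => ((z j : ℕ) : ℝ)) i

/-- The relation between the sizes of the parameters. -/
structure Sizes (W nv g S T₀ C : ℕ) (P : Prog) (D T : ℕ → ℕ) : Prop where
  computes : Computes C P D T
  one_le : 1 ≤ C
  g_le : 2 * g ≤ nv
  word : 2 ^ (2 * nv) ≤ W
  below : P.Below S
  sim : (2 * 2 ^ g + D (2 * 2 ^ g) + 2) ^ C < S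
  fill : 2 * 2 ^ g * (D (2 * 2 ^ g) + 1) ≤ S
  fuel : T (2 * 2 ^ g) < T₀
  fuel_le : T₀ ≤ W

/-- One simulated call of the program, in new memory. -/
def attempt (P : Prog) : Cmd :=
  13 ::= R[13] +ₑ R[6] ;; .store 10 R[13] R[5] ;; .store 10 (R[13] +ₑ K[1]) R[12] ;; fill ;;
  18 ::= R[7] ;; P.sim 18 13

theorem attempt_wregs (P : Prog) : ∀ r ∈ (attempt P).wregs, r ∈ [13, 18, 43, 44, 45, 46, 47] := by
  intro r hr
  have := P.sim_wregs 18 13 r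
  simp [attempt, fill, fillRow, maskRow] at hr ⊢
  tauto

theorem attempt_warrs (P : Prog) : ∀ a ∈ (attempt P).warrs, 10 ≤ a := by
  intro r hr
  have := P.sim_warrs 18 13 r
  simp [attempt, fill, fillRow, maskRow] at hr
  by_cases h : r ∈ (P.sim 18 13).warrs
  · exact this h
  · simp only [h, or_false] at hr
    omega

/-- The time for one attempt on at most `l` clauses. -/
def callCost (P : Prog) (g l T₀ : ℕ) : ℕ :=
  2 * 2 ^ g * (l * 30 + 150) + P.simCost * (T₀ + 1) + 200

/-- The block number `ρ` of the output has been computed. -/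
def Done (X : ℕ → ℕ) (fl nv g ρ : ℕ) (s : State) : Prop :=
  ∀ u < 2 ^ g, s.mem 13 (s.reg 13 + u) < 2 * 2 ^ g ↔
    ∃ v < 2 ^ g, ∀ r < fl, X r &&& mask nv g ρ u ≠ 0 ∨ X r &&& mask nv g ρ (2 ^ g + v) ≠ 0

/-- If fuel is left, the call was completed, and `gadget_mulVec_lt` interprets its output. In
dimension `D (2 * 2 ^ g)` fewer than `T₀` steps are needed, so running out of fuel proves that `d`
is smaller. The region of length `S` was never touched, which provides the zeros that the initial
configuration demands. -/
theorem attempt_spec {W nv g S T₀ C ρ base fp fl l d : ℕ} {X : ℕ → ℕ} {P : Prog} {D T : ℕ → ℕ}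
    {s : State} (hz : Sizes W nv g S T₀ C P D T) (hc : Const nv g S T₀ s) (hρ : s.reg 17 = ρ)
    (hρ' : ρ < 2 ^ (nv - 2 * g)) (hb : s.reg 13 = base) (hbW : base + 2 * S ≤ W)
    (hfp : s.reg 22 = fp) (hfl : s.reg 23 = fl) (hfW : fp + fl ≤ W) (hd : s.reg 12 = d)
    (hfd : fl ≤ d) (hl : fl ≤ l) (hdD : d ≤ D (2 * 2 ^ g)) (hX : ∀ r < fl, s.mem 1 (fp + r) = X r)
    (hfr : Fresh (base + S) s) :
    wp W (attempt P) s fun t s' => t + 40 + 2 ^ g * 50 ≤ callCost P g l T₀ ∧ s'.reg 13 = base + S ∧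
      Fresh (base + S + S) s' ∧ (s'.reg 18 = 0 → d < D (2 * 2 ^ g)) ∧
      (s'.reg 18 ≠ 0 → Done X fl nv g ρ s') := by
  have hSd : 2 * 2 ^ g * (d + 1) ≤ S := (Nat.mul_le_mul_left _ (by omega)).trans hz.fill
  have hS1 : 1 < S := by
    have := hz.sim
    have : 0 < (2 * 2 ^ g + D (2 * 2 ^ g) + 2) ^ C := by positivity
    omega
  rw [attempt]
  rw [wp_seq, wp_set, wp_seq, wp_store, wp_seq, wp_store]
  simp only [Expr.eval, Expr.Ok, Expr.cost, BinOp.eval, BinOp.Fits, State.setReg_reg,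
    State.setMem_reg, if_true, if_false, Nat.reduceEqDiff, true_and, hb, hc.reg6, hc.reg5, hd]
  refine ⟨by omega, ⟨by omega, by omega⟩, ?_⟩
  rw [wp_seq]
  refine (fill_spec (base := base + S) (X := X) (fp := fp) (fl := fl) (d := d) (ρ := ρ)
    (hc.congr ?_) ?_ hρ' hz.g_le hz.word ?_ ?_ ?_ ?_ hfW ?_ hfd ?_ ?_ ?_).mono
    fun t s₁ f₁ ⟨p1, p2, p3⟩ => ?_
  · intro r hr
    have : r ≠ 13 := by rintro rfl; simp at hr
    simp [this]
  · simp [hρ]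
  · simp
  · omega
  · simp [hfp]
  · simp [hfl]
  · simp [hd]
  · intro r hr; simp [State.setMem_mem, hX r hr]
  · intro i; simp [State.setMem_mem, hfr 11 _ (by omega) (Nat.le_add_right (base + S) i)]
  · intro i; simp [State.setMem_mem, hfr 12 _ (by omega) (Nat.le_add_right (base + S) i)]
  have e7 : s₁.reg 7 = T₀ := by
    rw [f₁.1 7 (by simp [fill, fillRow, maskRow])]; simp [hc.reg7]
  have e13 : s₁.reg 13 = base + S := by rw [f₁.1 13 (by simp [fill, fillRow, maskRow])]; simp
  have hm : ∀ a, a ≠ 11 → a ≠ 12 → a ≠ 10 → s₁.mem a = s.mem a := by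
    intro a h1 h2 h3
    rw [f₁.2 a (by simp [fill, fillRow, maskRow]; omega)]
    simp [State.setMem_mem, h3]
  have hm10 := f₁.2 10 (by simp [fill, fillRow, maskRow])
  set x := gadget X fl (mask nv g ρ) (2 ^ g) (2 * 2 ^ g) d with hx
  set z := gadgetVec (2 ^ g) (2 * 2 ^ g) with hzz
  rw [wp_seq, wp_set]
  refine ⟨trivial, ?_⟩
  simp only [Expr.eval, Expr.cost, e7]
  obtain ⟨t', s', he, ht', hout⟩ := hz.computes (2 * 2 ^ g) d hdD x z
  have hW0 : (2 * 2 ^ g + d + 2) ^ C < S :=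
    lt_of_le_of_lt (Nat.pow_le_pow_left (by omega) _) hz.sim
  -- The exponent is at least 1, so the input itself consists of words of the simulated machine.
  have hW1 : 2 * 2 ^ g + d + 2 ≤ (2 * 2 ^ g + d + 2) ^ C :=
    Nat.le_self_pow (by have := hz.one_le; omega) _
  have hbd : (matVecInput x z).Bounded ((2 * 2 ^ g + d + 2) ^ C) := by
    refine ⟨fun r => ?_, fun a i => ?_⟩
    · rcases r with _ | _ | r <;> simp only [matVecInput] <;> omega
    · rcases a with _ | _ | a
      · rw [matVecInput_mem_zero]
        split_ifs
        · have := (x ⟨i / d, by tauto⟩ ⟨i % d, Nat.mod_lt _ (by tauto)⟩).2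
          omega
        · omega
      · simp only [matVecInput]
        split_ifs
        · have := (z ⟨i, by assumption⟩).2
          omega
        · omega
      · simp [matVecInput]
  have hR : Prog.Rel (base + S) (matVecInput x z) (s₁.setReg 18 T₀) := by
    refine ⟨fun r => ?_, fun a i => ?_⟩
    · have h0 : s.mem 10 (base + S + r) = 0 := hfr 10 _ (by omega) (by omega)
      rw [State.setReg_mem, hm10, State.setMem_mem_apply, State.setMem_mem_apply]
      rcases r with _ | _ | r
      · simp [matVecInput]
      · simp [matVecInput]
      · rw [if_neg (by omega), if_neg (by omega), State.setReg_mem, h0]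
        simp [matVecInput]
    · rw [State.setReg_mem]
      rcases a with _ | _ | a
      · exact p2 i
      · exact p3 i
      · rw [hm (a + 1 + 1 + 11) (by omega) (by omega) (by omega),
          hfr (a + 1 + 1 + 11) _ (by omega) (by omega)]
        simp [matVecInput]
  refine (Prog.sim_exec (fu := 18) (ba := 13) (base := base + S) (B := S) (by simp) hW0 (by omega)
      he
    hz.below hbd (by simp [e13]) hR).mono fun t₂ s₂ f₂ ⟨q1, q2, q3, q4⟩ => ?_
  have e13' : s₂.reg 13 = base + S := by
    rw [f₂.1 13 fun h => by simpa using P.sim_wregs 18 13 _ h]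
    simp [e13]
  simp only [State.setReg_reg, if_true] at q1 q2 q4
  refine ⟨?_, e13', fun a i ha hi => ?_, fun h => ?_, fun h => ?_⟩
  · have h1 : P.simCost * (T₀ - s₂.reg 18 + 1) ≤ P.simCost * (T₀ + 1) :=
      Nat.mul_le_mul_left _ (by omega)
    have h2 : 2 * 2 ^ g * (fl * 30 + 90) ≤ 2 * 2 ^ g * (l * 30 + 90) :=
      Nat.mul_le_mul_left _ (by omega)
    have h3 : 2 * 2 ^ g * (l * 30 + 150) = 2 * 2 ^ g * (l * 30 + 90) + 120 * 2 ^ g := by ring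
    rw [callCost, h3]
    omega
  · rw [q3 a i hi, State.setReg_mem]
    obtain ⟨i, rfl⟩ : ∃ j, i = base + S + j := ⟨i - (base + S), by omega⟩
    have hi' : S ≤ i := by omega
    rcases eq_or_ne a 11 with rfl | h11
    · rw [p2, matVecInput_mem_zero, dif_neg]
      rintro ⟨h1, h2⟩
      rw [Nat.div_lt_iff_lt_mul h2] at h1
      have := Nat.mul_le_mul_left (2 * 2 ^ g) (Nat.le_succ d)
      simp only [Nat.succ_eq_add_one] at this
      omega
    rcases eq_or_ne a 12 with rfl | h12
    · rw [p3]
      simp only [matVecInput]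
      rw [dif_neg]
      intro h1
      have := Nat.le_mul_of_pos_right (2 * 2 ^ g) (Nat.succ_pos d)
      simp only [Nat.succ_eq_add_one] at this
      omega
    rcases eq_or_ne a 10 with rfl | h10
    · rw [hm10, State.setMem_mem_apply, State.setMem_mem_apply, if_neg (by omega),
        if_neg (by omega), State.setReg_mem]
      exact hfr _ _ (by omega) (by omega)
    · rw [hm a h11 h12 h10]
      exact hfr _ _ (by omega) (by omega)
  · have : T₀ ≤ t' := by omega
    have := hz.fuel
    rcases hdD.lt_or_eq with h' | h'
    · exact h'
    · have := ht' h'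
      omega
  · intro u hu
    rw [e13', (q4 (by omega)).2 2 u, ← gadget_mulVec_lt (X := X) (M := mask nv g ρ) hfd
      (u := ⟨u, by omega⟩) hu, ← Nat.cast_lt (α := ℝ)]
    exact iff_of_eq (congrArg (· < _) (hout ⟨u, by omega⟩))

end WordRAM

/-! ### Search for the dimension, and evaluation of a leaf -/

namespace WordRAM

open Sparsify


/-- A call that is not finished in time is repeated in the next dimension. -/
def retryBody (P : Prog) : Cmd := attempt P ;; .ite R[18] .skip (12 ::= R[12] +ₑ K[1])

/-- Calls until one is finished in time. -/
def retry (P : Prog) : Cmd := 18 ::= K[0] ;; .while (R[18] =ₑ K[0]) (retryBody P)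

theorem retryBody_wregs (P : Prog) :
    ∀ r ∈ (retryBody P).wregs, r ∈ [12, 13, 18, 43, 44, 45, 46, 47] := by
  intro r hr
  have := attempt_wregs P r
  simp [retryBody] at hr this ⊢
  tauto

theorem retry_wregs (P : Prog) : ∀ r ∈ (retry P).wregs, r ∈ [12, 13, 18, 43, 44, 45, 46, 47] := by
  intro r hr
  simp only [retry, Cmd.wregs, List.mem_append, List.mem_cons, List.not_mem_nil, or_false] at hr
  rcases hr with h | h
  · simp [h]
  · exact retryBody_wregs P r h

theorem retryBody_warrs (P : Prog) : ∀ a ∈ (retryBody P).warrs, 10 ≤ a := by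
  intro r hr
  have := attempt_warrs P r
  simp [retryBody] at hr
  exact this hr

theorem Fresh.setReg {b r v : ℕ} {s : State} (h : Fresh b s) : Fresh b (s.setReg r v) := h

/-- The number `a` counts the failed calls. Each of them shows that the dimension was too small, so
the loop ends at the latest in dimension `D (2 * 2 ^ g)`. The term `2 ^ g * 50` reserves time for
the subsequent `check`. -/
theorem retry_spec {W nv g S T₀ C ρ base fp fl l d : ℕ} {X : ℕ → ℕ} {P : Prog} {D T : ℕ → ℕ}
    {s : State} (hz : Sizes W nv g S T₀ C P D T) (hc : Const nv g S T₀ s) (hρ : s.reg 17 = ρ)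
    (hρ' : ρ < 2 ^ (nv - 2 * g)) (hb : s.reg 13 = base)
    (hbW : base + (D (2 * 2 ^ g) - d + 2) * S ≤ W)
    (hfp : s.reg 22 = fp) (hfl : s.reg 23 = fl) (hfW : fp + fl ≤ W) (hd : s.reg 12 = d)
    (hfd : fl ≤ d) (hl : fl ≤ l) (hdD : d ≤ D (2 * 2 ^ g)) (hX : ∀ r < fl, s.mem 1 (fp + r) = X r)
    (hfr : Fresh (base + S) s) :
    wp W (retry P) s fun t s' => ∃ a, t + 2 ^ g * 50 ≤ (a + 1) * callCost P g l T₀ ∧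
      s'.reg 13 = base + (a + 1) * S ∧ s'.reg 12 = d + a ∧ d + a ≤ D (2 * 2 ^ g) ∧
      Fresh (s'.reg 13 + S) s' ∧ Done X fl nv g ρ s' := by
  set Dm := D (2 * 2 ^ g) with hDm
  set Tc := callCost P g l T₀ - 2 ^ g * 50 - 20 with hTc
  have hTc' : Tc + 2 ^ g * 50 + 20 ≤ callCost P g l T₀ := by
    have : 2 ^ g * 50 + 20 ≤ callCost P g l T₀ := by
      have h3 : 2 * 2 ^ g * (l * 30 + 150) = 2 * 2 ^ g * (l * 30) + 300 * 2 ^ g := by ring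
      rw [callCost, h3]
      omega
    omega
  have hSf := hz.fill
  have hS : Dm + 1 ≤ S := by
    refine le_trans ?_ hSf
    exact Nat.le_mul_of_pos_left _ (by positivity)
  have hDW : Dm + 1 ≤ W := by
    have h1 : 2 * S ≤ (Dm - d + 2) * S := Nat.mul_le_mul_right _ (by omega)
    omega
  rw [retry, wp_seq, wp_set]
  refine ⟨Nat.zero_le _, ?_⟩
  -- Before a success the credit covers one call for each remaining dimension, including the current
  -- one; the successful call uses the share of the current dimension.
  refine (wp_while (fun s' p => ∃ a, Frame (retryBody P) (s.setReg 18 0) s' ∧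
    s'.reg 12 = d + a ∧ d + a ≤ Dm ∧ Fresh (s'.reg 13 + S) s' ∧
    ((s'.reg 18 = 0 ∧ s'.reg 13 = base + a * S ∧ p = (Dm - (d + a) + 1) * Tc) ∨
      (s'.reg 18 ≠ 0 ∧ s'.reg 13 = base + (a + 1) * S ∧ p = (Dm - (d + a)) * Tc ∧
        Done X fl nv g ρ s')))
    (fun s p _ => by simp) ?_ (p := (Dm - d + 1) * Tc)
    ⟨0, Frame.refl _ _, by simp [hd], by omega, by simpa [hb] using hfr.setReg,
      Or.inl ⟨by simp, by simp [hb], rfl⟩⟩).mono ?_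
  · rintro s' p ⟨a, hf, h12, ha, hfr', h⟩ he
    have h18 : s'.reg 18 = 0 := by
      by_contra hcon
      simp [hcon] at he
    obtain ⟨-, h13, rfl⟩ := h.resolve_right fun h' => h'.1 h18
    have hr : ∀ r, r ∉ [12, 13, 18, 43, 44, 45, 46, 47] → s'.reg r = s.reg r := by
      intro r hr
      rw [hf.1 r fun h => hr (retryBody_wregs P r h), State.setReg_reg, if_neg]
      rintro rfl
      simp at hr
    have hm1 : s'.mem 1 = s.mem 1 := hf.2 1 fun h => by simpa using retryBody_warrs P 1 h
    rw [retryBody, wp_seq]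
    have hbW' : base + a * S + 2 * S ≤ W := by
      have h1 : (a + 2) * S ≤ (Dm - d + 2) * S := Nat.mul_le_mul_right _ (by omega)
      rw [add_mul] at h1
      omega
    refine (attempt_spec (ρ := ρ) (base := base + a * S) (fp := fp) (fl := fl) (l := l) (d := d + a)
      (X := X) hz (hc.congr fun r h => hr r ?_) ?_ hρ' h13 hbW' ?_ ?_ hfW h12 (by omega) hl ha
      ?_ ?_).mono ?_
    · simp at h ⊢; omega
    · rw [hr 17 (by simp), hρ]
    · rw [hr 22 (by simp), hfp]
    · rw [hr 23 (by simp), hfl]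
    · rwa [hm1]
    · rwa [← h13]
    rintro t₁ s₁ f₁ ⟨p1, p2, p3, p4, p5⟩
    have e12 : s₁.reg 12 = d + a := by
      rw [f₁.1 12 fun h => by simpa using attempt_wregs P 12 h, h12]
    have hf1 : Frame (retryBody P) (s.setReg 18 0) s₁ :=
      hf.trans (f₁.mono (by simp [retryBody]) (by simp [retryBody]))
    have hbase : base + a * S + S = base + (a + 1) * S := by ring
    simp only [wp_seq, wp_set, wp_ite, wp_store, wp_skip, Expr.eval, Expr.Ok, Expr.cost,
      BinOp.eval, BinOp.Fits, State.setReg_reg, State.setReg_mem, State.setMem_reg,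
      Nat.reduceEqDiff, if_true, if_false, ind_and, ind_not, ind_eq_zero, ind_ne_zero,
      true_and, and_true, e12]
    refine ⟨fun h => ⟨(Dm - (d + a)) * Tc, ⟨a, hf1, rfl, ha, ?_, Or.inr ⟨h, ?_, rfl, p5 h⟩⟩, ?_⟩,
      fun h => ⟨⟨by omega, by omega⟩, (Dm - (d + a)) * Tc, ⟨a + 1, hf1.trans ⟨fun r hr => ?_,
        fun _ _ => rfl⟩, ?_, p4 h, ?_, Or.inl ⟨by simp [h], ?_, ?_⟩⟩, ?_⟩⟩
    · rwa [p2]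
    · rw [p2, hbase]
    · rw [show Dm - (d + a) + 1 = (Dm - (d + a)) + 1 by omega, add_mul, one_mul]
      omega
    · have : r ≠ 12 := by rintro rfl; simp [retryBody] at hr
      simp [this]
    · simp [add_assoc]
    · rw [p2]; exact p3
    · simp [p2, hbase]
    · have := p4 h
      rw [show Dm - (d + a) = Dm - (d + (a + 1)) + 1 by omega]
    · have := p4 h
      rw [add_mul, one_mul]
      omega
  · rintro t s' - ⟨p, ⟨a, hf, h12, ha, hfr', h⟩, he, ht⟩
    have h18 : s'.reg 18 ≠ 0 := by
      intro hcon
      simp [hcon] at he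
    obtain ⟨-, h13, rfl, hdone⟩ := h.resolve_left fun h' => h18 h'.1
    refine ⟨a, ?_, h13, h12, ha, hfr', hdone⟩
    have h1 : (Dm - d + 1) * Tc = (Dm - (d + a)) * Tc + (a + 1) * Tc := by
      rw [← add_mul]; congr 1; omega
    have h2 : (a + 1) * (Tc + 2 ^ g * 50 + 20) ≤ (a + 1) * callCost P g l T₀ :=
      Nat.mul_le_mul_left _ hTc'
    have h3 : (a + 1) * (Tc + 2 ^ g * 50 + 20) =
      (a + 1) * Tc + (a * (2 ^ g * 50 + 20) + (2 ^ g * 50 + 20)) := by ring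
    simp only [Expr.cost] at ht ⊢
    omega

/-- The formula is satisfied by some assignment. -/
def SatMasks (nv g : ℕ) (F : Finset (Finset ℕ)) : Prop :=
  ∃ u < 2 ^ g, ∃ w < 2 ^ (nv - g), Hits F (bits (rowMask nv g u) ∪ bits (colMask nv g w))

/-- Division of the second assignment by `2 ^ g` gives the block as quotient and the column as
remainder. -/
theorem satMasks_iff_exists_block {nv g fp fl : ℕ} {f : ℕ → ℕ} (hg : 2 * g ≤ nv) :
    SatMasks nv g (fam (seg f fp fl)) ↔ ∃ ρ < 2 ^ (nv - 2 * g), ∃ u < 2 ^ g, ∃ v < 2 ^ g,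
      ∀ r < fl, f (fp + r) &&& mask nv g ρ u ≠ 0 ∨ f (fp + r) &&& mask nv g ρ (2 ^ g + v) ≠ 0 := by
  have key : ∀ u < 2 ^ g, ∀ v ρ, Hits (fam (seg f fp fl))
      (bits (rowMask nv g u) ∪ bits (colMask nv g (v + 2 ^ g * ρ))) ↔
      ∀ r < fl, f (fp + r) &&& mask nv g ρ u ≠ 0 ∨ f (fp + r) &&& mask nv g ρ (2 ^ g + v) ≠ 0 := by
    intro u hu v ρ
    have h1 : mask nv g ρ u = rowMask nv g u := if_pos hu
    have h2 : mask nv g ρ (2 ^ g + v) = colMask nv g (v + 2 ^ g * ρ) := by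
      rw [mask, if_neg (by omega), Nat.add_sub_cancel_left]
    simp only [h1, h2, ne_eq, and_eq_zero_iff]
    constructor
    · intro h r hr
      have := h _ (mem_fam.2 ⟨_, mem_seg.2 ⟨r, hr, rfl⟩, rfl⟩)
      rw [Finset.disjoint_union_right] at this
      tauto
    · intro h C hC
      obtain ⟨x, hx, rfl⟩ := mem_fam.1 hC
      obtain ⟨r, hr, rfl⟩ := mem_seg.1 hx
      rw [Finset.disjoint_union_right]
      have := h r hr
      tauto
  have hpos : 0 < 2 ^ g := by positivity
  have hpow : 2 ^ (nv - g) = 2 ^ (nv - 2 * g) * 2 ^ g := by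
    rw [← pow_add]; congr 1; omega
  constructor
  · rintro ⟨u, hu, w, hw, h⟩
    refine ⟨w / 2 ^ g, (Nat.div_lt_iff_lt_mul hpos).2 (hpow ▸ hw), u, hu, w % 2 ^ g,
      Nat.mod_lt _ hpos, (key u hu _ _).1 ?_⟩
    rwa [Nat.mod_add_div]
  · rintro ⟨ρ, hρ, u, hu, v, hv, h⟩
    refine ⟨u, hu, v + 2 ^ g * ρ, ?_, (key u hu v ρ).2 h⟩
    have : 2 ^ g * (ρ + 1) ≤ 2 ^ g * 2 ^ (nv - 2 * g) := Nat.mul_le_mul_left _ hρ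
    rw [hpow, mul_comm (2 ^ (nv - 2 * g))]
    rw [mul_add] at this
    omega

/-- Examine the output of a call. -/
def check : Cmd := .for 43 9 (.ite (A[13, R[13] +ₑ R[43]] <ₑ R[5]) (11 ::= K[1]) .skip)

theorem check_spec {W g base : ℕ} {s : State} (h9 : s.reg 9 = 2 ^ g) (h5 : s.reg 5 = 2 * 2 ^ g)
    (hb : s.reg 13 = base) (hbW : base + 2 ^ g < W) (h11 : s.reg 11 ≤ 1) :
    wp W check s fun t s' => t ≤ 2 ^ g * 20 + 10 ∧ s'.reg 11 ≤ 1 ∧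
      (s'.reg 11 = 1 ↔ s.reg 11 = 1 ∨ ∃ u < 2 ^ g, s.mem 13 (base + u) < 2 * 2 ^ g) := by
  refine (wp_for (n := 2 ^ g) (T := 12) (fun j s' => s'.reg 11 ≤ 1 ∧
      (s'.reg 11 = 1 ↔ s.reg 11 = 1 ∨ ∃ u < j, s.mem 13 (base + u) < 2 * 2 ^ g))
    h9 (by omega) (by omega) (by simp) (by simp) (by simp) (by simp [h11]) ?_).mono ?_
  · rintro j s' hj hij hf ⟨h1, h2⟩
    have e13 : s'.reg 13 = base := by rw [hf.1 13 (by simp), hb]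
    have e5 : s'.reg 5 = 2 * 2 ^ g := by rw [hf.1 5 (by simp), h5]
    have em : s'.mem 13 = s.mem 13 := hf.2 13 (by simp)
    have hsucc : (∃ u < j + 1, s.mem 13 (base + u) < 2 * 2 ^ g) ↔
        (∃ u < j, s.mem 13 (base + u) < 2 * 2 ^ g) ∨ s.mem 13 (base + j) < 2 * 2 ^ g := by
      constructor
      · rintro ⟨u, hu, h⟩
        rcases Nat.lt_succ_iff_lt_or_eq.1 hu with h' | rfl
        exacts [Or.inl ⟨u, h', h⟩, Or.inr h]
      · rintro (⟨u, hu, h⟩ | h)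
        exacts [⟨u, by omega, h⟩, ⟨j, by omega, h⟩]
    simp only [wp_seq, wp_set, wp_ite, wp_store, wp_skip, Expr.eval, Expr.Ok, Expr.cost,
      BinOp.eval, BinOp.Fits, State.setReg_reg, State.setReg_mem, State.setMem_reg,
      Nat.reduceEqDiff, if_true, if_false, ind_and, ind_not, ind_eq_zero, ind_ne_zero,
      true_and, and_true, e13, e5, em, hij, hsucc]
    refine ⟨by omega, fun h => ⟨by omega, by omega, by omega, by simp [h]⟩, fun h =>
        ⟨by omega, h1, ?_⟩⟩
    rw [h2, or_iff_left h]
  · rintro t s' - ⟨h1, h2⟩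
    exact ⟨by omega, h2⟩

/-- All blocks of the current list. -/
def leaf (P : Prog) : Cmd := .for 17 16 (retry P ;; check)

theorem leafBody_wregs (P : Prog) :
    ∀ r ∈ (retry P ;; check).wregs, r ∈ [11, 12, 13, 18, 43, 44, 45, 46, 47] := by
  intro r hr
  have := retryBody_wregs P r
  simp [retry, check] at hr this ⊢
  tauto

theorem leafBody_warrs (P : Prog) : ∀ a ∈ (retry P ;; check).warrs, 10 ≤ a := by
  intro r hr
  have := retryBody_warrs P r
  simp [retry, check] at hr
  exact this hr

theorem leaf_wregs (P : Prog) :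
    ∀ r ∈ (leaf P).wregs, r ∈ [17, 11, 12, 13, 18, 43, 44, 45, 46, 47] := by
  intro r hr
  have := leafBody_wregs P r
  simp only [leaf, Cmd.for, Cmd.wregs, List.mem_append, List.mem_cons, List.not_mem_nil, or_false]
    at hr this ⊢
  rcases hr with h | h | h
  exacts [Or.inl h, Or.inr (this h), Or.inl h]

theorem leaf_warrs (P : Prog) : ∀ a ∈ (leaf P).warrs, 10 ≤ a := by
  intro r hr
  have := leafBody_warrs P r
  simp only [leaf, Cmd.for, Cmd.warrs, List.mem_append, List.not_mem_nil, or_false, false_or]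
    at hr this
  exact this hr

/-- The dimension is carried over from block to block, so failed calls enter the cost as a sum, not
as a factor per block. -/
theorem leaf_spec {W nv g S T₀ C base fp fl l d : ℕ} {P : Prog} {D T : ℕ → ℕ}
    {s : State} (hz : Sizes W nv g S T₀ C P D T) (hc : Const nv g S T₀ s) (hb : s.reg 13 = base)
    (hbW : base + (2 ^ (nv - 2 * g) + (D (2 * 2 ^ g) - d) + 2) * S ≤ W)
    (hfp : s.reg 22 = fp) (hfl : s.reg 23 = fl) (hfW : fp + fl ≤ W) (hd : s.reg 12 = d)
    (hfd : fl ≤ d) (hl : fl ≤ l) (hdD : d ≤ D (2 * 2 ^ g)) (hfr : Fresh (base + S) s)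
    (h11 : s.reg 11 ≤ 1) :
    wp W (leaf P) s fun t s' => ∃ a, t ≤ (2 ^ (nv - 2 * g) + a) * callCost P g l T₀ + 10 ∧
      s'.reg 13 = base + (2 ^ (nv - 2 * g) + a) * S ∧ s'.reg 12 = d + a ∧
      d + a ≤ D (2 * 2 ^ g) ∧ Fresh (s'.reg 13 + S) s' ∧ s'.reg 11 ≤ 1 ∧
      (s'.reg 11 = 1 ↔ s.reg 11 = 1 ∨ SatMasks nv g (fam (seg (s.mem 1) fp fl))) := by
  set Dm := D (2 * 2 ^ g) with hDm
  set M := 2 ^ (nv - 2 * g) with hM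
  set Tc := callCost P g l T₀ with hTc
  have hg1 : 0 < 2 ^ g := by positivity
  have hS : 1 ≤ S := by have := hz.sim; omega
  have hfill := hz.fill
  have hMW : M ≤ W := by
    refine le_trans ?_ hz.word
    exact Nat.pow_le_pow_right (by norm_num) (by omega)
  have hTc' : 8 ≤ Tc := by rw [hTc, callCost]; omega
  -- Each block contributes `Tc - 8`, as `wp_for_credit` adds 8 per round; each dimension that is
  -- still untried contributes one further call.
  refine (wp_for_credit (n := M) (p₀ := M * (Tc - 8) + (Dm - d) * Tc) (fun j s' p => ∃ a,
    s'.reg 13 = base + (j + a) * S ∧ s'.reg 12 = d + a ∧ d + a ≤ Dm ∧ Fresh (s'.reg 13 + S) s' ∧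
    s'.reg 11 ≤ 1 ∧ (s'.reg 11 = 1 ↔ s.reg 11 = 1 ∨ ∃ ρ < j, ∃ u < 2 ^ g, ∃ v < 2 ^ g, ∀ r < fl,
      s.mem 1 (fp + r) &&& mask nv g ρ u ≠ 0 ∨ s.mem 1 (fp + r) &&& mask nv g ρ (2 ^ g + v) ≠ 0) ∧
    p = (M - j) * (Tc - 8) + (Dm - (d + a)) * Tc)
    hc.reg16 hMW (Nat.one_le_two_pow.trans hMW) (fun h => by simpa using leafBody_wregs P _ h)
    (fun h => by simpa using leafBody_wregs P _ h) (by simp)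
    ⟨0, by simp [hb], by simp [hd], hdD, by simpa [hb] using hfr.setReg, by simpa,
      by simp, rfl⟩ ?_).mono ?_
  · rintro j s' p hj hjj hf ⟨a, h13, h12, ha, hfr', h11', hans, rfl⟩
    have hr : ∀ r, r ∉ [17, 11, 12, 13, 18, 43, 44, 45, 46, 47] → s'.reg r = s.reg r := by
      intro r hr
      exact hf.1 r fun h => hr (leaf_wregs P r h)
    have hm1 : s'.mem 1 = s.mem 1 := hf.2 1 fun h => by simpa using leaf_warrs P 1 h
    rw [wp_seq]
    have hbW1 : base + (j + a) * S + (Dm - (d + a) + 2) * S ≤ W := by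
      have h1 : (j + a + (Dm - (d + a) + 2)) * S ≤ (M + (Dm - d) + 2) * S :=
        Nat.mul_le_mul_right _ (by omega)
      rw [add_mul] at h1
      omega
    refine (retry_spec (ρ := j) (base := base + (j + a) * S) (fp := fp) (fl := fl) (l := l)
      (d := d + a) (X := fun r => s.mem 1 (fp + r)) hz (hc.congr fun r h => hr r ?_) hjj hj h13
      hbW1 ?_ ?_ hfW h12 (by omega) hl ha ?_ ?_).mono ?_
    · simp at h ⊢; omega
    · rw [hr 22 (by simp), hfp]
    · rw [hr 23 (by simp), hfl]
    · intro r _; rw [hm1]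
    · rwa [← h13]
    rintro t₁ s₁ f₁ ⟨a', p1, p2, p3, p4, p5, p6⟩
    have hw : ∀ r, r ∉ [12, 13, 18, 43, 44, 45, 46, 47] → s₁.reg r = s'.reg r := by
      intro r hr
      exact f₁.1 r fun h => hr (retry_wregs P r h)
    have hbW2 : base + (j + a) * S + (a' + 1) * S + 2 ^ g < W := by
      have h1 : (a' + 1 + 1) * S ≤ (Dm - (d + a) + 2) * S := Nat.mul_le_mul_right _ (by omega)
      rw [add_mul (a' + 1)] at h1
      have := Nat.mul_le_mul_left (2 * 2 ^ g) (Nat.succ_le_succ (Nat.zero_le (D (2 * 2 ^ g))))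
      simp only [Nat.succ_eq_add_one] at this
      omega
    refine (check_spec (g := g) (by rw [hw 9 (by simp), hr 9 (by simp), hc.reg9])
      (by rw [hw 5 (by simp), hr 5 (by simp), hc.reg5]) p2 hbW2
      (by rw [hw 11 (by simp)]; exact h11')).mono ?_
    rintro t₂ s₂ f₂ ⟨q1, q2, q3⟩
    have e13 : s₂.reg 13 = s₁.reg 13 := f₂.1 13 (by simp [check])
    have hb' : base + (j + a) * S + (a' + 1) * S = base + (j + 1 + (a + a')) * S := by ring
    refine ⟨(M - (j + 1)) * (Tc - 8) + (Dm - (d + a + a')) * Tc, ?_, a + a', ?_, ?_, by omega, ?_,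
        ?_,
      ?_, by rw [add_assoc d]⟩
    · have h1 : (M - j) * (Tc - 8) = (M - (j + 1)) * (Tc - 8) + (Tc - 8) := by
        rw [show M - j = M - (j + 1) + 1 by omega]; ring
      have h2 : (Dm - (d + a)) * Tc = (Dm - (d + a + a')) * Tc + a' * Tc := by
        rw [← add_mul]; congr 1; omega
      rw [add_mul, one_mul, ← hTc] at p1
      have h3 : t₁ + t₂ ≤ a' * Tc + (Tc - 8) := by omega
      omega
    · rw [State.setReg_reg, if_neg (by simp), e13, p2, hb']
    · rw [State.setReg_reg, if_neg (by simp), f₂.1 12 (by simp [check]), p3, add_assoc]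
    · rw [State.setReg_reg, if_neg (by simp), e13]
      intro b i h1 h2
      rw [State.setReg_mem, f₂.2 b (by simp [check])]
      exact p5 b i h1 h2
    · rw [State.setReg_reg, if_neg (by simp)]; exact q2
    · rw [State.setReg_reg, if_neg (by simp), q3, hw 11 (by simp), hans, or_assoc]
      refine or_congr_right ?_
      have hd : (∃ u < 2 ^ g, s₁.mem 13 (base + (j + a) * S + (a' + 1) * S + u) < 2 * 2 ^ g) ↔
          ∃ u < 2 ^ g, ∃ v < 2 ^ g, ∀ r < fl, s.mem 1 (fp + r) &&& mask nv g j u ≠ 0 ∨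
            s.mem 1 (fp + r) &&& mask nv g j (2 ^ g + v) ≠ 0 := by
        refine exists_congr fun u => and_congr_right fun hu => ?_
        rw [← p2]
        exact p6 u hu
      rw [hd]
      constructor
      · rintro (⟨ρ, hρ, h⟩ | h)
        exacts [⟨ρ, by omega, h⟩, ⟨j, by omega, h⟩]
      · rintro ⟨ρ, hρ, h⟩
        rcases Nat.lt_succ_iff_lt_or_eq.1 hρ with h' | rfl
        exacts [Or.inl ⟨ρ, h', h⟩, Or.inr h]
  · rintro t s' - ⟨p, ht, a, h13, h12, ha, hfr', h11', hans, rfl⟩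
    refine ⟨a, ?_, h13, h12, ha, hfr', h11', ?_⟩
    · have h1 : (Dm - d) * Tc = (Dm - (d + a)) * Tc + a * Tc := by
        rw [← add_mul]; congr 1; omega
      have h2 : (M + a) * Tc = M * (Tc - 8) + M * 8 + a * Tc := by
        rw [add_mul, ← mul_add, Nat.sub_add_cancel hTc']
      simp only [Nat.sub_self, zero_mul, zero_add] at ht
      omega
    · rw [hans, satMasks_iff_exists_block hz.g_le]

end WordRAM

/-! ### The main loop -/

namespace WordRAM

open Sparsify


/-- The list of `l` clauses at address `p` below `top`, in the memory `f`, may be branched on. -/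
structure NodeOK (κ k L Lm : ℕ) (f : ℕ → ℕ) (top p l w : ℕ) : Prop where
  le : p + l ≤ top
  len : l ≤ Lm
  lt : ∀ x ∈ seg f p l, x < 2 ^ L
  budget : Budget κ k L (fam (seg f p l)) w

theorem NodeOK.congr {κ k L Lm top top' p l w : ℕ} {f f' : ℕ → ℕ}
    (h : NodeOK κ k L Lm f top p l w) (hf : ∀ i < top, f' i = f i) (ht : top ≤ top') :
    seg f' p l = seg f p l ∧ NodeOK κ k L Lm f' top' p l w := by
  have hs : seg f' p l = seg f p l := seg_congr fun i _ hi => hf i (by have := h.le; omega)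
  exact ⟨hs, h.le.trans ht, h.len, hs ▸ h.lt, hs ▸ h.budget⟩

/-- The number of clauses of size at most `k`. -/
def maxList (k L : ℕ) : ℕ := (k + 1) * (L + 1) ^ k

/-- The time for a node of the search tree. -/
def popCost (k L Lm : ℕ) : ℕ :=
  Lm * (50 * Lm + 100) + maxList k L * (maxList k L * ((maxList k L + 5) * (20 * L + 100)) + 20) +
    100

/-- The top of the stack is removed, normalised and searched for a sunflower. -/
def pop (κ k : ℕ) : Cmd :=
  15 ::= R[15] -ₑ K[1] ;; 20 ::= A[2, R[15]] ;; 21 ::= A[3, R[15]] ;; norm ;; search κ k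

theorem search_wregs' (κ k : ℕ) : ∀ r ∈ (search κ k).wregs, 24 ≤ r ∧ r ≤ 42 := by
  intro r hr
  have := search_wregs κ k r
  simp only [search, Cmd.for, Cmd.wregs, List.mem_append, List.mem_singleton] at hr
  by_cases h : r ∈ (searchBody κ k).wregs
  · have := this h
    omega
  · simp only [h, false_or] at hr
    omega

theorem search_warrs' (κ k : ℕ) : (search κ k).warrs = [] := by
  simp [search, search_warrs κ k]

theorem pop_wregs (κ k : ℕ) :
    ∀ r ∈ (pop κ k).wregs, r = 14 ∨ r = 15 ∨ 20 ≤ r ∧ r ≤ 42 := by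
  intro r hr
  have := search_wregs' κ k r
  simp [pop, norm, normInner] at hr
  by_cases h : r ∈ (search κ k).wregs
  · have := this h
    omega
  · simp only [h, or_false] at hr
    omega

theorem pop_warrs (κ k : ℕ) : ∀ a ∈ (pop κ k).warrs, a = 1 := by
  simp [pop, norm, normInner, search_warrs']

/-- After normalisation the entries are distinct sets of at most `k` literals, so there are at most
`maxList k L` of them. The expensive search then depends on the number of variables only, not on the
length of the input. -/
theorem pop_spec {W L κ k Lm sp w : ℕ} {s : State} (h8 : s.reg 8 = L) (h15 : s.reg 15 = sp + 1)
    (hn : NodeOK κ k L Lm (s.mem 1) (s.reg 14) (s.mem 2 sp) (s.mem 3 sp) w)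
    (hW : s.reg 14 + Lm < W) (hLW : L < W)
    (hkW : (k + 1) * (k + 1) ≤ W) (hκW : κ ≤ W) (hθW : 2 ^ (2 * κ * k) ≤ W) (hκ : k + 1 ≤ κ) :
    wp W (pop κ k) s fun t s' => t ≤ popCost k L Lm ∧ s'.reg 15 = sp ∧ s'.reg 22 = s.reg 14 ∧
      s'.reg 23 ≤ maxList k L ∧ s'.reg 14 = s.reg 14 + s'.reg 23 ∧
      (∀ i < s.reg 14, s'.mem 1 i = s.mem 1 i) ∧
      fam (seg (s'.mem 1) (s.reg 14) (s'.reg 23)) =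
        minimals (fam (seg (s.mem 1) (s.mem 2 sp) (s.mem 3 sp))) ∧
      (seg (s'.mem 1) (s.reg 14) (s'.reg 23)).Nodup ∧
      (∀ x ∈ seg (s'.mem 1) (s.reg 14) (s'.reg 23), x < 2 ^ L) ∧
      ((s'.reg 35 < (k + 1) * (k + 1) ∧ s'.reg 36 < 2 ^ L ∧
          IsPick κ (fam (seg (s'.mem 1) (s.reg 14) (s'.reg 23))) (s'.reg 37) (bits (s'.reg 36))) ∨
        (¬ s'.reg 35 < (k + 1) * (k + 1) ∧
          ∀ c H, ¬ Heavy κ (fam (seg (s'.mem 1) (s.reg 14) (s'.reg 23))) c H)) := by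
  obtain ⟨hn1, hn2, hn3, hn4⟩ := hn
  rw [pop, wp_seq, wp_set, wp_seq, wp_set, wp_seq, wp_set, wp_seq]
  simp only [Expr.eval, Expr.Ok, Expr.cost, BinOp.eval, BinOp.Fits, State.setReg_reg,
    State.setReg_mem, if_true, if_false, Nat.reduceEqDiff, true_and, and_true, h15,
    Nat.add_sub_cancel]
  refine ⟨by omega, (norm_spec (p := s.mem 2 sp) (l := s.mem 3 sp) (m := s.reg 14)
    (X := fun i => s.mem 1 (s.mem 2 sp + i)) (by simp) (by simp) (by simp) (by simp) hn1
    (by omega)).mono ?_⟩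
  rintro t s₁ f₁ ⟨p1, p2, p3, p4, p5, p6⟩
  set nl := normList (fun i => s.mem 1 (s.mem 2 sp + i)) (s.mem 3 sp) with hnl
  have hfam : fam nl = minimals (fam (seg (s.mem 1) (s.mem 2 sp) (s.mem 3 sp))) :=
    fam_normList _ _ _
  have hnd : nl.Nodup := normList_nodup _ _
  have hground := hn4.ground
  rw [← hfam] at hground
  have hQ : nl.length ≤ maxList k L := by
    rw [← card_fam hnd]; exact card_le_of_ground hground
  have hlen : nl.length ≤ s.mem 3 sp := by
    rw [hnl, normList, List.length_map]
    exact (List.length_filter_le _ _).trans (by simp)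
  have hlt : ∀ x ∈ nl, x < 2 ^ L := by
    intro x hx
    simp only [hnl, normList, List.mem_map, List.mem_filter, List.mem_range] at hx
    obtain ⟨i, ⟨hi, -⟩, rfl⟩ := hx
    exact hn3 _ (mem_seg.2 ⟨i, hi, rfl⟩)
  have e8 : s₁.reg 8 = L := by rw [f₁.1 8 (by simp [norm, normInner])]; simp [h8]
  have e15 : s₁.reg 15 = sp := by rw [f₁.1 15 (by simp [norm, normInner])]; simp
  rw [← p3] at p5
  refine (search_spec (κ := κ) (k := k) e8 p2 rfl (by
    rw [p5]
    exact fun x hx => ⟨hlt x hx, (hground _ (mem_fam.2 ⟨x, hx, rfl⟩)).2⟩) (by rwa [p5]) hLW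
    (by omega) hkW hκW hθW hκ).mono ?_
  rintro t₂ s₂ f₂ ⟨q1, q2⟩
  have hr : ∀ r, r < 24 → s₂.reg r = s₁.reg r := fun r hr =>
    f₂.1 r fun h => by have := (search_wregs' κ k r h).1; omega
  have hm : ∀ a, s₂.mem a = s₁.mem a := fun a => f₂.2 a (by simp [search_warrs'])
  rw [p5] at q2
  rw [hr 15 (by simp), hr 22 (by simp), hr 23 (by simp), hr 14 (by simp), hm 1, p5]
  refine ⟨?_, e15, p2, p3.trans_le hQ, by rw [p4, p3], p6, hfam, hnd, hlt, q2⟩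
  have h1 : s.mem 3 sp * (50 * s.mem 3 sp + 100) ≤ Lm * (50 * Lm + 100) := by gcongr
  have h2 : s₁.reg 23 * (s₁.reg 23 * ((s₁.reg 23 + 5) * (20 * L + 100)) + 20) ≤
      maxList k L * (maxList k L * ((maxList k L + 5) * (20 * L + 100)) + 20) := by
    rw [p3]; gcongr
  rw [popCost]
  omega

/-- One node of the search tree. -/
def node (P : Prog) (κ k : ℕ) : Cmd :=
  pop κ k ;; .ite (R[35] <ₑ K[(k + 1) * (k + 1)]) (pushHeart ;; pushPetals) (leaf P)

/-- The parameters of the sparsification. -/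
structure Params (W κ k L Lm : ℕ) : Prop where
  hk : 4 * k ≤ 2 ^ κ
  hκ : k + 1 ≤ κ
  hκW : κ ≤ W
  hkW : (k + 1) * (k + 1) ≤ W
  hθW : 2 ^ (2 * κ * k) ≤ W
  hLm : 2 * maxList k L + 1 ≤ Lm

/-- The part of the invariant of the main loop that concerns the stack. -/
structure StackInv (W κ k L Lm : ℕ) (w : ℕ → ℕ) (s : State) : Prop where
  node : ∀ i < s.reg 15, NodeOK κ k L Lm (s.mem 1) (s.reg 14) (s.mem 2 i) (s.mem 3 i) (w i)
  free : s.reg 14 + (∑ i ∈ Finset.range (s.reg 15), w i + 1) * (2 * Lm) < W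
  sp : s.reg 15 + ∑ i ∈ Finset.range (s.reg 15), w i < W

/-- Some formula on the stack is satisfiable. -/
def StackSat (nv g : ℕ) (s : State) : Prop :=
  ∃ i < s.reg 15, SatMasks nv g (fam (seg (s.mem 1) (s.mem 2 i) (s.mem 3 i)))

theorem nodeOK_of_pushed {κ k L Lm w : ℕ} {l : List ℕ} {s s' : State} (h : Pushed l s s')
    (hl : l.length ≤ Lm) (hlt : ∀ x ∈ l, x < 2 ^ L) (hb : Budget κ k L (fam l) w) :
    seg (s'.mem 1) (s'.mem 2 (s.reg 15)) (s'.mem 3 (s.reg 15)) = l ∧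
    NodeOK κ k L Lm (s'.mem 1) (s'.reg 14) (s'.mem 2 (s.reg 15)) (s'.mem 3 (s.reg 15)) w := by
  rw [h.mem2, h.mem3, h.reg14]
  simp only [Function.update_self]
  exact ⟨h.seg, le_rfl, hl, by rwa [h.seg], by rwa [h.seg]⟩

theorem Pushed.old {l : List ℕ} {s s' : State} (h : Pushed l s s') {i : ℕ} (hi : i < s.reg 15) :
    s'.mem 2 i = s.mem 2 i ∧ s'.mem 3 i = s.mem 3 i := by
  rw [h.mem2, h.mem3, Function.update_of_ne (by omega), Function.update_of_ne (by omega)]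
  exact ⟨rfl, rfl⟩

theorem satMasks_branch {nv g c : ℕ} {X : Finset (Finset ℕ)} {H : Finset ℕ} :
    SatMasks nv g X ↔ SatMasks nv g (minimals X ∪ {H}) ∨
      SatMasks nv g (minimals X ∪ petals (minimals X) c H) := by
  have key : ∀ S, Hits X S ↔ Hits (minimals X ∪ {H}) S ∨
      Hits (minimals X ∪ petals (minimals X) c H) S := fun S => by
    rw [← hits_minimals, hits_branch c H]
  simp only [SatMasks, key]
  constructor
  · rintro ⟨u, hu, w, hw, h | h⟩
    exacts [Or.inl ⟨u, hu, w, hw, h⟩, Or.inr ⟨u, hu, w, hw, h⟩]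
  · rintro (⟨u, hu, w, hw, h⟩ | ⟨u, hu, w, hw, h⟩)
    exacts [⟨u, hu, w, hw, Or.inl h⟩, ⟨u, hu, w, hw, Or.inr h⟩]

/-- The effect of branching. -/
theorem branch_spec {W nv g κ k Lm sp : ℕ} {w : ℕ → ℕ} {s s₁ : State}
    (hp : Params W κ k (2 * nv) Lm) (hinv : StackInv W κ k (2 * nv) Lm w s)
    (hLW : 2 ^ (2 * nv) ≤ W)
    (h15 : s.reg 15 = sp + 1) (e8 : s₁.reg 8 = 2 * nv) (e15 : s₁.reg 15 = sp)
    (e22 : s₁.reg 22 = s.reg 14) (e23 : s₁.reg 23 ≤ maxList k (2 * nv))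
    (e14 : s₁.reg 14 = s.reg 14 + s₁.reg 23) (m1 : ∀ i < s.reg 14, s₁.mem 1 i = s.mem 1 i)
    (m2 : s₁.mem 2 = s.mem 2) (m3 : s₁.mem 3 = s.mem 3)
    (hfam : fam (seg (s₁.mem 1) (s.reg 14) (s₁.reg 23)) =
      minimals (fam (seg (s.mem 1) (s.mem 2 sp) (s.mem 3 sp))))
    (hlt : ∀ x ∈ seg (s₁.mem 1) (s.reg 14) (s₁.reg 23), x < 2 ^ (2 * nv))
    (hH : s₁.reg 36 < 2 ^ (2 * nv))
    (hpick : IsPick κ (fam (seg (s₁.mem 1) (s.reg 14) (s₁.reg 23))) (s₁.reg 37)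
      (bits (s₁.reg 36))) :
    wp W (pushHeart ;; pushPetals) s₁ fun t s' => t ≤ maxList k (2 * nv) * (40 * nv + 120) + 100 ∧
      ∃ w', StackInv W κ k (2 * nv) Lm w' s' ∧ ∑ i ∈ Finset.range (s'.reg 15), w' i + 1 ≤
        ∑ i ∈ Finset.range (s.reg 15), w i ∧ (StackSat nv g s' ↔ StackSat nv g s) := by
  have hnode := hinv.node
  have hfree := hinv.free
  have hsp := hinv.sp
  have hLm := hp.hLm
  rw [h15, Finset.sum_range_succ] at hfree hsp
  have hlast := hnode sp (by omega)
  -- The budget of the removed entry is divided between the two new ones, with one unit left over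
  -- for this branching.
  obtain ⟨w₁, w₂, hw, hb₁, hb₂⟩ := hlast.budget.branch hp.hk (by have := hp.hκ; omega)
    (hfam ▸ hpick)
  have hw1 := hb₁.pos
  have hw2 := hb₂.pos
  have hfree' : s.reg 14 + (2 * Lm + 2 * Lm) < W := by
    have : 2 * (2 * Lm) ≤ (∑ i ∈ Finset.range sp, w i + w sp + 1) * (2 * Lm) :=
      Nat.mul_le_mul_right _ (by omega)
    omega
  have hLW' : 2 * nv < W := Nat.lt_two_pow_self.trans_le hLW
  rw [wp_seq]
  refine (pushHeart_spec (fp := s.reg 14) (fl := s₁.reg 23) e22 rfl (by omega) (by omega)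
    (by omega)).mono fun t₂ s₂ f₂ ⟨p1, p2⟩ => ?_
  have g8 := f₂.1 8 (by simp [pushHeart, copyList, push])
  have g22 := f₂.1 22 (by simp [pushHeart, copyList, push])
  have g23 := f₂.1 23 (by simp [pushHeart, copyList, push])
  have g36 := f₂.1 36 (by simp [pushHeart, copyList, push])
  have g37 := f₂.1 37 (by simp [pushHeart, copyList, push])
  set nl := seg (s₁.mem 1) (s.reg 14) (s₁.reg 23) with hnl
  have hnll : nl.length = s₁.reg 23 := seg_length _ _ _
  have hseg : seg (s₂.mem 1) (s.reg 14) (s₁.reg 23) = nl :=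
    seg_congr fun i _ hi => p2.mem1 i (by omega)
  have h14 := p2.reg14
  have h15' := p2.reg15
  rw [List.length_append, hnll, List.length_singleton] at h14
  refine (pushPetals_spec (L := 2 * nv) (fp := s.reg 14) (fl := s₁.reg 23) (by rw [g8, e8])
    (by rw [g22, e22]) g23 (by omega) (by omega) (by omega) hLW' hLW (by rwa [g36])
    (by rwa [hseg])).mono fun t₃ s₃ f₃ ⟨q1, q2⟩ => ?_
  rw [hseg, g36, g37] at q2
  set pl := petalList nl (s₁.reg 37) (s₁.reg 36) with hpl
  have hpll : pl.length ≤ s₁.reg 23 := (petalList_length _ _ _).trans hnll.le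
  have hpl_lt : ∀ x ∈ pl, x < 2 ^ (2 * nv) := by
    intro x hx
    simp only [hpl, petalList, List.mem_map, List.mem_filter] at hx
    obtain ⟨y, ⟨hy, -⟩, rfl⟩ := hx
    exact Nat.xor_lt_two_pow (hlt y hy) hH
  obtain ⟨n1, n2⟩ := nodeOK_of_pushed p2 (κ := κ) (k := k) (L := 2 * nv) (Lm := Lm) (w := w₁)
    (by rw [List.length_append, hnll, List.length_singleton]; omega)
    (by simp only [List.mem_append, List.mem_singleton]; rintro x (hx | rfl); exacts [hlt x hx, hH])
    (by rwa [fam_append, fam_singleton, hfam])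
  obtain ⟨n3, n4⟩ := nodeOK_of_pushed q2 (κ := κ) (k := k) (L := 2 * nv) (Lm := Lm) (w := w₂)
    (by rw [List.length_append, hnll]; omega)
    (by simp only [List.mem_append]; rintro x (hx | hx); exacts [hlt x hx, hpl_lt x hx])
    (by rwa [fam_append, hpl, petalList, ← petals_fam, hfam])
  have h14' := q2.reg14
  have h15'' := q2.reg15
  rw [List.length_append, hnll] at h14'
  obtain ⟨k2, k3⟩ := q2.old (i := s₁.reg 15) (by omega)
  rw [← k2, ← k3] at n1 n2
  obtain ⟨n5, n6⟩ := n2.congr (top' := s₃.reg 14) q2.mem1 (by omega)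
  rw [h15', e15] at n3 n4
  rw [e15] at n1 n2 n5 n6
  have hold : ∀ i < sp, seg (s₃.mem 1) (s₃.mem 2 i) (s₃.mem 3 i) =
      seg (s.mem 1) (s.mem 2 i) (s.mem 3 i) ∧
      NodeOK κ k (2 * nv) Lm (s₃.mem 1) (s₃.reg 14) (s₃.mem 2 i) (s₃.mem 3 i) (w i) := by
    intro i hi
    obtain ⟨a1, a2⟩ := q2.old (i := i) (by omega)
    obtain ⟨a3, a4⟩ := p2.old (i := i) (by omega)
    rw [a1, a2, a3, a4, m2, m3]
    exact (hnode i (by omega)).congr (fun j hj => by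
      rw [q2.mem1 j (by omega), p2.mem1 j (by omega), m1 j hj])
      (by rw [h14', h14, e14]; omega)
  have hw' : ∑ i ∈ Finset.range sp, (if i < sp then w i else if i = sp then w₁ else w₂) =
      ∑ i ∈ Finset.range sp, w i :=
    Finset.sum_congr rfl fun i hi => if_pos (Finset.mem_range.1 hi)
  have hsum : ∑ i ∈ Finset.range (s₃.reg 15),
      (if i < sp then w i else if i = sp then w₁ else w₂) =
      ∑ i ∈ Finset.range sp, w i + w₁ + w₂ := by
    rw [h15'', h15', e15, Finset.sum_range_succ, Finset.sum_range_succ, hw']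
    simp
  refine ⟨?_, fun i => if i < sp then w i else if i = sp then w₁ else w₂, ⟨fun i hi => ?_, ?_, ?_⟩,
    ?_, ?_⟩
  · have a1 : s₁.reg 23 * (20 * (2 * nv) + 90) ≤ maxList k (2 * nv) * (20 * (2 * nv) + 90) := by
      gcongr
    have a2 : maxList k (2 * nv) * (40 * nv + 120) = maxList k (2 * nv) * (20 * (2 * nv) + 90) +
      maxList k (2 * nv) * 30 := by ring
    have a3 : s₁.reg 23 * 30 ≤ maxList k (2 * nv) * 30 := by gcongr
    omega
  · rcases lt_trichotomy i sp with h | rfl | h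
    · simp only [h, if_true]; exact (hold i h).2
    · simp only [lt_irrefl, if_true, if_false]; exact n6
    · obtain rfl : i = sp + 1 := by omega
      simp only [show ¬ sp + 1 < sp by omega, show sp + 1 ≠ sp by omega, if_false]; exact n4
  -- The normalised list and the two pushed lists occupy at most `4 * maxList k (2 * nv) + 1` cells,
  -- hence at most `2 * Lm`, the share of one unit.
  · rw [hsum, h14', h14, e14]
    have : (∑ i ∈ Finset.range sp, w i + w₁ + w₂ + 1 + 1) * (2 * Lm) ≤
        (∑ i ∈ Finset.range sp, w i + w sp + 1) * (2 * Lm) := Nat.mul_le_mul_right _ (by omega)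
    rw [add_mul _ 1] at this
    omega
  · rw [hsum]; omega
  · rw [hsum, h15, Finset.sum_range_succ]; omega
  · have hX := satMasks_branch (nv := nv) (g := g) (c := s₁.reg 37) (H := bits (s₁.reg 36))
      (X := fam (seg (s.mem 1) (s.mem 2 sp) (s.mem 3 sp)))
    have f1 : fam (nl ++ [s₁.reg 36]) =
        minimals (fam (seg (s.mem 1) (s.mem 2 sp) (s.mem 3 sp))) ∪ {bits (s₁.reg 36)} := by
      rw [fam_append, fam_singleton, hfam]
    have f2 : fam (nl ++ pl) = minimals (fam (seg (s.mem 1) (s.mem 2 sp) (s.mem 3 sp))) ∪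
        petals (minimals (fam (seg (s.mem 1) (s.mem 2 sp) (s.mem 3 sp)))) (s₁.reg 37)
          (bits (s₁.reg 36)) := by
      rw [fam_append, hpl, petalList, ← petals_fam, hfam]
    rw [← f1, ← f2] at hX
    constructor
    · rintro ⟨i, hi, h⟩
      rcases lt_trichotomy i sp with h' | rfl | h'
      · rw [(hold i h').1] at h
        exact ⟨i, by omega, h⟩
      · rw [n5, n1] at h
        exact ⟨i, by omega, hX.2 (Or.inl h)⟩
      · obtain rfl : i = sp + 1 := by omega
        rw [n3] at h
        exact ⟨sp, by omega, hX.2 (Or.inr h)⟩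
    · rintro ⟨i, hi, h⟩
      rcases (show i < sp ∨ i = sp by omega) with h' | rfl
      · exact ⟨i, by omega, by rwa [(hold i h').1]⟩
      · rcases hX.1 h with h | h
        · exact ⟨i, by omega, by rwa [n5, n1]⟩
        · exact ⟨i + 1, by omega, by rwa [n3]⟩

end WordRAM

/-! ### Accounting for the whole search tree -/

namespace WordRAM

open Sparsify


/-- The largest number of clauses of a formula without large sunflowers. -/
def leafSize (κ k L : ℕ) : ℕ := 1 + k * L * θ κ k

/-- The time for a node, without the calls at a leaf. -/
def nodeCost (k nv Lm : ℕ) : ℕ :=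
  popCost k (2 * nv) Lm + maxList k (2 * nv) * (40 * nv + 120) + 150

/-- The invariant of the main loop. -/
structure MainInv (W nv g S T₀ κ k Lm Dm : ℕ) (sat : Prop) (w : ℕ → ℕ) (s : State) : Prop where
  const : Const nv g S T₀ s
  stack : StackInv W κ k (2 * nv) Lm w s
  leaf_le : leafSize κ k (2 * nv) ≤ s.reg 12
  dim_le : s.reg 12 ≤ Dm
  fresh : Fresh (s.reg 13 + S) s
  ans_le : s.reg 11 ≤ 1
  base_le : s.reg 13 + ((∑ i ∈ Finset.range (s.reg 15), w i) * 2 ^ (nv - 2 * g) +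
    (Dm - s.reg 12) + 2) * S ≤ W
  correct : (s.reg 11 = 1 ∨ StackSat nv g s) ↔ sat

/-- The time that is still available. -/
def credit (P : Prog) (nv g T₀ κ k Lm Dm : ℕ) (w : ℕ → ℕ) (s : State) : ℕ :=
  (∑ i ∈ Finset.range (s.reg 15), w i) * (nodeCost k nv Lm +
    2 ^ (nv - 2 * g) * callCost P g (leafSize κ k (2 * nv)) T₀) +
  (Dm - s.reg 12) * callCost P g (leafSize κ k (2 * nv)) T₀

/-- A branching is paid by the unit that `Budget.branch` sets aside, a leaf by its own unit, which
covers all its blocks. Failed calls are paid by the decrease of `Dm - reg 12`, a supply that the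
whole search shares. -/
theorem node_spec {W nv g S T₀ C κ k Lm Dm : ℕ} {P : Prog} {D T : ℕ → ℕ} {sat : Prop}
    {w : ℕ → ℕ} {s : State} (hz : Sizes W nv g S T₀ C P D T) (hp : Params W κ k (2 * nv) Lm)
    (hDm : D (2 * 2 ^ g) = Dm) (hinv : MainInv W nv g S T₀ κ k Lm Dm sat w s)
    (h15 : s.reg 15 ≠ 0) :
    wp W (node P κ k) s fun t s' => ∃ w', MainInv W nv g S T₀ κ k Lm Dm sat w' s' ∧
      t + 2 + credit P nv g T₀ κ k Lm Dm w' s' ≤ credit P nv g T₀ κ k Lm Dm w s := by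
  obtain ⟨sp, h15⟩ := Nat.exists_eq_succ_of_ne_zero h15
  rw [Nat.succ_eq_add_one] at h15
  have hst := hinv.stack
  have hlast := hst.node sp (by omega)
  have hwsp := hlast.budget.pos
  have hfree := hst.free
  have hbase := hinv.base_le
  have hsp := hst.sp
  have hLm := hp.hLm
  have hans := hinv.ans_le
  have hcor := hinv.correct
  have hd1 := hinv.leaf_le
  have hd2 := hinv.dim_le
  have hLW : 2 * nv < W := Nat.lt_two_pow_self.trans_le hz.word
  have hfree' : s.reg 14 + 2 * (2 * Lm) < W := by
    rw [h15, Finset.sum_range_succ] at hfree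
    have : 2 * (2 * Lm) ≤ (∑ i ∈ Finset.range sp, w i + w sp + 1) * (2 * Lm) :=
      Nat.mul_le_mul_right _ (by omega)
    omega
  rw [node, wp_seq]
  refine (pop_spec hinv.const.reg8 h15 hlast (by omega) hLW hp.hkW hp.hκW hp.hθW hp.hκ).mono ?_
  rintro t₁ s₁ f₁ ⟨p1, p2, p3, p4, p5, p6, p7, p8, p9, p10⟩
  have hr : ∀ r, ¬ (r = 14 ∨ r = 15 ∨ 20 ≤ r ∧ r ≤ 42) → s₁.reg r = s.reg r :=
    fun r hr => f₁.1 r fun h => hr (pop_wregs κ k r h)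
  have hm : ∀ a, a ≠ 1 → s₁.mem a = s.mem a := fun a ha => f₁.2 a fun h => ha (pop_warrs κ k a h)
  rw [wp_ite]
  refine ⟨⟨trivial, hp.hkW, trivial⟩, fun h => ?_, fun h => ?_⟩
  · have hb : s₁.reg 35 < (k + 1) * (k + 1) := (ind_ne_zero _).1 h
    obtain ⟨-, hH, hpick⟩ := p10.resolve_right fun h' => h'.1 hb
    refine (branch_spec (g := g) hp hst hz.word h15 (by rw [hr 8 (by omega), hinv.const.reg8]) p2
      p3 p4 p5 p6 (hm 2 (by omega)) (hm 3 (by omega)) p7 p9 hH hpick).mono ?_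
    rintro t₂ s₂ f₂ ⟨q1, w', q2, q3, q4⟩
    have hr' : ∀ r, ¬ (r = 14 ∨ r = 15 ∨ 20 ≤ r ∧ r ≤ 42) → s₂.reg r = s.reg r := by
      intro r hr'
      rw [f₂.1 r fun h => hr' ?_, hr r hr']
      simp [pushHeart, pushPetals, copyList, addPetals, push, popc] at h
      omega
    have hm' : ∀ a, 10 ≤ a → s₂.mem a = s.mem a := by
      intro a ha
      rw [f₂.2 a, hm a (by omega)]
      simp [pushHeart, pushPetals, copyList, addPetals, push, popc]
      omega
    refine ⟨w', ⟨hinv.const.congr fun r h => hr' r ?_, q2, ?_, ?_, ?_, ?_, ?_, ?_⟩, ?_⟩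
    · simp at h; omega
    · rwa [hr' 12 (by omega)]
    · rwa [hr' 12 (by omega)]
    · intro a i ha hi
      rw [hm' a ha]
      rw [hr' 13 (by omega)] at hi
      exact hinv.fresh a i ha hi
    · rwa [hr' 11 (by omega)]
    · rw [hr' 13 (by omega), hr' 12 (by omega)]
      refine le_trans ?_ hbase
      gcongr
      omega
    · rw [hr' 11 (by omega), q4]; exact hcor
    · rw [credit, credit, hr' 12 (by omega)]
      have h1 : (∑ i ∈ Finset.range (s₂.reg 15), w' i + 1) *
          (nodeCost k nv Lm + 2 ^ (nv - 2 * g) * callCost P g (leafSize κ k (2 * nv)) T₀) ≤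
          (∑ i ∈ Finset.range (s.reg 15), w i) *
              (nodeCost k nv Lm + 2 ^ (nv - 2 * g) * callCost P g (leafSize κ k (2 * nv)) T₀) :=
        Nat.mul_le_mul_right _ q3
      rw [add_mul, one_mul] at h1
      have h2 : t₁ + t₂ + 20 ≤ nodeCost k nv Lm := by rw [nodeCost]; omega
      simp only [Expr.cost]
      omega
  · have hb : ¬ s₁.reg 35 < (k + 1) * (k + 1) := (ind_eq_zero _).1 h
    obtain ⟨-, hno⟩ := p10.resolve_left fun h' => hb h'.1
    have hfl : s₁.reg 23 ≤ leafSize κ k (2 * nv) := by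
      rw [← seg_length (s₁.mem 1) (s.reg 14) (s₁.reg 23), ← card_fam p8, p7]
      rw [p7] at hno
      exact card_le_of_not_heavy hlast.budget.ground hno
    have hsum : ∑ i ∈ Finset.range (s.reg 15), w i = ∑ i ∈ Finset.range sp, w i + w sp := by
      rw [h15, Finset.sum_range_succ]
    have hbW : s₁.reg 13 + (2 ^ (nv - 2 * g) + (D (2 * 2 ^ g) - s₁.reg 12) + 2) * S ≤ W := by
      rw [hr 13 (by omega), hr 12 (by omega), hDm]
      refine le_trans ?_ hbase
      gcongr
      rw [hsum]
      exact Nat.le_mul_of_pos_left _ (by omega)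
    refine (leaf_spec (fp := s.reg 14) (fl := s₁.reg 23) (l := leafSize κ k (2 * nv)) hz
      (hinv.const.congr fun r h => hr r ?_) rfl hbW p3 rfl (by omega) rfl ?_ hfl ?_ ?_ ?_).mono ?_
    · simp at h; omega
    · rw [hr 12 (by omega)]; exact hfl.trans hd1
    · rw [hr 12 (by omega), hDm]; exact hd2
    · intro a i ha hi
      rw [hm a (by omega)]
      rw [hr 13 (by omega)] at hi
      exact hinv.fresh a i ha hi
    · rwa [hr 11 (by omega)]
    rintro t₂ s₂ f₂ ⟨a, q1, q2, q3, q4, q5, q6, q7⟩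
    have hr' : ∀ r, r ∉ [17, 11, 12, 13, 18, 43, 44, 45, 46, 47] → s₂.reg r = s₁.reg r :=
      fun r hr => f₂.1 r fun h => hr (leaf_wregs P r h)
    have hm' : ∀ a, a < 10 → s₂.mem a = s₁.mem a :=
      fun a ha => f₂.2 a fun h => by have := leaf_warrs P a h; omega
    have e15 : s₂.reg 15 = sp := by rw [hr' 15 (by simp), p2]
    have e14 : s₂.reg 14 = s.reg 14 + s₁.reg 23 := by rw [hr' 14 (by simp), p5]
    rw [hr 13 (by omega)] at q2
    rw [hr 12 (by omega)] at q3 q4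
    rw [hDm] at q4
    have hold : ∀ i < sp, seg (s₂.mem 1) (s₂.mem 2 i) (s₂.mem 3 i) =
        seg (s.mem 1) (s.mem 2 i) (s.mem 3 i) ∧
        NodeOK κ k (2 * nv) Lm (s₂.mem 1) (s₂.reg 14) (s₂.mem 2 i) (s₂.mem 3 i) (w i) := by
      intro i hi
      rw [hm' 2 (by omega), hm' 3 (by omega), hm 2 (by omega), hm 3 (by omega)]
      exact (hst.node i (by omega)).congr (fun j hj => by rw [hm' 1 (by omega), p6 j hj])
        (by omega)
    refine ⟨w, ⟨hinv.const.congr fun r h => ?_, ⟨fun i hi => ?_, ?_, ?_⟩, ?_, ?_, q5, q6, ?_, ?_⟩,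
        ?_⟩
    · rw [hr' r (by simp at h ⊢; omega), hr r (by simp at h; omega)]
    · exact (hold i (by omega)).2
    · rw [e15, e14]
      rw [hsum] at hfree
      have : (∑ i ∈ Finset.range sp, w i + 1 + 1) * (2 * Lm) ≤
        (∑ i ∈ Finset.range sp, w i + w sp + 1) * (2 * Lm) := Nat.mul_le_mul_right _ (by omega)
      rw [add_mul _ 1] at this
      omega
    · rw [e15]; omega
    · omega
    · omega
    · rw [q2, q3, e15, add_assoc, ← add_mul]
      refine le_trans ?_ hbase
      refine Nat.add_le_add_left (Nat.mul_le_mul_right _ ?_) _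
      rw [hsum, add_mul]
      have := Nat.mul_le_mul_right (2 ^ (nv - 2 * g)) (show 1 ≤ w sp from hwsp)
      omega
    · rw [q7, hr 11 (by omega), p7, ← hcor, or_assoc]
      refine or_congr_right ?_
      have hX : SatMasks nv g (minimals (fam (seg (s.mem 1) (s.mem 2 sp) (s.mem 3 sp)))) ↔
          SatMasks nv g (fam (seg (s.mem 1) (s.mem 2 sp) (s.mem 3 sp))) := by
        simp only [SatMasks, hits_minimals]
      rw [hX]
      constructor
      · rintro (h | ⟨i, hi, h⟩)
        · exact ⟨sp, by omega, h⟩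
        · rw [e15] at hi
          exact ⟨i, by omega, by rwa [← (hold i hi).1]⟩
      · rintro ⟨i, hi, h⟩
        rcases (show i < sp ∨ i = sp by omega) with h' | rfl
        · exact Or.inr ⟨i, by omega, by rwa [(hold i h').1]⟩
        · exact Or.inl h
    · rw [credit, credit, q3, e15, hsum]
      have h1 : (∑ i ∈ Finset.range sp, w i + 1) *
          (nodeCost k nv Lm + 2 ^ (nv - 2 * g) * callCost P g (leafSize κ k (2 * nv)) T₀) ≤
          (∑ i ∈ Finset.range sp, w i + w sp) *
              (nodeCost k nv Lm + 2 ^ (nv - 2 * g) * callCost P g (leafSize κ k (2 * nv)) T₀) :=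
        Nat.mul_le_mul_right _ (by omega)
      rw [add_mul _ 1, one_mul] at h1
      have h2 : t₁ + 50 ≤ nodeCost k nv Lm := by rw [nodeCost]; omega
      have h3 : (Dm - s.reg 12) * callCost P g (leafSize κ k (2 * nv)) T₀ = (Dm - (s.reg 12 + a)) *
          callCost P g (leafSize κ k (2 * nv)) T₀ + a * callCost P g (leafSize κ k (2 * nv)) T₀ :=
          by
        rw [← add_mul]; congr 1; omega
      rw [add_mul] at q1
      simp only [Expr.cost]
      omega

/-- The search over the stack. -/
def mainLoop (P : Prog) (κ k : ℕ) : Cmd := .while R[15] (node P κ k)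

theorem mainLoop_spec {W nv g S T₀ C κ k Lm Dm : ℕ} {P : Prog} {D T : ℕ → ℕ} {sat : Prop}
    {w : ℕ → ℕ} {s : State} (hz : Sizes W nv g S T₀ C P D T) (hp : Params W κ k (2 * nv) Lm)
    (hDm : D (2 * 2 ^ g) = Dm) (hinv : MainInv W nv g S T₀ κ k Lm Dm sat w s) :
    wp W (mainLoop P κ k) s fun t s' => t ≤ credit P nv g T₀ κ k Lm Dm w s + 2 ∧ s'.reg 11 ≤ 1 ∧
      (s'.reg 11 = 1 ↔ sat) := by
  refine (wp_while (fun s p => ∃ w, MainInv W nv g S T₀ κ k Lm Dm sat w s ∧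
    p = credit P nv g T₀ κ k Lm Dm w s) (fun _ _ _ => by simp) ?_ ⟨w, hinv, rfl⟩).mono ?_
  · rintro s p ⟨w, hinv, rfl⟩ h
    refine (node_spec hz hp hDm hinv h).mono ?_
    rintro t s' - ⟨w', h1, h2⟩
    refine ⟨_, ⟨w', h1, rfl⟩, ?_⟩
    simp only [Expr.cost]
    omega
  · rintro t s' - ⟨p, ⟨w', h1, rfl⟩, h2, h3⟩
    simp only [Expr.cost] at h3
    refine ⟨by omega, h1.ans_le, ?_⟩
    rw [← h1.correct, or_iff_left]
    rintro ⟨i, hi, -⟩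
    simp only [Expr.eval] at h2
    omega

end WordRAM

/-! ### Initialisation -/

namespace WordRAM

open Sparsify


theorem input_literal {k n m : ℕ} (φ : KCNF k n m) (i : Fin m) (j : Fin k) :
    φ.input.mem 0 (i * k + j) = 2 * ((φ i j).1 : ℕ) + (φ i j).2.toNat := by
  have h : (i : ℕ) * k + j < m * k := by
    have h1 := j.2
    have h2 := Nat.mul_le_mul_right k (show (i : ℕ) + 1 ≤ m from i.2)
    rw [add_mul, one_mul] at h2
    omega
  have h1 : finProdFinEquiv.symm ⟨(i : ℕ) * k + j, h⟩ = (i, j) := by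
    rw [Equiv.symm_apply_eq]
    ext
    simp [finProdFinEquiv, mul_comm, add_comm]
  simp only [KCNF.input, dif_pos h, h1]

theorem litPos_encode (nv v : ℕ) (b : Bool) :
    ((2 * v + b.toNat) >>> 1) + (1 - ((2 * v + b.toNat) &&& 1)) * nv = litPos nv (v, b) := by
  rw [Nat.shiftRight_one, Nat.and_one_is_mod, litPos]
  cases b <;> simp
  omega

/-- Sizes of the instances. -/
structure Sizing : Type where
  (b q₀ c A B : ℕ)

namespace Sizing

variable (z : Sizing) (n : ℕ)

/-- The scale. -/
def q : ℕ := n / (4 * z.b) + z.q₀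

/-- The number of variables of a row or column. -/
def g : ℕ := z.b * z.q n - 1

/-- The number of variables after padding. -/
def nv : ℕ := n + 2 * z.b * z.q₀

/-- The memory for one call. -/
def S : ℕ := 2 ^ (z.A * z.q n + z.B)

/-- The time for one call. -/
def T₀ : ℕ := z.c * 2 ^ ((2 * z.b - 1) * z.q n) + 1

theorem mul_q_le : z.b * z.q n ≤ z.nv n := by
  have h : 4 * z.b * (n / (4 * z.b)) ≤ n := Nat.mul_div_le _ _
  rw [mul_assoc] at h
  have h2 : 2 * z.b * z.q₀ = 2 * (z.b * z.q₀) := by ring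
  rw [q, nv, mul_add, h2]
  omega

theorem two_mul_g_le : 2 * z.g n ≤ z.nv n := by
  have h : 4 * z.b * (n / (4 * z.b)) ≤ n := Nat.mul_div_le _ _
  rw [mul_assoc] at h
  have h2 : 2 * z.b * z.q₀ = 2 * (z.b * z.q₀) := by ring
  rw [g, q, nv, mul_add, h2]
  omega

/-- The `- 1` in the definition of `g` compensates for the two halves, so that the number of points
is exactly a size covered by `exists_time_bound` and `exists_dim_bound`. -/
theorem two_mul_two_pow_g (hb : 1 ≤ z.b) (hq : 1 ≤ z.q₀) : 2 * 2 ^ z.g n = 2 ^ (z.b * z.q n) := by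
  have : 1 * 1 ≤ z.b * z.q n := Nat.mul_le_mul hb (hq.trans (Nat.le_add_left _ _))
  rw [g, ← pow_succ']
  congr 1
  omega

end Sizing

/-- The constants are computed. -/
def setup (z : Sizing) (κ k : ℕ) : Cmd :=
  3 ::= R[0] /ₑ K[4 * z.b] +ₑ K[z.q₀] ;;
  4 ::= K[z.b] *ₑ R[3] -ₑ K[1] ;;
  2 ::= R[0] +ₑ K[2 * z.b * z.q₀] ;;
  9 ::= K[1] <<ₑ R[4] ;;
  5 ::= K[2] *ₑ R[9] ;;
  6 ::= K[1] <<ₑ (K[z.A] *ₑ R[3] +ₑ K[z.B]) ;;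
  7 ::= K[z.c] *ₑ (K[1] <<ₑ (K[2 * z.b - 1] *ₑ R[3])) +ₑ K[1] ;;
  8 ::= K[2] *ₑ R[2] ;;
  16 ::= K[1] <<ₑ (R[2] -ₑ K[2] *ₑ R[4]) ;;
  19 ::= K[1] <<ₑ (R[2] -ₑ R[4]) ;;
  12 ::= K[1] +ₑ K[k] *ₑ R[8] *ₑ K[θ κ k]

theorem setup_spec {W κ k : ℕ} {z : Sizing} {n : ℕ} {s : State} (h0 : s.reg 0 = n)
    (hb : 1 ≤ z.b) (hq₀ : 1 ≤ z.q₀) (hc : 1 ≤ z.c) (hW : 2 ^ (2 * z.nv n) ≤ W)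
    (hS : z.S n ≤ W) (hT : z.T₀ n ≤ W) (hl : leafSize κ k (2 * z.nv n) ≤ W)
    (hθW : θ κ k ≤ W) :
    wp W (setup z κ k) s fun t s' => t ≤ 150 ∧ Const (z.nv n) (z.g n) (z.S n) (z.T₀ n) s' ∧
      s'.reg 12 = leafSize κ k (2 * z.nv n) := by
  have h1 := z.mul_q_le n
  have h2 := z.two_mul_g_le n
  have hq : 1 ≤ z.q n := hq₀.trans (Nat.le_add_left _ _)
  have hqb : z.q n ≤ z.b * z.q n := Nat.le_mul_of_pos_left _ hb
  have hbq : z.b ≤ z.b * z.q n := Nat.le_mul_of_pos_right _ hq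
  have hnW : 2 * z.nv n < W := Nat.lt_two_pow_self.trans_le hW
  have hnv : n + 2 * z.b * z.q₀ = z.nv n := rfl
  have hbb : 2 * z.b ≤ 2 * z.b * z.q₀ := Nat.le_mul_of_pos_right _ hq₀
  have hqdef : n / (4 * z.b) + z.q₀ = z.q n := rfl
  have hpow : ∀ e, e ≤ 2 * z.nv n → 2 ^ e ≤ W := fun e he =>
    (Nat.pow_le_pow_right (by norm_num) he).trans hW
  have hS' : z.A * z.q n + z.B < W := lt_of_lt_of_le Nat.lt_two_pow_self hS
  have hA : z.A ≤ z.A * z.q n := Nat.le_mul_of_pos_right _ hq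
  have hT' : z.c * 2 ^ ((2 * z.b - 1) * z.q n) + 1 ≤ W := hT
  have hT1 : 2 ^ ((2 * z.b - 1) * z.q n) ≤ z.c * 2 ^ ((2 * z.b - 1) * z.q n) :=
    Nat.le_mul_of_pos_left _ hc
  have hT2 : (2 * z.b - 1) * z.q n < 2 ^ ((2 * z.b - 1) * z.q n) := Nat.lt_two_pow_self
  have hc' : z.c ≤ z.c * 2 ^ ((2 * z.b - 1) * z.q n) := Nat.le_mul_of_pos_right _ (by positivity)
  have hl' : 1 + k * (2 * z.nv n) * θ κ k ≤ W := hl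
  have hθ := one_le_θ κ k
  have hnv1 : 1 ≤ 2 * z.nv n := by omega
  have hl1 : k * (2 * z.nv n) ≤ k * (2 * z.nv n) * θ κ k := Nat.le_mul_of_pos_right _ hθ
  have hk1 : k ≤ k * (2 * z.nv n) := Nat.le_mul_of_pos_right _ hnv1
  have hg : z.b * z.q n - 1 = z.g n := rfl
  have hTz : z.c * 2 ^ ((2 * z.b - 1) * z.q n) + 1 = z.T₀ n := rfl
  have hlz : 1 + k * (2 * z.nv n) * θ κ k = leafSize κ k (2 * z.nv n) := rfl
  have h5 : 2 * 2 ^ z.g n ≤ W := by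
    rw [z.two_mul_two_pow_g n hb hq₀]; exact hpow _ (by omega)
  rw [setup]
  simp only [wp_seq, wp_set, wp_ite, wp_store, wp_skip, Expr.eval, Expr.Ok, Expr.cost,
    BinOp.eval, BinOp.Fits, State.setReg_reg, State.setReg_mem, State.setMem_reg,
    Nat.reduceEqDiff, if_true, if_false, ind_and, ind_not, ind_eq_zero, ind_ne_zero,
    true_and, and_true, h0, hqdef, hnv, Nat.one_shiftLeft, hg, hTz, hlz]
  have hq5 : z.q₀ ≤ z.q n := Nat.le_add_left _ _
  and_intros
  all_goals first | omega | exact hpow _ (by omega) | exact hS | skip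
  constructor <;> simp [State.setReg_reg, Sizing.S]

/-- The clause number `reg 17` is read. -/
def readClause (k : ℕ) : Cmd :=
  20 ::= K[0] ;; 21 ::= K[k] ;;
  .for 22 21 (23 ::= A[0, R[17] *ₑ K[k] +ₑ R[22]] ;;
    20 ::= R[20] |ₑ (K[1] <<ₑ ((R[23] >>ₑ K[1]) +ₑ (K[1] -ₑ (R[23] &ₑ K[1])) *ₑ R[2])))

theorem readClause_spec {W k n m nv : ℕ} (φ : KCNF k n m) {i : Fin m} {s : State}
    (hs : s.mem 0 = φ.input.mem 0) (hi : s.reg 17 = i) (hnv : s.reg 2 = nv) (hn : n ≤ nv)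
    (hW : 2 ^ (2 * nv) ≤ W) (hk : k < W) (hm : m * k < W) :
    wp W (readClause k) s fun t s' => t ≤ k * 40 + 20 ∧ s'.reg 20 = clauseMask nv (φ i) k := by
  have hnW : 2 * nv < W := Nat.lt_two_pow_self.trans_le hW
  have hik : (i : ℕ) * k + k ≤ m * k := by
    have := Nat.mul_le_mul_right k (show (i : ℕ) + 1 ≤ m from i.2)
    rwa [add_mul, one_mul] at this
  rw [readClause, wp_seq, wp_set, wp_seq, wp_set]
  refine ⟨Nat.zero_le _, hk.le, ?_⟩
  refine (wp_for (n := k) (T := 32) (fun j s' => s'.reg 20 = clauseMask nv (φ i) j)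
    (by simp) hk.le (by omega) (by simp) (by simp) (by simp) (by simp [clauseMask]) ?_).mono ?_
  · intro j s' hj hij hf hI
    have e17 : s'.reg 17 = i := by rw [hf.1 17 (by simp)]; simp [hi]
    have e2 : s'.reg 2 = nv := by rw [hf.1 2 (by simp)]; simp [hnv]
    have em : s'.mem 0 (i * k + j) = 2 * ((φ i ⟨j, hj⟩).1 : ℕ) + (φ i ⟨j, hj⟩).2.toNat := by
      rw [hf.2 0 (by simp)]
      simp only [State.setReg_mem, hs]
      exact input_literal φ i ⟨j, hj⟩
    have hpos := litPos_lt hn (φ i ⟨j, hj⟩)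
    have hp := litPos_encode nv (φ i ⟨j, hj⟩).1 (φ i ⟨j, hj⟩).2
    have hcm := clauseMask_lt hn (φ i) (show j + 1 ≤ k from hj)
    rw [clauseMask_succ nv (φ i) hj] at hcm ⊢
    have hsh : 1 <<< litPos nv ((φ i ⟨j, hj⟩).1, (φ i ⟨j, hj⟩).2) ≤ W := by
      rw [Nat.one_shiftLeft]
      exact (Nat.pow_le_pow_right (by norm_num) hpos.le).trans hW
    simp only [wp_seq, wp_set, wp_ite, wp_store, wp_skip, Expr.eval, Expr.Ok, Expr.cost,
      BinOp.eval, BinOp.Fits, State.setReg_reg, State.setReg_mem, State.setMem_reg,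
      Nat.reduceEqDiff, if_true, if_false, ind_and, ind_not, ind_eq_zero, ind_ne_zero,
      true_and, and_true, e17, e2, hij, em, hI, hp]
    have hcm' := hcm.le.trans hW
    and_intros <;> omega
  · rintro t s' - ⟨h1, h2⟩
    simp only [Expr.cost]
    exact ⟨by omega, h2⟩

/-- The clauses are read and the list of them is pushed on the stack. -/
def readInput (k : ℕ) : Cmd :=
  .for 17 1 (readClause k ;; .store 1 R[17] R[20]) ;;
  14 ::= R[1] ;; .store 3 K[0] R[1] ;; 15 ::= K[1]

theorem readInput_spec {W k n m nv : ℕ} (φ : KCNF k n m) {s : State}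
    (hs : s.mem 0 = φ.input.mem 0) (h1 : s.reg 1 = m) (hnv : s.reg 2 = nv) (hn : n ≤ nv)
    (hW : 2 ^ (2 * nv) ≤ W) (hk : k < W) (hm : m * k < W) (hmW : m < W) :
    wp W (readInput k) s fun t s' => t ≤ m * (k * 40 + 60) + 50 ∧
      (∀ i : Fin m, s'.mem 1 i = clauseMask nv (φ i) k) ∧ s'.reg 14 = m ∧ s'.reg 15 = 1 ∧
      s'.mem 3 0 = m := by
  rw [readInput, wp_seq]
  refine (wp_for (n := m) (T := k * 40 + 40)
    (fun j s' => ∀ i : Fin m, (i : ℕ) < j → s'.mem 1 i = clauseMask nv (φ i) k)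
    h1 hmW.le (by omega) (by simp [readClause]) (by simp [readClause]) (by simp) (by simp) ?_).mono
        ?_
  · intro j s' hj hij hf hI
    rw [wp_seq]
    refine (readClause_spec φ (i := ⟨j, hj⟩) (by rw [hf.2 0 (by simp [readClause]), hs]) hij
      (by rw [hf.1 2 (by simp [readClause]), hnv]) hn hW hk hm).mono fun t s₁ f₁ ⟨p1, p2⟩ => ?_
    have e17 : s₁.reg 17 = j := by rw [f₁.1 17 (by simp [readClause]), hij]
    simp only [wp_seq, wp_set, wp_ite, wp_store, wp_skip, Expr.eval, Expr.Ok, Expr.cost,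
      BinOp.eval, BinOp.Fits, State.setReg_reg, State.setReg_mem, State.setMem_reg,
      Nat.reduceEqDiff, if_true, if_false, ind_and, ind_not, ind_eq_zero, ind_ne_zero,
      true_and, and_true, e17, p2]
    refine ⟨by omega, fun i hi => ?_⟩
    rw [State.setMem_mem_apply]
    by_cases h : (i : ℕ) = j
    · obtain rfl : i = ⟨j, hj⟩ := Fin.ext h
      simp
    · rw [if_neg (by omega), f₁.2 1 (by simp [readClause])]
      exact hI i (by omega)
  · rintro t s' hf ⟨p1, p2⟩
    have e1 : s'.reg 1 = m := by rw [hf.1 1 (by simp [readClause]), h1]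
    simp only [wp_seq, wp_set, wp_ite, wp_store, wp_skip, Expr.eval, Expr.Ok, Expr.cost,
      BinOp.eval, BinOp.Fits, State.setReg_reg, State.setReg_mem, State.setMem_reg,
      Nat.reduceEqDiff, if_true, if_false, ind_and, ind_not, ind_eq_zero, ind_ne_zero,
      true_and, and_true, e1]
    refine ⟨by omega, by omega, ?_, fun i => ?_, ?_⟩
    · have : m * (k * 40 + 40 + 8) ≤ m * (k * 40 + 60) := Nat.mul_le_mul_left _ (by omega)
      omega
    · simpa [State.setMem_mem] using p2 i i.2
    · simp [State.setMem_mem]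

/-- The decision procedure. -/
def decider (P : Prog) (z : Sizing) (κ k : ℕ) : Cmd :=
  setup z κ k ;; readInput k ;; mainLoop P κ k ;; 0 ::= R[11]

/-- The number of leaves and branchings. -/
noncomputable def nodes (κ k nv : ℕ) : ℕ := ⌊2 * (2 : ℝ) ^ expo κ k (2 * nv)⌋₊

/-- The length of the lists. -/
def listBound (k nv m : ℕ) : ℕ := 2 * maxList k (2 * nv) + 1 + m

/-- The time of the decision procedure. -/
noncomputable def totalCost (P : Prog) (z : Sizing) (κ k n m Dm : ℕ) : ℕ :=
  nodes κ k (z.nv n) * (nodeCost k (z.nv n) (listBound k (z.nv n) m) +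
    2 ^ (z.nv n - 2 * z.g n) * callCost P (z.g n) (leafSize κ k (2 * z.nv n)) (z.T₀ n)) +
  Dm * callCost P (z.g n) (leafSize κ k (2 * z.nv n)) (z.T₀ n) + m * (k * 40 + 60) + 300

theorem decider_spec {W C κ k n m Dm : ℕ} {P : Prog} {z : Sizing} {D T : ℕ → ℕ} (φ : KCNF k n m)
    (hb : 1 ≤ z.b) (hq₀ : 1 ≤ z.q₀) (hc : 1 ≤ z.c)
    (hz : Sizes W (z.nv n) (z.g n) (z.S n) (z.T₀ n) C P D T)
    (hp : Params W κ k (2 * z.nv n) (listBound k (z.nv n) m))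
    (hDm : D (2 * 2 ^ z.g n) = Dm) (hl : leafSize κ k (2 * z.nv n) ≤ Dm)
    (hbase : (nodes κ k (z.nv n) * 2 ^ (z.nv n - 2 * z.g n) + Dm + 2) * z.S n ≤ W)
    (hfree : m + (nodes κ k (z.nv n) + 1) * (2 * listBound k (z.nv n) m) < W)
    (hm : m * k < W) (hk : k < W) :
    wp W (decider P z κ k) φ.input fun t s' => t ≤ totalCost P z κ k n m Dm ∧
      s'.reg 0 ≤ 1 ∧ (s'.reg 0 = 1 ↔ φ.Satisfiable) := by
  have hS1 : 1 ≤ z.S n := Nat.one_le_two_pow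
  have hbase' : nodes κ k (z.nv n) * 2 ^ (z.nv n - 2 * z.g n) + Dm + 2 ≤ W :=
    (Nat.le_mul_of_pos_right _ hS1).trans hbase
  have hSW : z.S n ≤ W := (Nat.le_mul_of_pos_left _ (by omega)).trans hbase
  have hθW : θ κ k ≤ W := by
    refine le_trans (Nat.pow_le_pow_right (by norm_num) ?_) hp.hθW
    rw [mul_comm 2 κ, mul_assoc]
    exact Nat.mul_le_mul_left _ (by omega)
  have hnn : n ≤ z.nv n := Nat.le_add_right _ _
  rw [decider, wp_seq]
  refine (setup_spec (κ := κ) (k := k) (z := z) (n := n) rfl hb hq₀ hc hz.word hSW hz.fuel_le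
    (by omega) hθW).mono fun t₁ s₁ f₁ ⟨p1, p2, p3⟩ => ?_
  have hm1 : ∀ a, s₁.mem a = φ.input.mem a := fun a => f₁.2 a (by simp [setup])
  rw [wp_seq]
  refine (readInput_spec φ (nv := z.nv n) (hm1 0) (by rw [f₁.1 1 (by simp [setup])]; rfl) p2.reg2
    hnn hz.word hk hm (by omega)).mono fun t₂ s₂ f₂ ⟨q1, q2, q3, q4, q5⟩ => ?_
  have hr : ∀ r ∈ [2, 4, 5, 6, 7, 8, 9, 16, 19, 12, 11, 13], s₂.reg r = s₁.reg r := by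
    intro r hr
    refine f₂.1 r ?_
    simp [readInput, readClause] at hr ⊢
    omega
  have e11 : s₂.reg 11 = 0 := by
    rw [hr 11 (by simp), f₁.1 11 (by simp [setup])]; rfl
  have e13 : s₂.reg 13 = 0 := by
    rw [hr 13 (by simp), f₁.1 13 (by simp [setup])]; rfl
  have e12 : s₂.reg 12 = leafSize κ k (2 * z.nv n) := by rw [hr 12 (by simp), p3]
  -- The first list starts at address 0, which is the default value of the cell; `readInput` writes
  -- only its length.
  have e2 : s₂.mem 2 0 = 0 := by rw [f₂.2 2 (by simp [readInput, readClause]), hm1]; rfl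
  have hX : ∀ x ∈ seg (s₂.mem 1) 0 m, ∃ i, x = clauseMask (z.nv n) (φ i) k := by
    intro x hx
    obtain ⟨i, hi, rfl⟩ := mem_seg.1 hx
    exact ⟨⟨i, hi⟩, by rw [zero_add]; exact q2 ⟨i, hi⟩⟩
  have hX' : ∀ i, clauseMask (z.nv n) (φ i) k ∈ seg (s₂.mem 1) 0 m := fun i =>
    mem_seg.2 ⟨i, i.2, by rw [zero_add]; exact q2 i⟩
  have hbud : Budget κ k (2 * z.nv n) (fam (seg (s₂.mem 1) 0 m)) (nodes κ k (z.nv n)) := by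
    refine budget_init fun C hC => ?_
    obtain ⟨x, hx, rfl⟩ := mem_fam.1 hC
    obtain ⟨i, rfl⟩ := hX x hx
    exact ⟨bits_subset_range (clauseMask_lt hnn _ le_rfl), card_clauseMask_le le_rfl⟩
  have hinv : MainInv W (z.nv n) (z.g n) (z.S n) (z.T₀ n) κ k (listBound k (z.nv n) m) Dm
      φ.Satisfiable (fun _ => nodes κ k (z.nv n)) s₂ := by
    refine ⟨p2.congr fun r h => hr r ?_, ⟨fun i hi => ?_, ?_, ?_⟩, e12.ge, e12.trans_le hl,
      fun a i ha hi => ?_, by omega, ?_, ?_⟩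
    · simp at h ⊢; omega
    · obtain rfl : i = 0 := by omega
      rw [e2, q5, q3]
      refine ⟨by omega, by rw [listBound]; omega, fun x hx => ?_, hbud⟩
      obtain ⟨i, rfl⟩ := hX x hx
      exact clauseMask_lt hnn _ le_rfl
    · simpa [q3, q4] using hfree
    · have : nodes κ k (z.nv n) + 1 ≤ (nodes κ k (z.nv n) + 1) * (2 * listBound k (z.nv n) m) :=
        Nat.le_mul_of_pos_right _ (by rw [listBound]; omega)
      simp only [q4, Finset.range_one, Finset.sum_singleton]
      omega
    · rw [f₂.2 a, hm1]
      · obtain ⟨a, rfl⟩ : ∃ b, a = b + 1 := ⟨a - 1, by omega⟩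
        rfl
      · simp [readInput, readClause]; omega
    · rw [e13, q4, Finset.range_one, Finset.sum_singleton, zero_add]
      refine le_trans (Nat.mul_le_mul_right _ ?_) hbase
      omega
    · rw [e11, satisfiable_iff_hits φ hnn (g := z.g n) (by have := z.two_mul_g_le n; omega)]
      simp only [zero_ne_one, false_or]
      have : SatMasks (z.nv n) (z.g n) (fam (seg (s₂.mem 1) 0 m)) ↔
          ∃ u < 2 ^ z.g n, ∃ w < 2 ^ (z.nv n - z.g n), ∀ i, ¬ Disjoint
            (bits (clauseMask (z.nv n) (φ i) k))
            (bits (rowMask (z.nv n) (z.g n) u) ∪ bits (colMask (z.nv n) (z.g n) w)) := by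
        refine exists_congr fun u => and_congr_right fun _ => exists_congr fun w =>
          and_congr_right fun _ => ⟨fun h i => h _ (mem_fam.2 ⟨_, hX' i, rfl⟩), fun h C hC => ?_⟩
        obtain ⟨x, hx, rfl⟩ := mem_fam.1 hC
        obtain ⟨i, rfl⟩ := hX x hx
        exact h i
      rw [← this, StackSat, q4]
      constructor
      · rintro ⟨i, hi, h⟩
        obtain rfl : i = 0 := by omega
        rwa [e2, q5] at h
      · intro h
        exact ⟨0, one_pos, by rwa [e2, q5]⟩
  rw [wp_seq]
  refine (mainLoop_spec hz hp hDm hinv).mono fun t₃ s₃ _ ⟨r1, r2, r3⟩ => ?_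
  rw [wp_set]
  refine ⟨trivial, ?_, by simpa using r2, by simpa using r3⟩
  rw [credit, q4, Finset.range_one, Finset.sum_singleton] at r1
  have : (Dm - s₂.reg 12) * callCost P (z.g n) (leafSize κ k (2 * z.nv n)) (z.T₀ n) ≤
      Dm * callCost P (z.g n) (leafSize κ k (2 * z.nv n)) (z.T₀ n) :=
    Nat.mul_le_mul_right _ (by omega)
  rw [totalCost]
  simp only [Expr.cost]
  omega

end WordRAM

/-! ### Polynomial bounds -/

/-- `f` is at most a polynomial in `y`. -/
def PolyBdd {ι : Type*} (y f : ι → ℕ) : Prop := ∃ K, ∀ i, f i ≤ K * y i ^ K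

namespace PolyBdd

variable {ι : Type*} {y f g : ι → ℕ}

theorem mono (hg : PolyBdd y g) (h : ∀ i, f i ≤ g i) : PolyBdd y f := by
  obtain ⟨K, hK⟩ := hg
  exact ⟨K, fun i => (h i).trans (hK i)⟩

theorem const (hy : ∀ i, 1 ≤ y i) (c : ℕ) : PolyBdd y fun _ => c :=
  ⟨c, fun i => Nat.le_mul_of_pos_right _ (pow_pos (hy i) _)⟩

theorem self : PolyBdd y y := ⟨1, fun i => by simp⟩

theorem add (hy : ∀ i, 1 ≤ y i) (hf : PolyBdd y f) (hg : PolyBdd y g) :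
    PolyBdd y fun i => f i + g i := by
  obtain ⟨K, hK⟩ := hf
  obtain ⟨K', hK'⟩ := hg
  refine ⟨K + K', fun i => ?_⟩
  rw [add_mul]
  refine Nat.add_le_add ((hK i).trans ?_) ((hK' i).trans ?_)
  · exact Nat.mul_le_mul_left _ (Nat.pow_le_pow_right (hy i) (by omega))
  · exact Nat.mul_le_mul_left _ (Nat.pow_le_pow_right (hy i) (by omega))

theorem mul (hy : ∀ i, 1 ≤ y i) (hf : PolyBdd y f) (hg : PolyBdd y g) :
    PolyBdd y fun i => f i * g i := by
  obtain ⟨K, hK⟩ := hf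
  obtain ⟨K', hK'⟩ := hg
  refine ⟨K * K' + (K + K'), fun i => (Nat.mul_le_mul (hK i) (hK' i)).trans ?_⟩
  rw [mul_mul_mul_comm, ← pow_add]
  exact Nat.mul_le_mul (by omega) (Nat.pow_le_pow_right (hy i) (by omega))

theorem pow (hy : ∀ i, 1 ≤ y i) (hf : PolyBdd y f) (e : ℕ) : PolyBdd y fun i => f i ^ e := by
  induction e with
  | zero => simpa using const hy 1
  | succ e ih => simpa only [pow_succ] using ih.mul hy hf

/-- A common exponent, without a constant factor. -/
theorem exists_pow (hy : ∀ i, 2 ≤ y i) (hf : PolyBdd y f) : ∃ K, ∀ K' ≥ K, ∀ i, f i ≤ y i ^ K' := by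
  obtain ⟨K, hK⟩ := hf
  refine ⟨2 * K, fun K' h i => (hK i).trans ?_⟩
  calc K * y i ^ K ≤ y i ^ K * y i ^ K := Nat.mul_le_mul_right _ (Nat.lt_pow_self (hy i)).le
    _ = y i ^ (2 * K) := by rw [← pow_add, two_mul]
    _ ≤ y i ^ K' := Nat.pow_le_pow_right (by have := hy i; omega) h

end PolyBdd

/-! ### The choice of the parameters -/

open Sparsify WordRAM

/-- The sparsification parameter. -/
theorem exists_kappa (k : ℕ) {ε : ℝ} (hε : 0 < ε) : ∃ κ : ℕ, k + 1 ≤ κ ∧ 4 * k ≤ 2 ^ κ ∧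
    ∀ nv : ℕ, expo κ k (2 * nv) ≤ ε * nv := by
  -- The coefficient of `nv` in the exponent tends to 0, as `κ / 2 ^ κ` does for fixed `k`.
  have h1 : Filter.Tendsto (fun κ : ℕ => 16 * (k : ℝ) ^ 2 * ((κ : ℝ) ^ 1 / 2 ^ κ)) Filter.atTop
      (nhds (16 * (k : ℝ) ^ 2 * 0)) :=
    (tendsto_pow_const_div_const_pow_of_one_lt 1 one_lt_two).const_mul _
  rw [mul_zero] at h1
  obtain ⟨κ, h2, h3⟩ := ((h1.eventually_lt_const hε).and
    (Filter.eventually_ge_atTop (4 * k + 1))).exists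
  refine ⟨κ, by omega, (by omega : 4 * k ≤ κ).trans Nat.lt_two_pow_self.le, fun nv => ?_⟩
  have h4 : expo κ k (2 * nv) = 16 * (k : ℝ) ^ 2 * ((κ : ℝ) ^ 1 / 2 ^ κ) * nv := by
    rw [expo]
    push_cast
    ring
  rw [h4]
  gcongr

/-- The running time of the matrix-vector product on instances of size `2 ^ (b q)`. -/
theorem exists_time_bound {T : ℕ → ℕ} {α : ℝ} {b : ℕ} (hb : 1 ≤ b) (hbα : 1 / (b : ℝ) ≤ α)
    (hT : Asymptotics.IsBigO Filter.atTop (fun n : ℕ => (T n : ℝ))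
      (fun n : ℕ => (n : ℝ) ^ (2 - α))) :
    ∃ c q₀ : ℕ, 1 ≤ c ∧ ∀ q ≥ q₀, T (2 ^ (b * q)) ≤ c * 2 ^ ((2 * b - 1) * q) := by
  obtain ⟨c, hc⟩ := hT.bound
  obtain ⟨N₀, hN₀⟩ := Filter.eventually_atTop.1 hc
  refine ⟨⌈c⌉₊ + 1, N₀, by omega, fun q hq => ?_⟩
  have h1 : N₀ ≤ 2 ^ (b * q) := by
    refine hq.le.trans (Nat.lt_two_pow_self.le.trans (Nat.pow_le_pow_right (by norm_num) ?_))
    exact Nat.le_mul_of_pos_left _ hb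
  have h2 := hN₀ _ h1
  rw [Real.norm_of_nonneg (Nat.cast_nonneg _), Real.norm_of_nonneg (by positivity)] at h2
  have hb' : (0 : ℝ) < b := by exact_mod_cast hb
  have h3 : ((2 ^ (b * q) : ℕ) : ℝ) ^ (2 - α) ≤ ((2 ^ ((2 * b - 1) * q) : ℕ) : ℝ) := by
    push_cast
    rw [← Real.rpow_natCast, ← Real.rpow_natCast, ← Real.rpow_mul (by norm_num)]
    refine Real.rpow_le_rpow_of_exponent_le (by norm_num) ?_
    rw [Nat.cast_mul, Nat.cast_mul, Nat.cast_sub (by omega)]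
    push_cast
    -- This is what `b q (2 - α) ≤ (2 b - 1) q` amounts to.
    have h4 : 1 ≤ α * b := by rwa [div_le_iff₀ hb'] at hbα
    have h5 : (q : ℝ) * 1 ≤ q * (α * b) := by gcongr
    nlinarith
  have h6 : (T (2 ^ (b * q)) : ℝ) ≤ ((⌈c⌉₊ + 1) * 2 ^ ((2 * b - 1) * q) : ℕ) := by
    refine h2.trans ?_
    rw [Nat.cast_mul]
    refine mul_le_mul ?_ h3 (by positivity) (by positivity)
    push_cast
    have := Nat.le_ceil c
    linarith
  exact_mod_cast h6

/-- The dimension exceeds every multiple of the logarithm. -/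
theorem exists_dim_bound {D : ℕ → ℕ} (hD : Asymptotics.IsLittleO Filter.atTop
      (fun n : ℕ => Real.log (n : ℝ)) (fun n : ℕ => (D n : ℝ))) {b : ℕ} (hb : 1 ≤ b) (K : ℕ) :
    ∃ q₀ : ℕ, ∀ q ≥ q₀, K * (b * q) ≤ D (2 ^ (b * q)) := by
  -- The factor 2 compensates for `log 2`, which exceeds `1 / 2`; `K + 1` avoids division by zero.
  have hK : (0 : ℝ) < 1 / (2 * (K + 1)) := by positivity
  obtain ⟨N₀, hN₀⟩ := Filter.eventually_atTop.1 (hD.def hK)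
  refine ⟨N₀, fun q hq => ?_⟩
  have h1 : N₀ ≤ 2 ^ (b * q) := by
    refine hq.le.trans (Nat.lt_two_pow_self.le.trans (Nat.pow_le_pow_right (by norm_num) ?_))
    exact Nat.le_mul_of_pos_left _ hb
  have h2 := hN₀ _ h1
  rw [Real.norm_of_nonneg (Real.log_natCast_nonneg _), Real.norm_of_nonneg (Nat.cast_nonneg _)]
      at h2
  push_cast at h2
  rw [Real.log_pow, one_div, inv_mul_eq_div, le_div_iff₀ (by positivity)] at h2
  have h3 := Real.log_two_gt_d9
  have h4 : (K : ℝ) * (b * q : ℕ) ≤ (D (2 ^ (b * q)) : ℝ) := by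
    refine le_trans ?_ h2
    have h5 : (0 : ℝ) ≤ (b * q : ℕ) := Nat.cast_nonneg _
    have h6 : (0 : ℝ) ≤ K := Nat.cast_nonneg _
    have h7 : (1 : ℝ) ≤ Real.log 2 * 2 := by linarith
    calc (K : ℝ) * (b * q : ℕ) ≤ (b * q : ℕ) * (K + 1) * 1 := by nlinarith
      _ ≤ (b * q : ℕ) * (K + 1) * (Real.log 2 * 2) := by gcongr
      _ = _ := by ring
  exact_mod_cast h4

/-! ### Sizes of the instances and the exponent of the running time -/

namespace WordRAM

open Sparsify

theorem Computes.of_exponent {C C' : ℕ} {P : Prog} {D T : ℕ → ℕ} (h : Computes C P D T)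
    (hC : C ≤ C') : Computes C' P D T := by
  intro n d hd x z
  obtain ⟨t, s, he, h'⟩ := h n d hd x z
  exact ⟨t, s, he.mono (Nat.pow_le_pow_right (by omega) hC), h'⟩

namespace Sizing

variable {z : Sizing}

/-- Because the dimension is at most the running time, both the word bound of the simulated machine
and the size of an instance are a power of `2 ^ q` times a constant. In `S`, the parameter `A`
absorbs the powers and `B` the constants and the registers of `P`. -/
theorem sizes {C B₀ W n : ℕ} {P : Prog} {D T : ℕ → ℕ} (hcomp : Computes C P D T) (hC : 1 ≤ C)
    (hb : 1 ≤ z.b) (hq₀ : 1 ≤ z.q₀) (hA : 3 * z.b * (C + 1) ≤ z.A)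
    (hB : B₀ + (z.c + 3) ^ C ≤ z.B) (hP : P.Below B₀)
    (hT : T (2 ^ (z.b * z.q n)) ≤ z.c * 2 ^ ((2 * z.b - 1) * z.q n))
    (hDT : D (2 ^ (z.b * z.q n)) ≤ T (2 ^ (z.b * z.q n)))
    (hW : 2 ^ (2 * z.nv n) ≤ W) (hTW : z.T₀ n ≤ W) :
    Sizes W (z.nv n) (z.g n) (z.S n) (z.T₀ n) C P D T := by
  have hN := z.two_mul_two_pow_g n hb hq₀
  have hB1 : z.B < 2 ^ z.B := Nat.lt_two_pow_self
  have hS : z.S n = 2 ^ (z.A * z.q n) * 2 ^ z.B := by rw [S, pow_add]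
  have hSB : 2 ^ z.B ≤ z.S n := by rw [hS]; exact Nat.le_mul_of_pos_left _ (by positivity)
  have h1 : ∀ e, e ≤ z.A * z.q n → 2 ^ e ≤ 2 ^ (z.A * z.q n) := fun e he =>
    Nat.pow_le_pow_right (by norm_num) he
  have hpow : (2 : ℕ) ^ (z.b * z.q n) ≤ 2 ^ (2 * z.b * z.q n) :=
    Nat.pow_le_pow_right (by norm_num) (Nat.mul_le_mul_right _ (by omega))
  have hpow' : (2 : ℕ) ^ ((2 * z.b - 1) * z.q n) ≤ 2 ^ (2 * z.b * z.q n) :=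
    Nat.pow_le_pow_right (by norm_num) (Nat.mul_le_mul_right _ (by omega))
  have hD : D (2 ^ (z.b * z.q n)) ≤ z.c * 2 ^ (2 * z.b * z.q n) :=
    hDT.trans (hT.trans (Nat.mul_le_mul_left _ hpow'))
  have hone : 1 ≤ 2 ^ (2 * z.b * z.q n) := Nat.one_le_two_pow
  refine ⟨hcomp, hC, z.two_mul_g_le n, hW, hP.mono (by
    have : 0 < (z.c + 3) ^ C := by positivity
    omega), ?_, ?_, ?_, hTW⟩
  · rw [hN, hS]
    calc (2 ^ (z.b * z.q n) + D (2 ^ (z.b * z.q n)) + 2) ^ C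
        ≤ ((z.c + 3) * 2 ^ (2 * z.b * z.q n)) ^ C := by
          refine Nat.pow_le_pow_left ?_ _
          have : (z.c + 3) * 2 ^ (2 * z.b * z.q n) =
            z.c * 2 ^ (2 * z.b * z.q n) + 3 * 2 ^ (2 * z.b * z.q n) := by ring
          omega
      _ = 2 ^ (2 * z.b * z.q n * C) * (z.c + 3) ^ C := by rw [mul_pow, ← pow_mul, mul_comm]
      _ ≤ 2 ^ (z.A * z.q n) * (z.c + 3) ^ C := by
          refine Nat.mul_le_mul_right _ (h1 _ ?_)
          calc 2 * z.b * z.q n * C = 2 * z.b * C * z.q n := by ring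
            _ ≤ 3 * z.b * (C + 1) * z.q n := by gcongr <;> omega
            _ ≤ _ := Nat.mul_le_mul_right _ hA
      _ < 2 ^ (z.A * z.q n) * 2 ^ z.B := by
          refine Nat.mul_lt_mul_of_pos_left ?_ (by positivity)
          omega
  · rw [hN, hS]
    calc 2 ^ (z.b * z.q n) * (D (2 ^ (z.b * z.q n)) + 1)
        ≤ 2 ^ (z.b * z.q n) * ((z.c + 1) * 2 ^ (2 * z.b * z.q n)) := by
          refine Nat.mul_le_mul_left _ ?_
          rw [add_mul]
          omega
      _ = 2 ^ (3 * z.b * z.q n) * (z.c + 1) := by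
          rw [show 3 * z.b * z.q n = z.b * z.q n + 2 * z.b * z.q n by ring, pow_add]; ring
      _ ≤ 2 ^ (z.A * z.q n) * 2 ^ z.B := by
          refine Nat.mul_le_mul (h1 _ (Nat.mul_le_mul_right _ ?_)) ?_
          · exact (Nat.le_mul_of_pos_right _ (by omega)).trans hA
          · have : z.c + 3 ≤ (z.c + 3) ^ C := Nat.le_self_pow (by omega) _
            omega
  · rw [hN]
    exact Nat.lt_succ_of_le hT

theorem nv_le (hb : 1 ≤ z.b) (hq₀ : 1 ≤ z.q₀) (n : ℕ) : z.nv n ≤ 8 * (z.b * z.q n) := by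
  have h1 : n < 4 * z.b * (n / (4 * z.b)) + 4 * z.b := Nat.lt_mul_div_succ n (by omega)
  have h2 : z.b ≤ z.b * z.q₀ := Nat.le_mul_of_pos_right _ hq₀
  have h3 : 8 * (z.b * z.q n) = 2 * (4 * z.b * (n / (4 * z.b))) + 8 * (z.b * z.q₀) := by
    rw [q]; ring
  have h4 : 2 * z.b * z.q₀ = 2 * (z.b * z.q₀) := by ring
  rw [nv, h3, h4]
  omega

/-- Here sparsification meets the dimension: the instances have `2 ^ (b q)` points, so the bound is
a constant times the logarithm of their number, which `D` eventually exceeds. -/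
theorem leafSize_le {κ k : ℕ} (hb : 1 ≤ z.b) (hq₀ : 1 ≤ z.q₀) (n : ℕ) :
    leafSize κ k (2 * z.nv n) ≤ (1 + 16 * k * θ κ k) * (z.b * z.q n) := by
  have h1 : 1 * 1 ≤ z.b * z.q n := Nat.mul_le_mul hb (hq₀.trans (Nat.le_add_left _ _))
  have h2 : k * (2 * z.nv n) * θ κ k ≤ k * (2 * (8 * (z.b * z.q n))) * θ κ k := by
    gcongr
    exact z.nv_le hb hq₀ n
  have h3 : (1 + 16 * k * θ κ k) * (z.b * z.q n) =
      z.b * z.q n + k * (2 * (8 * (z.b * z.q n))) * θ κ k := by ring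
  rw [leafSize, h3]
  omega

end Sizing

/-- The padding variables add only `q₀ / 4` to the exponent, that is, a constant factor. -/
theorem nodes_le {z : Sizing} {κ k : ℕ} (hb : 1 ≤ z.b)
    (hκ : ∀ nv : ℕ, expo κ k (2 * nv) ≤ 1 / (8 * z.b) * nv) (n : ℕ) :
    (nodes κ k (z.nv n) : ℝ) ≤ 2 ^ (z.q₀ + 1) * (2 : ℝ) ^ (1 / (8 * z.b) * (n : ℝ)) := by
  have hb' : (1 : ℝ) ≤ z.b := by exact_mod_cast hb
  have h2 : expo κ k (2 * z.nv n) ≤ z.q₀ + 1 / (8 * z.b) * (n : ℝ) := by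
    refine (hκ _).trans ?_
    rw [Sizing.nv]
    push_cast
    have : 1 / (8 * (z.b : ℝ)) * (n + 2 * z.b * z.q₀) = 1 / (8 * z.b) * n + z.q₀ / 4 := by
      field_simp
      ring
    rw [this]
    have : (0 : ℝ) ≤ z.q₀ := Nat.cast_nonneg _
    linarith
  calc (nodes κ k (z.nv n) : ℝ) ≤ 2 * (2 : ℝ) ^ expo κ k (2 * z.nv n) :=
        Nat.floor_le (by positivity)
    _ ≤ 2 * (2 : ℝ) ^ (z.q₀ + 1 / (8 * z.b) * (n : ℝ)) := by
        gcongr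
        norm_num
    _ = _ := by
        rw [Real.rpow_add (by norm_num), Real.rpow_natCast, pow_succ]
        ring

/-- The polynomial factor of the time of a call. -/
def callPoly (P : Prog) (z : Sizing) (κ k n : ℕ) : ℕ :=
  leafSize κ k (2 * z.nv n) * 30 + 350 + P.simCost * (z.c + 2)

theorem callCost_le {P : Prog} {z : Sizing} {κ k n : ℕ} (hb : 1 ≤ z.b) (hq₀ : 1 ≤ z.q₀) :
    callCost P (z.g n) (leafSize κ k (2 * z.nv n)) (z.T₀ n) ≤
      callPoly P z κ k n * 2 ^ ((2 * z.b - 1) * z.q n) := by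
  have h1 : (2 : ℕ) ^ (z.b * z.q n) ≤ 2 ^ ((2 * z.b - 1) * z.q n) :=
    Nat.pow_le_pow_right (by norm_num) (Nat.mul_le_mul_right _ (by omega))
  have h2 : 1 ≤ 2 ^ ((2 * z.b - 1) * z.q n) := Nat.one_le_two_pow
  rw [callCost, callPoly, z.two_mul_two_pow_g n hb hq₀, Sizing.T₀]
  generalize 2 ^ ((2 * z.b - 1) * z.q n) = x at *
  generalize 2 ^ (z.b * z.q n) = y at *
  calc y * (leafSize κ k (2 * z.nv n) * 30 + 150) + P.simCost * (z.c * x + 1 + 1) + 200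
      ≤ x * (leafSize κ k (2 * z.nv n) * 30 + 150) + P.simCost * (z.c * x + 2 * x) + 200 * x := by
        refine Nat.add_le_add (Nat.add_le_add (Nat.mul_le_mul_right _ h1)
          (Nat.mul_le_mul_left _ ?_)) ?_ <;> omega
    _ = _ := by ring

/-- The polynomial factor of the running time. -/
def timePoly (P : Prog) (z : Sizing) (κ k n m : ℕ) : ℕ :=
  2 ^ (z.q₀ + 1) * nodeCost k (z.nv n) (listBound k (z.nv n) m) +
    2 ^ (z.q₀ + 1) * 2 ^ (2 * z.b * z.q₀ + 2) * callPoly P z κ k n +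
    z.c * 2 ^ (4 * z.b * z.q₀) * callPoly P z κ k n + m * (k * 40 + 60) + 300

/-- Write `a = n / (8 b)`, so that `q` is `2 a` up to a constant. The tree has about `2 ^ a` nodes,
and all blocks of a leaf together cost about `2 ^ (n - q) ≈ 2 ^ (n - 2 a)`. The failed calls cost
about `2 ^ ((4 b - 2) q) ≈ 2 ^ (n - 4 a)`. Everything stays within `2 ^ (n - a)` up to polynomial
factors. -/
theorem totalCost_le {P : Prog} {z : Sizing} {κ k n m Dm : ℕ} (hb : 1 ≤ z.b) (hq₀ : 1 ≤ z.q₀)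
    (hκ : ∀ nv : ℕ, expo κ k (2 * nv) ≤ 1 / (8 * z.b) * nv)
    (hDm : Dm ≤ z.c * 2 ^ ((2 * z.b - 1) * z.q n)) :
    (totalCost P z κ k n m Dm : ℝ) ≤
      timePoly P z κ k n m * (2 : ℝ) ^ ((1 - 1 / (8 * z.b)) * (n : ℝ)) := by
  have hb' : (1 : ℝ) ≤ z.b := by exact_mod_cast hb
  set a : ℝ := 1 / (8 * z.b) * (n : ℝ) with ha
  have ha0 : 0 ≤ a := by positivity
  have han : 8 * z.b * a = n := by rw [ha]; field_simp
  have han' : 8 * a ≤ n := by rw [← han]; nlinarith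
  have he : (1 - 1 / (8 * z.b)) * (n : ℝ) = n - a := by rw [ha]; ring
  rw [he]
  have hq1 : 2 * a ≤ z.q n := by
    have h1 : n < 4 * z.b * (n / (4 * z.b)) + 4 * z.b := Nat.lt_mul_div_succ n (by omega)
    have h2 : (n : ℝ) ≤ 4 * z.b * (z.q n : ℕ) := by
      have : 4 * z.b * 1 ≤ 4 * z.b * z.q₀ := Nat.mul_le_mul_left _ hq₀
      have h3 : n ≤ 4 * z.b * z.q n := by rw [Sizing.q, mul_add]; omega
      exact_mod_cast h3
    have h3 : 4 * z.b * (2 * a) ≤ 4 * z.b * (z.q n : ℝ) := by linarith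
    exact le_of_mul_le_mul_left h3 (by positivity)
  have hq2 : (z.q n : ℝ) ≤ 2 * a + z.q₀ := by
    have h1 : ((n / (4 * z.b) : ℕ) : ℝ) ≤ n / (4 * z.b : ℕ) := Nat.cast_div_le
    rw [Sizing.q]
    push_cast at h1 ⊢
    have : (n : ℝ) / (4 * z.b) = 2 * a := by rw [← han]; field_simp; ring
    linarith
  have hN := nodes_le hb hκ n
  rw [← ha] at hN
  set E : ℝ := (2 : ℝ) ^ ((n : ℝ) - a) with hE
  have hE1 : 1 ≤ E := Real.one_le_rpow (by norm_num) (by linarith)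
  have hNE : (nodes κ k (z.nv n) : ℝ) ≤ 2 ^ (z.q₀ + 1) * E := by
    refine hN.trans ?_
    gcongr
    exact Real.rpow_le_rpow_of_exponent_le (by norm_num) (by linarith)
  -- The exponent `nv - 2 g + (2 b - 1) q` equals `n + 2 b q₀ + 2 - q`, and `q ≥ 2 a` leaves a
  -- saving of `a` after the tree is paid.
  have hX1 : (nodes κ k (z.nv n) : ℝ) * (2 ^ (z.nv n - 2 * z.g n) *
      2 ^ ((2 * z.b - 1) * z.q n)) ≤ 2 ^ (z.q₀ + 1) * 2 ^ (2 * z.b * z.q₀ + 2) * E := by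
    have h1 : (2 : ℝ) ^ (z.nv n - 2 * z.g n) * 2 ^ ((2 * z.b - 1) * z.q n) ≤
        2 ^ (2 * z.b * z.q₀ + 2) * (2 : ℝ) ^ ((n : ℝ) - 2 * a) := by
      rw [← pow_add, ← Real.rpow_natCast, ← Real.rpow_natCast, ← Real.rpow_add (by norm_num)]
      refine Real.rpow_le_rpow_of_exponent_le (by norm_num) ?_
      have hbq : 1 * 1 ≤ z.b * z.q n := Nat.mul_le_mul hb (hq₀.trans (Nat.le_add_left _ _))
      have hg : z.g n = z.b * z.q n - 1 := rfl
      rw [Nat.cast_add, Nat.cast_sub (z.two_mul_g_le n), Nat.cast_mul, Nat.cast_mul, hg,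
        Nat.cast_sub (by omega : 1 ≤ z.b * z.q n), Nat.cast_sub (by omega : 1 ≤ 2 * z.b),
        Sizing.nv]
      push_cast
      nlinarith
    calc _ ≤ (2 ^ (z.q₀ + 1) * (2 : ℝ) ^ a) *
          (2 ^ (2 * z.b * z.q₀ + 2) * (2 : ℝ) ^ ((n : ℝ) - 2 * a)) := by gcongr
      _ = 2 ^ (z.q₀ + 1) * 2 ^ (2 * z.b * z.q₀ + 2) *
          ((2 : ℝ) ^ a * (2 : ℝ) ^ ((n : ℝ) - 2 * a)) := by ring
      _ = _ := by
        rw [← Real.rpow_add (by norm_num), hE]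
        congr 2
        ring
  -- Failed calls cost the square of the time of one call. This is affordable because `q` is about
  -- `n / (4 b)`, not `n / (2 b)`.
  have hX2 : (Dm : ℝ) * 2 ^ ((2 * z.b - 1) * z.q n) ≤ z.c * 2 ^ (4 * z.b * z.q₀) * E := by
    have h1 : (2 : ℝ) ^ ((2 * z.b - 1) * z.q n) * 2 ^ ((2 * z.b - 1) * z.q n) ≤
        2 ^ (4 * z.b * z.q₀) * E := by
      rw [hE, ← pow_add, ← Real.rpow_natCast, ← Real.rpow_natCast, ← Real.rpow_add (by norm_num)]
      refine Real.rpow_le_rpow_of_exponent_le (by norm_num) ?_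
      rw [Nat.cast_add, Nat.cast_mul, Nat.cast_sub (by omega : 1 ≤ 2 * z.b)]
      push_cast
      have h2 : (4 * z.b - 2) * (z.q n : ℝ) ≤ (4 * z.b - 2) * (2 * a + z.q₀) :=
        mul_le_mul_of_nonneg_left hq2 (by linarith)
      have h3 : (0 : ℝ) ≤ z.q₀ := Nat.cast_nonneg _
      nlinarith
    have h2 : (Dm : ℝ) ≤ z.c * 2 ^ ((2 * z.b - 1) * z.q n) := by exact_mod_cast hDm
    calc _ ≤ (z.c * (2 : ℝ) ^ ((2 * z.b - 1) * z.q n)) * 2 ^ ((2 * z.b - 1) * z.q n) := by gcongr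
      _ = z.c * ((2 : ℝ) ^ ((2 * z.b - 1) * z.q n) * 2 ^ ((2 * z.b - 1) * z.q n)) := by ring
      _ ≤ z.c * (2 ^ (4 * z.b * z.q₀) * E) := by gcongr
      _ = _ := by ring
  have hcall : (callCost P (z.g n) (leafSize κ k (2 * z.nv n)) (z.T₀ n) : ℝ) ≤
      callPoly P z κ k n * 2 ^ ((2 * z.b - 1) * z.q n) := by
    exact_mod_cast callCost_le hb hq₀
  rw [totalCost, timePoly]
  push_cast
  set cc := (callCost P (z.g n) (leafSize κ k (2 * z.nv n)) (z.T₀ n) : ℝ)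
  set cp := (callPoly P z κ k n : ℝ)
  set nc := (nodeCost k (z.nv n) (listBound k (z.nv n) m) : ℝ)
  have hY1 : (nodes κ k (z.nv n) : ℝ) * nc ≤ 2 ^ (z.q₀ + 1) * nc * E := by
    calc _ ≤ (2 ^ (z.q₀ + 1) * E) * nc := by gcongr
      _ = _ := by ring
  have hY2 : (nodes κ k (z.nv n) : ℝ) * (2 ^ (z.nv n - 2 * z.g n) * cc) ≤
      2 ^ (z.q₀ + 1) * 2 ^ (2 * z.b * z.q₀ + 2) * cp * E := by
    calc _ ≤ (nodes κ k (z.nv n) : ℝ) * (2 ^ (z.nv n - 2 * z.g n) *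
          (cp * 2 ^ ((2 * z.b - 1) * z.q n))) := by gcongr
      _ = cp * ((nodes κ k (z.nv n) : ℝ) * (2 ^ (z.nv n - 2 * z.g n) *
          2 ^ ((2 * z.b - 1) * z.q n))) := by ring
      _ ≤ cp * (2 ^ (z.q₀ + 1) * 2 ^ (2 * z.b * z.q₀ + 2) * E) := by gcongr
      _ = _ := by ring
  have hY3 : (Dm : ℝ) * cc ≤ z.c * 2 ^ (4 * z.b * z.q₀) * cp * E := by
    calc _ ≤ (Dm : ℝ) * (cp * 2 ^ ((2 * z.b - 1) * z.q n)) := by gcongr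
      _ = cp * ((Dm : ℝ) * 2 ^ ((2 * z.b - 1) * z.q n)) := by ring
      _ ≤ cp * (z.c * 2 ^ (4 * z.b * z.q₀) * E) := by gcongr
      _ = _ := by ring
  have hY4 : (m : ℝ) * (k * 40 + 60) + 300 ≤ (m * (k * 40 + 60) + 300) * E :=
    le_mul_of_one_le_right (by positivity) hE1
  linarith

end WordRAM

/-! ### Polynomial growth of the running time and of the word size -/

namespace WordRAM

open Sparsify

theorem timePoly_polyBdd (P : Prog) (z : Sizing) (κ k : ℕ) :
    PolyBdd (fun p : ℕ × ℕ => p.1 + p.2 + 1) fun p => timePoly P z κ k p.1 p.2 := by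
  have hy : ∀ p : ℕ × ℕ, 1 ≤ p.1 + p.2 + 1 := fun p => by omega
  have hn : PolyBdd (fun p : ℕ × ℕ => p.1 + p.2 + 1) fun p => p.1 :=
    PolyBdd.self.mono fun p => by omega
  have hm : PolyBdd (fun p : ℕ × ℕ => p.1 + p.2 + 1) fun p => p.2 :=
    PolyBdd.self.mono fun p => by omega
  simp only [timePoly, nodeCost, popCost, listBound, maxList, callPoly, leafSize, Sizing.nv]
  repeat' first
    | with_reducible exact PolyBdd.const hy _
    | with_reducible exact hn
    | with_reducible exact hm
    | with_reducible refine PolyBdd.add hy ?_ ?_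
    | with_reducible refine PolyBdd.mul hy ?_ ?_
    | with_reducible refine PolyBdd.pow hy ?_ _

/-- A word size that suffices for the decision procedure. -/
def wordNeed (z : Sizing) (κ k n m : ℕ) : ℕ :=
  2 ^ (2 * z.nv n) + (z.c * 2 ^ ((2 * z.b - 1) * (n + z.q₀)) + 1) +
    (κ + (k + 1) * (k + 1) + 2 ^ (2 * κ * k)) +
    (2 ^ (n + (z.q₀ + 1)) * 2 ^ z.nv n + z.c * 2 ^ ((2 * z.b - 1) * (n + z.q₀)) + 2) *
      2 ^ (z.A * (n + z.q₀) + z.B) +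
    (m + (2 ^ (n + (z.q₀ + 1)) + 1) * (2 * listBound k (z.nv n) m)) +
    m * k + k + (2 * n + m + 2)

theorem wordNeed_le {z : Sizing} {κ k n m W : ℕ} (h : wordNeed z κ k n m ≤ W) :
    2 ^ (2 * z.nv n) ≤ W ∧ z.c * 2 ^ ((2 * z.b - 1) * (n + z.q₀)) + 1 ≤ W ∧
    κ + (k + 1) * (k + 1) + 2 ^ (2 * κ * k) ≤ W ∧
    (2 ^ (n + (z.q₀ + 1)) * 2 ^ z.nv n + z.c * 2 ^ ((2 * z.b - 1) * (n + z.q₀)) + 2) *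
      2 ^ (z.A * (n + z.q₀) + z.B) ≤ W ∧
    m + (2 ^ (n + (z.q₀ + 1)) + 1) * (2 * listBound k (z.nv n) m) < W ∧ m * k < W ∧ k < W ∧
    2 * n + m + 1 ≤ W := by
  -- With variables in place of the summands, `omega` does not have to handle the powers and
  -- products.
  have split : ∀ a b c d e f g h i W : ℕ, a + b + c + d + e + f + g + (h + i + 2) ≤ W →
      a ≤ W ∧ b ≤ W ∧ c ≤ W ∧ d ≤ W ∧ e < W ∧ f < W ∧ g < W ∧ h + i + 1 ≤ W := by omega
  exact split _ _ _ _ _ _ _ _ _ _ h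

/-- All exponents are linear in `n`, so the exponential terms are constants times powers of `2 ^ n`.
This is just what words of `O(n + log m)` bits permit. -/
theorem wordNeed_polyBdd (z : Sizing) (κ k : ℕ) :
    PolyBdd (fun p : ℕ × ℕ => 2 ^ p.1 * (p.2 + 2)) fun p => wordNeed z κ k p.1 p.2 := by
  have hy : ∀ p : ℕ × ℕ, 1 ≤ 2 ^ p.1 * (p.2 + 2) := fun p => Nat.mul_pos (by positivity) (by omega)
  have hE : PolyBdd (fun p : ℕ × ℕ => 2 ^ p.1 * (p.2 + 2)) fun p => 2 ^ p.1 :=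
    PolyBdd.self.mono fun p => Nat.le_mul_of_pos_right _ (by omega)
  have hn : PolyBdd (fun p : ℕ × ℕ => 2 ^ p.1 * (p.2 + 2)) fun p => p.1 :=
    hE.mono fun p => Nat.lt_two_pow_self.le
  have hm : PolyBdd (fun p : ℕ × ℕ => 2 ^ p.1 * (p.2 + 2)) fun p => p.2 :=
    PolyBdd.self.mono fun p => (Nat.le_add_right _ 2).trans
      (Nat.le_mul_of_pos_left _ (by positivity))
  have h3 : ∀ a b c, PolyBdd (fun p : ℕ × ℕ => 2 ^ p.1 * (p.2 + 2))
      fun p => 2 ^ (a * (p.1 + c) + b) := fun a b c =>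
    (PolyBdd.mul hy (PolyBdd.pow hy hE a) (PolyBdd.const hy (2 ^ (a * c + b)))).mono fun p => by
      rw [← pow_mul, ← pow_add, mul_comm p.1, ← add_assoc, mul_add]
  have h2 : ∀ a c, PolyBdd (fun p : ℕ × ℕ => 2 ^ p.1 * (p.2 + 2)) fun p => 2 ^ (a * (p.1 + c)) :=
    fun a c => h3 a 0 c
  have h1 : ∀ c, PolyBdd (fun p : ℕ × ℕ => 2 ^ p.1 * (p.2 + 2)) fun p => 2 ^ (p.1 + c) :=
    fun c => (h2 1 c).mono fun p => by rw [one_mul]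
  simp only [wordNeed, listBound, maxList, Sizing.nv]
  repeat' first
    | with_reducible exact PolyBdd.const hy _
    | with_reducible exact hn
    | with_reducible exact hm
    | with_reducible exact h1 _
    | with_reducible exact h2 _ _
    | with_reducible exact h3 _ _ _
    | with_reducible refine PolyBdd.add hy ?_ ?_
    | with_reducible refine PolyBdd.mul hy ?_ ?_
    | with_reducible refine PolyBdd.pow hy ?_ _

theorem input_bounded {k n m W : ℕ} (φ : KCNF k n m) (h : 2 * n + m + 1 ≤ W) :
    φ.input.Bounded W := by
  refine ⟨fun r => ?_, fun a i => ?_⟩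
  · match r with
    | 0 => show n ≤ W; omega
    | 1 => show m ≤ W; omega
    | r + 2 => exact Nat.zero_le _
  · match a with
    | 0 =>
      simp only [KCNF.input]
      split
      · have h1 := (φ (finProdFinEquiv.symm ⟨i, ‹_›⟩).1 (finProdFinEquiv.symm ⟨i, ‹_›⟩).2).1.isLt
        have h2 := (φ (finProdFinEquiv.symm ⟨i, ‹_›⟩).1
          (finProdFinEquiv.symm ⟨i, ‹_›⟩).2).2.toNat_le
        omega
      · exact Nat.zero_le _
    | a + 1 => exact Nat.zero_le _

theorem q_le (z : Sizing) (n : ℕ) : z.q n ≤ n + z.q₀ :=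
  Nat.add_le_add_right (Nat.div_le_self _ _) _

/-- The estimates `q ≤ n + q₀` and `nodes ≤ 2 ^ (n + q₀ + 1)` remove the division and the real
exponent, so the single condition on `wordNeed` yields all requirements on the word size. -/
theorem decider_decides {W C B₀ κ k n m : ℕ} {P : Prog} {z : Sizing} {D T : ℕ → ℕ}
    (φ : KCNF k n m) (hcomp : Computes C P D T) (hC : 1 ≤ C) (hb : 1 ≤ z.b) (hq₀ : 1 ≤ z.q₀)
    (hc : 1 ≤ z.c) (hA : 3 * z.b * (C + 1) ≤ z.A) (hB : B₀ + (z.c + 3) ^ C ≤ z.B)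
    (hP : P.Below B₀) (hκk : k + 1 ≤ κ) (hk : 4 * k ≤ 2 ^ κ)
    (hκ : ∀ nv : ℕ, expo κ k (2 * nv) ≤ 1 / (8 * z.b) * nv)
    (hT : T (2 ^ (z.b * z.q n)) ≤ z.c * 2 ^ ((2 * z.b - 1) * z.q n))
    (hD : (1 + 16 * k * θ κ k) * (z.b * z.q n) ≤ D (2 ^ (z.b * z.q n)))
    (hW : wordNeed z κ k n m ≤ W) :
    wp W (decider P z κ k) φ.input fun t s' =>
      (t : ℝ) ≤ timePoly P z κ k n m * (2 : ℝ) ^ ((1 - 1 / (8 * z.b)) * (n : ℝ)) ∧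
      s'.reg 0 ≤ 1 ∧ (s'.reg 0 = 1 ↔ φ.Satisfiable) := by
  have hN := z.two_mul_two_pow_g n hb hq₀
  have hbq : 1 * 1 ≤ z.b * z.q n := Nat.mul_le_mul hb (hq₀.trans (Nat.le_add_left _ _))
  have hDT : D (2 ^ (z.b * z.q n)) ≤ T (2 ^ (z.b * z.q n)) :=
    ComputesLinftyMatVec.dim_le ⟨C, hcomp⟩ (by
      simpa using Nat.pow_le_pow_right (n := 2) (by norm_num) hbq)
  have hb' : (1 : ℝ) ≤ z.b := by exact_mod_cast hb
  have hX : z.c * 2 ^ ((2 * z.b - 1) * z.q n) ≤ z.c * 2 ^ ((2 * z.b - 1) * (n + z.q₀)) :=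
    Nat.mul_le_mul_left _ (Nat.pow_le_pow_right (by norm_num)
      (Nat.mul_le_mul_left _ (q_le z n)))
  have hnodes : nodes κ k (z.nv n) ≤ 2 ^ (n + (z.q₀ + 1)) := by
    have h1 := nodes_le hb hκ n
    have h2 : (2 : ℝ) ^ (1 / (8 * z.b) * (n : ℝ)) ≤ 2 ^ n := by
      rw [← Real.rpow_natCast]
      refine Real.rpow_le_rpow_of_exponent_le (by norm_num) ?_
      refine mul_le_of_le_one_left (Nat.cast_nonneg _) ?_
      rw [div_le_one (by positivity)]
      linarith
    have h3 : (nodes κ k (z.nv n) : ℝ) ≤ 2 ^ (n + (z.q₀ + 1)) := by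
      rw [pow_add, mul_comm]
      exact h1.trans (mul_le_mul_of_nonneg_left h2 (by positivity))
    exact_mod_cast h3
  have hS : z.S n ≤ 2 ^ (z.A * (n + z.q₀) + z.B) :=
    Nat.pow_le_pow_right (by norm_num) (Nat.add_le_add_right
      (Nat.mul_le_mul_left _ (q_le z n)) _)
  have hsub : (2 : ℕ) ^ (z.nv n - 2 * z.g n) ≤ 2 ^ z.nv n :=
    Nat.pow_le_pow_right (by norm_num) (Nat.sub_le _ _)
  have hbase : (nodes κ k (z.nv n) * 2 ^ (z.nv n - 2 * z.g n) + D (2 ^ (z.b * z.q n)) + 2) *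
      z.S n ≤ (2 ^ (n + (z.q₀ + 1)) * 2 ^ z.nv n + z.c * 2 ^ ((2 * z.b - 1) * (n + z.q₀)) + 2) *
        2 ^ (z.A * (n + z.q₀) + z.B) :=
    Nat.mul_le_mul (Nat.add_le_add_right (Nat.add_le_add (Nat.mul_le_mul hnodes hsub)
      (hDT.trans (hT.trans hX))) _) hS
  have hfree : (nodes κ k (z.nv n) + 1) * (2 * listBound k (z.nv n) m) ≤
      (2 ^ (n + (z.q₀ + 1)) + 1) * (2 * listBound k (z.nv n) m) :=
    Nat.mul_le_mul_right _ (Nat.add_le_add_right hnodes 1)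
  obtain ⟨w1, w2, w3, w4, w5, w6, w7, -⟩ := wordNeed_le hW
  have hz : Sizes W (z.nv n) (z.g n) (z.S n) (z.T₀ n) C P D T :=
    Sizing.sizes hcomp hC hb hq₀ hA hB hP hT hDT w1
      ((Nat.add_le_add_right hX 1).trans w2)
  have hp : Params W κ k (2 * z.nv n) (listBound k (z.nv n) m) :=
    ⟨hk, hκk, (Nat.le_add_right _ _).trans ((Nat.le_add_right _ _).trans w3),
      (Nat.le_add_left _ _).trans ((Nat.le_add_right _ _).trans w3),
      (Nat.le_add_left _ _).trans w3, Nat.le_add_right _ _⟩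
  refine (decider_spec φ hb hq₀ hc hz hp (by rw [hN]) ((Sizing.leafSize_le hb hq₀ n).trans hD)
    (hbase.trans w4) ((Nat.add_le_add_left hfree m).trans_lt w5) w6 w7).mono fun t s' _ ⟨h1, h2⟩ =>
        ⟨?_, h2⟩
  exact (Nat.cast_le.2 h1).trans (totalCost_le hb hq₀ hκ (hDT.trans hT))

end WordRAM

/-! ### The contradiction to SETH -/

open WordRAM Sparsify

/-- The asymptotic bounds hold from `q₀` on, and the padding makes `q n ≥ q₀` for every `n`. So no
formula is too small, and no finite list of exceptions is needed. -/
theorem kSATSolvableInTime_of_computes {C b q₀ c κ k B₀ : ℕ} {P : Prog} {D T : ℕ → ℕ}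
    (hcomp : Computes C P D T) (hC : 1 ≤ C) (hb : 1 ≤ b) (hq₀ : 1 ≤ q₀) (hc : 1 ≤ c)
    (hP : P.Below B₀) (hκk : k + 1 ≤ κ) (hk : 4 * k ≤ 2 ^ κ)
    (hκ : ∀ nv : ℕ, expo κ k (2 * nv) ≤ 1 / (8 * b) * nv)
    (hT : ∀ q ≥ q₀, T (2 ^ (b * q)) ≤ c * 2 ^ ((2 * b - 1) * q))
    (hD : ∀ q ≥ q₀, (1 + 16 * k * θ κ k) * (b * q) ≤ D (2 ^ (b * q))) :
    KSATSolvableInTime k (1 - 1 / (8 * b)) := by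
  set z : Sizing := ⟨b, q₀, c, 3 * b * (C + 1), B₀ + (c + 3) ^ C⟩ with hz
  obtain ⟨K₁, hK₁⟩ := timePoly_polyBdd P z κ k
  obtain ⟨K₂, hK₂⟩ := (wordNeed_polyBdd z κ k).exists_pow fun p : ℕ × ℕ =>
    (by omega : 2 ≤ p.2 + 2).trans (Nat.le_mul_of_pos_left _ (by positivity))
  -- Scratch registers start above all registers of the decider, in particular above register 0,
  -- which holds the answer. The constant `K₁ + K₂` serves both the time and the word size.
  refine ⟨(decider P z κ k).compile ((decider P z κ k).regBound + 1), K₁ + K₂,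
    fun n m φ => ?_⟩
  have hW := hK₂ (K₁ + K₂) (Nat.le_add_left _ _) (n, m)
  set W := (2 ^ n * (m + 2)) ^ (K₁ + K₂)
  have hq : z.q n ≥ q₀ := Nat.le_add_left _ _
  obtain ⟨t, s', he, ht, h01, hiff⟩ := decider_decides φ hcomp hC (z := z) hb hq₀ hc le_rfl le_rfl
    hP hκk hk hκ (hT _ hq) (hD _ hq) hW
  have hW' : 2 * n + m + 1 ≤ W := (wordNeed_le hW).2.2.2.2.2.2.2
  obtain ⟨s₁, he₁, -, hreg, -⟩ := he.compile (d := (decider P z κ k).regBound + 1) (by omega)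
    (by omega) (input_bounded φ hW') (fun _ _ => rfl) rfl
  rw [hreg 0 (by omega)] at h01 hiff
  refine ⟨t, s₁, he₁, ht.trans ?_, hiff.2, fun h => ?_⟩
  · have h1 : (timePoly P z κ k n m : ℝ) ≤ (K₁ + K₂ : ℕ) * ((n : ℝ) + m + 1) ^ (K₁ + K₂) := by
      have h2 : timePoly P z κ k n m ≤ (K₁ + K₂) * (n + m + 1) ^ (K₁ + K₂) :=
        (hK₁ (n, m)).trans (Nat.mul_le_mul (Nat.le_add_right _ _)
          (Nat.pow_le_pow_right (Nat.le_add_left _ _) (Nat.le_add_right _ _)))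
      exact_mod_cast h2
    calc _ ≤ ((K₁ + K₂ : ℕ) * ((n : ℝ) + m + 1) ^ (K₁ + K₂)) *
          (2 : ℝ) ^ ((1 - 1 / (8 * b)) * (n : ℝ)) :=
          mul_le_mul_of_nonneg_right h1 (by positivity)
      _ = _ := by ring
  · have := mt hiff.1 h
    omega

theorem mainTheorem2 (hSETH : SETH) (α : ℝ) (hα : 0 < α) (D : ℕ → ℕ)
    (hD : Asymptotics.IsLittleO Filter.atTop
      (fun n : ℕ => Real.log (n : ℝ)) (fun n : ℕ => (D n : ℝ))) :
    ¬ ∃ (P : WordRAM.Prog) (T : ℕ → ℕ), ComputesLinftyMatVec P D T ∧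
      Asymptotics.IsBigO Filter.atTop
        (fun n : ℕ => (T n : ℝ)) (fun n : ℕ => (n : ℝ) ^ (2 - α)) := by
  rintro ⟨P, T, ⟨C, hcomp⟩, hT⟩
  obtain ⟨n₀, hn₀⟩ := exists_nat_one_div_lt hα
  -- Here `b = n₀ + 1`. Calls alone would save `1 / (4 b)` in the exponent; half of it is given to
  -- the sparsification, and the other half contradicts SETH.
  have hε : (0 : ℝ) < 1 / (8 * (n₀ + 1 : ℕ)) := by positivity
  obtain ⟨k, hk⟩ := hSETH _ hε
  obtain ⟨κ, hκk, hk4, hκ⟩ := exists_kappa k hε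
  obtain ⟨c, q₁, hc, hq₁⟩ := exists_time_bound (b := n₀ + 1) (by omega)
    (by push_cast; exact hn₀.le) hT
  obtain ⟨q₂, hq₂⟩ := exists_dim_bound hD (b := n₀ + 1) (by omega) (1 + 16 * k * θ κ k)
  obtain ⟨B₀, hB₀⟩ := P.exists_below
  exact hk (kSATSolvableInTime_of_computes (q₀ := q₁ + q₂ + 1)
    (Computes.of_exponent hcomp (Nat.le_add_right C 1)) (by omega) (by omega) (by omega) hc hB₀ hκk
    hk4 hκ (fun q hq => hq₁ q (by omega)) fun q hq => hq₂ q (by omega))
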